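/- Let $N\ge 1$, let $r\in\mathbb{C}$, $r\ne 0$, and put $q=r^2$; half-integer powers of $q$ are read as $q^{k/2}=r^{k}$. For $1\le a\le N$ put $a'=N+1-a$, and let $\rho_a=\frac N2-a$ if $a<a'$, $\rho_a=0$ if $a=a'$, $\rho_a=-\rho_{a'}$ if $a>a'$. Let $C=(C_{ab})$, $C_{ab}=q^{-\rho_a}\delta_{ab'}$ (so $C^2=\mathbf 1$), let $E_{ab}$ denote the matrix units, and let $$R=\sum_{a\ne a'}\bigl(q\,E_{aa}\otimes E_{aa}+q^{-1}E_{aa}\otimes E_{a'a'}\bigr)+\sum_{a=a'}E_{aa}\otimes E_{aa}+\sum_{a\ne b,b'}E_{aa}\otimes E_{bb}+(q-q^{-1})\sum_{a>b}\bigl(E_{ab}\otimes E_{ba}-q^{\rho_a-\rho_b}E_{ab}\otimes E_{a'b'}\bigr),$$ with $R^{ab}{}_{cd}$ the coefficient of $E_{ac}\otimes E_{bd}$. Let $SO_q(N)$ be the unital complex algebra generated by the entries $T^a{}_b$ of an $N\times N$ matrix $T$ with relations $R_{12}T_1T_2=T_2T_1R_{12}$, $TCT^t=C$, $T^tCT=C$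 and $\det_qT=1$. The last relation means $\sum_{j_1,\dots,j_N}T^{i_1}{}_{j_1}\cdots T^{i_N}{}_{j_N}\,\varepsilon^{j_1\cdots j_N}=\varepsilon^{i_1\cdots i_N}$ for every $q$-antisymmetric tensor $\varepsilon$, i.e. every tensor such that in each pair of neighbouring slots $\hat R\varepsilon=-q^{-1}\varepsilon$ (where $\hat R^{ab}{}_{cd}=R^{ba}{}_{cd}$) and $\sum_{c,d}C_{cd}\,\varepsilon^{\cdots cd\cdots}=0$. It is a Hopf algebra with $\Delta(T)=T\otimes T$, $\varepsilon(T)=\mathbf 1$, $\kappa(T)=CT^tC$. A $*$-structure on a complex Hopf algebra is an antilinear antimultiplicative involution $*$ with $\Delta\circ *=(*\otimes *)\circ\Delta$ and $\varepsilon(f^*)=\overline{\varepsilon(f)}$. Its real points are the characters $\chi$ (a group under convolution) with $\chi(f^*)=\overline{\chi(f)}$ for all $f$. For $q=1$ we say that a $*$-structure on $SO_q(N)$ gives the real form $SO(l,m)$, $l+m=N$, if there is an invertible complex matrix $M$ such that the entries of $T'=MTM^{-1}$ are fixed by $*$, the metric $C'=(M^{-1})^tCM^{-1}$ is diagonal with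 $l$ entries $1$ and $m$ entries $-1$, and $\chi\mapsto\chi(T')$ is a group isomorphism from the real points onto the group $SO(l,m)$ of real matrices of determinant $1$ preserving $C'$. Let $\mathcal D$ be the permutation matrix exchanging the indices $n$ and $n+1$ if $N=2n$, and the diagonal matrix with $-1$ at the middle index and $1$ elsewhere if $N=2n+1$. Then: 1. There is an involutive Hopf algebra automorphism $\sharp$ of $SO_q(N)$ with $T^\sharp=\mathcal D T\mathcal D^{-1}$. 2. Let $q$ be real, and $q>0$ if $N$ is odd. There is a $*$-structure $\star$ on $SO_q(N)$ with $T^\star=C^tTC^t$. It commutes with $\sharp$, and $\star^\sharp=\sharp\circ\star=\star\circ\sharp$ is a $*$-structure. If $q=1$, then $\star$ gives the real form $SO(N)=SO(N,0)$ and $\star^\sharp$ gives the Lorentz real form $SO(N-1,1)$. 3. Let $|q|=1$. There is a $*$-structure $\times$ on $SO_q(N)$ with $T^\times=T$. It commutes with $\sharp$, and $\times^\sharp=\sharp\circ\times=\times\circ\sharp$ is a $*$-structure. If $N=2n$ and $q=1$, then $\times^\sharp$ gives the real form $SO(n+1,n-1)$. If $N=2n+1$ and $q=1$, then $\times^\sharp$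 gives the real form $SO(n,n+1)$ and $\times$ gives $SO(n+1,n)$; moreover, if $N=2n+1$ then for every $q$ with $|q|=1$ there is a Hopf algebra automorphism $\alpha$ of $SO_q(N)$ with $\alpha\circ\times^\sharp=\times\circ\alpha$. -/

import Mathlib

open scoped TensorProduct Matrix

set_option linter.unusedSectionVars false

namespace QuantumOrthogonal

/-! ### The scalar data: the exponents `ρ`, the metric `C`, the `R`-matrix, the matrix `𝒟`

Indices run over `Fin N` (so they start from `0`), the conjugate index `a'` is `a.rev`.
The deformation parameter is `q = r ^ 2`; the number `r` is the square root of `q` that enters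
the half-integer powers of `q` occurring for odd `N`. -/

/-- Twice the exponent `ρ_a`: with 0-based indices, `ρ_a = N/2 - 1 - a` for `a < a'`, `ρ_a = 0` for
`a = a'`, and `ρ_a = -ρ_{a'}` for `a > a'`. -/
def twoRho {N : ℕ} (a : Fin N) : ℤ :=
  if a < a.rev then (N : ℤ) - 2 - 2 * (a : ℕ)
  else if a.rev < a then -((N : ℤ) - 2 - 2 * (a.rev : ℕ))
  else 0

/-- The metric `C_{ab} = q^{-ρ_a} δ_{ab'}`; its inverse `C^{ab}` has the same entries. -/
noncomputable def metric (N : ℕ) (r : ℂ) : Matrix (Fin N) (Fin N) ℂ :=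
  Matrix.of fun a b => if b = a.rev then r ^ (-twoRho a) else 0

/-- The entry `R^{ab}_{cd}` of the orthogonal `R`-matrix. -/
noncomputable def REntry {N : ℕ} (r : ℂ) (a b c d : Fin N) : ℂ :=
  if c = a ∧ d = b then
    (if a = b then (if a = a.rev then 1 else r ^ 2)
      else if b = a.rev then (r ^ 2)⁻¹ else 1)
  else if c = b ∧ d = a then
    (if b < a then
      (if b = a.rev then (r ^ 2 - (r ^ 2)⁻¹) * (1 - r ^ (twoRho a - twoRho a.rev))
        else r ^ 2 - (r ^ 2)⁻¹)
      else 0)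
  else if b = a.rev ∧ d = c.rev ∧ c < a then
    -(r ^ 2 - (r ^ 2)⁻¹) * r ^ (twoRho a - twoRho c)
  else 0

/-- The `R`-matrix, `(ab)` being the row and `(cd)` the column of `R^{ab}_{cd}`. -/
noncomputable def RMatrix (N : ℕ) (r : ℂ) : Matrix (Fin N × Fin N) (Fin N × Fin N) ℂ :=
  Matrix.of fun x y => REntry r x.1 x.2 y.1 y.2

/-- The matrix `𝒟`: for `N = 2n` the permutation matrix exchanging the two middle indices, for
`N = 2n + 1` the diagonal matrix with `-1` at the middle index and `1` elsewhere. -/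
def dMatrix (N : ℕ) : Matrix (Fin N) (Fin N) ℂ :=
  Matrix.of fun a b =>
    if Even N then
      (if ((a : ℕ) + 1 = N / 2 ∧ (b : ℕ) = N / 2) ∨ ((a : ℕ) = N / 2 ∧ (b : ℕ) + 1 = N / 2) then 1
        else if a = b ∧ (a : ℕ) + 1 ≠ N / 2 ∧ (a : ℕ) ≠ N / 2 then 1
        else 0)
    else (if a = b then (if (a : ℕ) = N / 2 then -1 else 1) else 0)

/-- A tensor `ε^{i_1 … i_N}` is `q`-antisymmetric when in every pair of neighbouring slots it lies
in the range of the `q`-antisymmetrizer `P_A`, i.e. `R̂ ε = -q⁻¹ ε` with `R̂^{ab}_{cd} = R^{ba}_{cd}`,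
and `C_{cd} ε^{… cd …} = 0`. Such tensors are the multiples of the quantum epsilon tensor. -/
def IsQAntisymm {N : ℕ} (r : ℂ) (ε : (Fin N → Fin N) → ℂ) : Prop :=
  ∀ k l : Fin N, (k : ℕ) + 1 = l → ∀ I : Fin N → Fin N,
    (∑ c, ∑ d, REntry r (I l) (I k) c d * ε (Function.update (Function.update I k c) l d)
        = -(r ^ 2)⁻¹ * ε I) ∧
    ∑ c, ∑ d, metric N r c d * ε (Function.update (Function.update I k c) l d) = 0

/-! ### Matrices with entries in an algebra -/

section MatrixNotation

variable {n : Type*} {A : Type*} [Ring A] [Algebra ℂ A]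

/-- A complex matrix, viewed as a matrix with entries in a complex algebra. -/
def scalarMat {m : Type*} (A : Type*) [Ring A] [Algebra ℂ A] (X : Matrix m m ℂ) : Matrix m m A :=
  X.map (algebraMap ℂ A)

/-- `U₁ U₂`, with entries `U^a_c U^b_d`. -/
def prodOneTwo (U : Matrix n n A) : Matrix (n × n) (n × n) A :=
  Matrix.of fun x y => U x.1 y.1 * U x.2 y.2

/-- `U₂ U₁`, with entries `U^b_d U^a_c`. -/
def prodTwoOne (U : Matrix n n A) : Matrix (n × n) (n × n) A :=
  Matrix.of fun x y => U x.2 y.2 * U x.1 y.1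

/-- The matrix with entries `U^{i_1}_{j_1} ⋯ U^{i_k}_{j_k}`. -/
def tensorPow (k : ℕ) (U : Matrix n n A) : Matrix (Fin k → n) (Fin k → n) A :=
  Matrix.of fun I J => (List.ofFn fun m => U (I m) (J m)).prod

end MatrixNotation

/-! ### The algebra `SO_q(N)` -/

/-- The matrix of free generators. -/
noncomputable def freeT (N : ℕ) : Matrix (Fin N) (Fin N) (FreeAlgebra ℂ (Fin N × Fin N)) :=
  Matrix.of fun a b => FreeAlgebra.ι ℂ (a, b)

/-- The defining relations of `SO_q(N)`: the `RTT` relations `R₁₂ T₁ T₂ = T₂ T₁ R₁₂`, the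
orthogonality relations `T C Tᵗ = C` and `Tᵗ C T = C`, and `det_q T = 1`, where the quantum
determinant is defined by `T^{i_1}_{j_1} ⋯ T^{i_N}_{j_N} ε_q^{j_1 … j_N} = det_q T ε_q^{i_1 … i_N}`
with the quantum epsilon tensor `ε_q`. -/
inductive Rel (N : ℕ) (r : ℂ) :
    FreeAlgebra ℂ (Fin N × Fin N) → FreeAlgebra ℂ (Fin N × Fin N) → Prop
  | rtt (x y : Fin N × Fin N) :
      Rel N r
        ((scalarMat (FreeAlgebra ℂ (Fin N × Fin N)) (RMatrix N r) * prodOneTwo (freeT N) :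
          Matrix (Fin N × Fin N) (Fin N × Fin N) (FreeAlgebra ℂ (Fin N × Fin N))) x y)
        ((prodTwoOne (freeT N) * scalarMat (FreeAlgebra ℂ (Fin N × Fin N)) (RMatrix N r) :
          Matrix (Fin N × Fin N) (Fin N × Fin N) (FreeAlgebra ℂ (Fin N × Fin N))) x y)
  | tct (a b : Fin N) :
      Rel N r
        ((freeT N * scalarMat (FreeAlgebra ℂ (Fin N × Fin N)) (metric N r) * (freeT N)ᵀ :
          Matrix (Fin N) (Fin N) (FreeAlgebra ℂ (Fin N × Fin N))) a b)
        (scalarMat (FreeAlgebra ℂ (Fin N × Fin N)) (metric N r) a b)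
  | ctt (a b : Fin N) :
      Rel N r
        (((freeT N)ᵀ * scalarMat (FreeAlgebra ℂ (Fin N × Fin N)) (metric N r) * freeT N :
          Matrix (Fin N) (Fin N) (FreeAlgebra ℂ (Fin N × Fin N))) a b)
        (scalarMat (FreeAlgebra ℂ (Fin N × Fin N)) (metric N r) a b)
  | det (ε : (Fin N → Fin N) → ℂ) (hε : IsQAntisymm r ε) (I : Fin N → Fin N) :
      Rel N r
        ((tensorPow N (freeT N) *ᵥ fun J => algebraMap ℂ (FreeAlgebra ℂ (Fin N × Fin N)) (ε J)) I)
        (algebraMap ℂ (FreeAlgebra ℂ (Fin N × Fin N)) (ε I))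

/-- The algebra `SO_q(N)`, `q = r ^ 2`. -/
def SOq (N : ℕ) (r : ℂ) : Type := RingQuot (Rel N r)

namespace SOq

variable {N : ℕ} {r : ℂ}

noncomputable instance instRing : Ring (SOq N r) := inferInstanceAs (Ring (RingQuot (Rel N r)))

noncomputable instance instAlgebra : Algebra ℂ (SOq N r) :=
  inferInstanceAs (Algebra ℂ (RingQuot (Rel N r)))

/-- The quotient map. -/
noncomputable def mk : FreeAlgebra ℂ (Fin N × Fin N) →ₐ[ℂ] SOq N r :=
  RingQuot.mkAlgHom ℂ (Rel N r)

/-- The matrix `T` of generators of `SO_q(N)`. -/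
noncomputable def T (N : ℕ) (r : ℂ) : Matrix (Fin N) (Fin N) (SOq N r) :=
  (freeT N).map mk

end SOq

/-- A matrix with entries in a complex algebra that satisfies the defining relations of
`SO_q(N)`. -/
structure IsQOrthogonal {N : ℕ} {A : Type*} [Ring A] [Algebra ℂ A] (r : ℂ)
    (U : Matrix (Fin N) (Fin N) A) : Prop where
  rtt : scalarMat A (RMatrix N r) * prodOneTwo U = prodTwoOne U * scalarMat A (RMatrix N r)
  tct : U * scalarMat A (metric N r) * Uᵀ = scalarMat A (metric N r)
  ctt : Uᵀ * scalarMat A (metric N r) * U = scalarMat A (metric N r)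
  det : ∀ ε : (Fin N → Fin N) → ℂ, IsQAntisymm r ε →
    tensorPow N U *ᵥ (fun J => algebraMap ℂ A (ε J)) = fun I => algebraMap ℂ A (ε I)

section Lemmas

variable {N : ℕ} {r : ℂ} {n : Type*} {A B : Type*} [Ring A] [Algebra ℂ A] [Ring B] [Algebra ℂ B]

lemma map_scalarMat {m : Type*} (φ : A →ₐ[ℂ] B) (X : Matrix m m ℂ) :
    (scalarMat A X).map φ = scalarMat B X := by
  ext; simp [scalarMat]

lemma map_prodOneTwo (φ : A →ₐ[ℂ] B) (U : Matrix n n A) :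
    (prodOneTwo U).map φ = prodOneTwo (U.map φ) := by
  ext; simp [prodOneTwo]

lemma map_prodTwoOne (φ : A →ₐ[ℂ] B) (U : Matrix n n A) :
    (prodTwoOne U).map φ = prodTwoOne (U.map φ) := by
  ext; simp [prodTwoOne]

lemma map_tensorPow (φ : A →ₐ[ℂ] B) (k : ℕ) (U : Matrix n n A) :
    (tensorPow k U).map φ = tensorPow k (U.map φ) := by
  ext I J
  simp only [tensorPow, Matrix.map_apply, Matrix.of_apply, map_list_prod, List.map_ofFn]
  rfl

lemma map_mul_apply {m : Type*} [Fintype m] (φ : A →ₐ[ℂ] B) (X Y : Matrix m m A) :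
    (X * Y).map φ = X.map φ * Y.map φ := by
  ext; simp [Matrix.mul_apply]

lemma IsQOrthogonal.map (φ : A →ₐ[ℂ] B) {U : Matrix (Fin N) (Fin N) A} (h : IsQOrthogonal r U) :
    IsQOrthogonal r (U.map φ) where
  rtt := by
    have := congrArg (fun X => X.map φ) h.rtt
    simpa only [map_mul_apply, map_scalarMat, map_prodOneTwo, map_prodTwoOne] using this
  tct := by
    have := congrArg (fun X => X.map φ) h.tct
    simpa only [map_mul_apply, map_scalarMat, Matrix.transpose_map] using this
  ctt := by
    have := congrArg (fun X => X.map φ) h.ctt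
    simpa only [map_mul_apply, map_scalarMat, Matrix.transpose_map] using this
  det ε hε := by
    funext I
    have := congrArg φ (congrFun (h.det ε hε) I)
    rw [← map_tensorPow]
    simpa [Matrix.mulVec, dotProduct] using this

lemma SOq.isQOrthogonal_T : IsQOrthogonal r (SOq.T N r) := by
  have key : ∀ x y, Rel N r x y → (SOq.mk x : SOq N r) = SOq.mk y :=
    fun x y h => RingQuot.mkAlgHom_rel ℂ h
  refine ⟨?_, ?_, ?_, ?_⟩
  · ext x y
    have := key _ _ (Rel.rtt x y)
    simp only [← Matrix.map_apply (f := (SOq.mk : _ →ₐ[ℂ] SOq N r))] at this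
    simpa only [map_mul_apply, map_scalarMat, map_prodOneTwo, map_prodTwoOne, SOq.T] using this
  · ext x y
    have := key _ _ (Rel.tct x y)
    simp only [← Matrix.map_apply (f := (SOq.mk : _ →ₐ[ℂ] SOq N r))] at this
    simpa only [map_mul_apply, map_scalarMat, Matrix.transpose_map, SOq.T] using this
  · ext x y
    have := key _ _ (Rel.ctt x y)
    simp only [← Matrix.map_apply (f := (SOq.mk : _ →ₐ[ℂ] SOq N r))] at this
    simpa only [map_mul_apply, map_scalarMat, Matrix.transpose_map, SOq.T] using this
  · intro ε hε
    funext I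
    have := key _ _ (Rel.det ε hε I)
    rw [SOq.T, ← map_tensorPow]
    simpa [Matrix.mulVec, dotProduct] using this

/-- The universal property of `SO_q(N)`. -/
noncomputable def SOq.lift (U : Matrix (Fin N) (Fin N) A) (hU : IsQOrthogonal r U) :
    SOq N r →ₐ[ℂ] A :=
  RingQuot.liftAlgHom ℂ ⟨FreeAlgebra.lift ℂ fun p => U p.1 p.2, by
    have hT : (freeT N).map (FreeAlgebra.lift ℂ fun p : Fin N × Fin N => U p.1 p.2) = U := by
      ext a b; simp [freeT]
    intro x y h
    induction h with
    | rtt x y =>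
      rw [← Matrix.map_apply (f := (FreeAlgebra.lift ℂ fun p : Fin N × Fin N => U p.1 p.2)),
        ← Matrix.map_apply (f := (FreeAlgebra.lift ℂ fun p : Fin N × Fin N => U p.1 p.2))]
      simp only [map_mul_apply, map_scalarMat, map_prodOneTwo, map_prodTwoOne, hT]
      rw [hU.rtt]
    | tct x y =>
      rw [← Matrix.map_apply (f := (FreeAlgebra.lift ℂ fun p : Fin N × Fin N => U p.1 p.2)),
        ← Matrix.map_apply (f := (FreeAlgebra.lift ℂ fun p : Fin N × Fin N => U p.1 p.2))]
      simp only [map_mul_apply, map_scalarMat, Matrix.transpose_map, hT]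
      rw [hU.tct]
    | ctt x y =>
      rw [← Matrix.map_apply (f := (FreeAlgebra.lift ℂ fun p : Fin N × Fin N => U p.1 p.2)),
        ← Matrix.map_apply (f := (FreeAlgebra.lift ℂ fun p : Fin N × Fin N => U p.1 p.2))]
      simp only [map_mul_apply, map_scalarMat, Matrix.transpose_map, hT]
      rw [hU.ctt]
    | det ε hε I =>
      have h1 := congrFun (hU.det ε hε) I
      rw [← hT, ← map_tensorPow] at h1
      simpa [Matrix.mulVec, dotProduct] using h1⟩

@[simp] lemma SOq.lift_T (U : Matrix (Fin N) (Fin N) A) (hU : IsQOrthogonal r U) (a b : Fin N) :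
    SOq.lift U hU (SOq.T N r a b) = U a b := by
  show RingQuot.liftAlgHom ℂ _ (RingQuot.mkAlgHom ℂ (Rel N r) (FreeAlgebra.ι ℂ (a, b))) = _
  rw [RingQuot.liftAlgHom_mkAlgHom_apply]
  simp

lemma SOq.algHom_ext {φ ψ : SOq N r →ₐ[ℂ] A}
    (h : ∀ a b, φ (SOq.T N r a b) = ψ (SOq.T N r a b)) : φ = ψ := by
  apply RingQuot.ringQuot_ext'
  apply FreeAlgebra.hom_ext
  funext p
  exact h p.1 p.2

lemma SOq.induction {P : SOq N r → Prop} (hs : ∀ c : ℂ, P (algebraMap ℂ _ c))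
    (hT : ∀ a b, P (SOq.T N r a b)) (hm : ∀ x y, P x → P y → P (x * y))
    (ha : ∀ x y, P x → P y → P (x + y)) (x : SOq N r) : P x := by
  obtain ⟨y, rfl⟩ := RingQuot.mkAlgHom_surjective ℂ (Rel N r) x
  induction y using FreeAlgebra.induction with
  | grade0 c =>
    rw [AlgHom.commutes]
    exact hs c
  | grade1 p => exact hT p.1 p.2
  | mul x y hx hy => rw [map_mul]; exact hm _ _ hx hy
  | add x y hx hy => rw [map_add]; exact ha _ _ hx hy

lemma sum_cons {k : ℕ} [Fintype n] (f : (Fin (k + 1) → n) → A) :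
    ∑ K, f K = ∑ a, ∑ L : Fin k → n, f (Fin.cons a L) := by
  rw [← Fintype.sum_prod_type']
  exact (Fintype.sum_equiv (Fin.consEquiv fun _ => n) _ _ fun _ => rfl).symm

lemma tensorPow_succ {k : ℕ} (U : Matrix n n A) (I J : Fin (k + 1) → n) :
    tensorPow (k + 1) U I J = U (I 0) (J 0) * tensorPow k U (Fin.tail I) (Fin.tail J) := by
  simp [tensorPow, List.ofFn_succ, Fin.tail]

lemma tensorPow_commute {k : ℕ} (V : Matrix n n A) (x : A) (h : ∀ c d, Commute x (V c d))
    (I J : Fin k → n) : Commute x (tensorPow k V I J) := by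
  induction k with
  | zero => simp [tensorPow]
  | succ k ih => rw [tensorPow_succ]; exact (h _ _).mul_right (ih _ _)

lemma tensorPow_mul [Fintype n] (k : ℕ) (U V : Matrix n n A)
    (h : ∀ a b c d, Commute (U a b) (V c d)) :
    tensorPow k (U * V) = tensorPow k U * tensorPow k V := by
  induction k with
  | zero => ext I J; simp [tensorPow, Matrix.mul_apply]
  | succ k ih =>
    ext I J
    rw [tensorPow_succ, ih, Matrix.mul_apply, Matrix.mul_apply, Matrix.mul_apply, sum_cons,
      Finset.sum_mul_sum]
    refine Finset.sum_congr rfl fun a _ => Finset.sum_congr rfl fun L _ => ?_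
    rw [tensorPow_succ, tensorPow_succ]
    simp only [Fin.cons_zero, Fin.tail_cons]
    have h1 : Commute (V a (J 0)) (tensorPow k U (Fin.tail I) L) :=
      tensorPow_commute U _ (fun c d => (h _ _ _ _).symm) _ _
    rw [mul_assoc, mul_assoc, ← mul_assoc (V a (J 0)), h1.eq, mul_assoc]

lemma commute_scalarMat {m : Type*} (X : Matrix m m ℂ) (a b : m) (x : A) :
    Commute (scalarMat A X a b) x := Algebra.commutes _ _

lemma transpose_mul_of_commute [Fintype n] (U V : Matrix n n A)
    (h : ∀ a b c d, Commute (U a b) (V c d)) : (U * V)ᵀ = Vᵀ * Uᵀ := by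
  ext a b
  simp only [Matrix.transpose_apply, Matrix.mul_apply]
  exact Finset.sum_congr rfl fun c _ => (h _ _ _ _).eq

lemma prodOneTwo_mul [Fintype n] (U V : Matrix n n A)
    (h : ∀ a b c d, Commute (U a b) (V c d)) :
    prodOneTwo (U * V) = prodOneTwo U * prodOneTwo V := by
  ext x y
  simp only [prodOneTwo, Matrix.of_apply, Matrix.mul_apply, Finset.sum_mul_sum,
    Fintype.sum_prod_type]
  refine Finset.sum_congr rfl fun a _ => Finset.sum_congr rfl fun b _ => ?_
  rw [mul_assoc, mul_assoc, ← mul_assoc (V _ _), ← (h x.2 b a y.1).eq, mul_assoc]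

lemma prodTwoOne_mul [Fintype n] (U V : Matrix n n A)
    (h : ∀ a b c d, Commute (U a b) (V c d)) :
    prodTwoOne (U * V) = prodTwoOne U * prodTwoOne V := by
  ext x y
  simp only [prodTwoOne, Matrix.of_apply, Matrix.mul_apply, Finset.sum_mul_sum,
    Fintype.sum_prod_type]
  rw [Finset.sum_comm]
  refine Finset.sum_congr rfl fun a _ => Finset.sum_congr rfl fun b _ => ?_
  rw [mul_assoc, mul_assoc, ← mul_assoc (V _ _), ← (h x.1 a b y.2).eq, mul_assoc]

/-- The product of two mutually commuting quantum orthogonal matrices is quantum orthogonal. -/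
lemma IsQOrthogonal.mul {U V : Matrix (Fin N) (Fin N) A} (hU : IsQOrthogonal r U)
    (hV : IsQOrthogonal r V) (h : ∀ a b c d, Commute (U a b) (V c d)) :
    IsQOrthogonal r (U * V) where
  rtt := by
    rw [prodOneTwo_mul U V h, prodTwoOne_mul U V h, ← mul_assoc, hU.rtt, mul_assoc, hV.rtt,
      mul_assoc]
  tct := by
    rw [transpose_mul_of_commute U V h]
    calc U * V * scalarMat A (metric N r) * (Vᵀ * Uᵀ)
        = U * (V * scalarMat A (metric N r) * Vᵀ) * Uᵀ := by simp only [mul_assoc]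
      _ = _ := by rw [hV.tct, hU.tct]
  ctt := by
    rw [transpose_mul_of_commute U V h]
    calc Vᵀ * Uᵀ * scalarMat A (metric N r) * (U * V)
        = Vᵀ * (Uᵀ * scalarMat A (metric N r) * U) * V := by simp only [mul_assoc]
      _ = _ := by rw [hU.ctt, hV.ctt]
  det ε hε := by
    rw [tensorPow_mul N U V h, ← Matrix.mulVec_mulVec, hV.det ε hε, hU.det ε hε]

lemma scalarMat_one {m : Type*} [DecidableEq m] : scalarMat A (1 : Matrix m m ℂ) = 1 := by
  simp [scalarMat]

lemma prodOneTwo_one [DecidableEq n] : prodOneTwo (1 : Matrix n n A) = 1 := by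
  ext ⟨a, b⟩ ⟨c, d⟩
  by_cases h1 : a = c <;> by_cases h2 : b = d <;> simp [prodOneTwo, Matrix.one_apply, h1, h2]

lemma prodTwoOne_one [DecidableEq n] : prodTwoOne (1 : Matrix n n A) = 1 := by
  ext ⟨a, b⟩ ⟨c, d⟩
  by_cases h1 : a = c <;> by_cases h2 : b = d <;> simp [prodTwoOne, Matrix.one_apply, h1, h2]

lemma tensorPow_one [DecidableEq n] (k : ℕ) : tensorPow k (1 : Matrix n n A) = 1 := by
  induction k with
  | zero =>
    ext I J
    obtain rfl : I = J := Subsingleton.elim _ _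
    simp [tensorPow]
  | succ k ih =>
    ext I J
    rw [tensorPow_succ, ih]
    by_cases h : I = J
    · subst h
      rw [Matrix.one_apply_eq, Matrix.one_apply_eq, Matrix.one_apply_eq, one_mul]
    · rw [Matrix.one_apply_ne h]
      by_cases h0 : I 0 = J 0
      · have : Fin.tail I ≠ Fin.tail J := by
          intro h1
          apply h
          rw [← Fin.cons_self_tail I, ← Fin.cons_self_tail J, h0, h1]
        rw [Matrix.one_apply_ne this, mul_zero]
      · rw [Matrix.one_apply_ne h0, zero_mul]

lemma isQOrthogonal_one : IsQOrthogonal r (1 : Matrix (Fin N) (Fin N) A) where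
  rtt := by rw [prodOneTwo_one, prodTwoOne_one, one_mul, mul_one]
  tct := by simp
  ctt := by simp
  det ε _ := by rw [tensorPow_one, Matrix.one_mulVec]

lemma twoRho_rev (a : Fin N) : twoRho a.rev = -twoRho a := by
  unfold twoRho
  rw [Fin.rev_rev]
  rcases lt_trichotomy a a.rev with h | h | h
  · simp [h, h.not_gt]
  · simp [← h]
  · simp [h, h.not_gt]

lemma metric_mul_self [NeZero r] : metric N r * metric N r = 1 := by
  ext a b
  have hr : r ≠ 0 := NeZero.ne r
  rw [Matrix.mul_apply, Finset.sum_eq_single a.rev]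
  · simp only [metric, Matrix.of_apply, if_true, Fin.rev_rev]
    by_cases h : b = a
    · subst h
      rw [if_pos rfl, ← zpow_add₀ hr, twoRho_rev, Matrix.one_apply_eq]
      simp
    · rw [if_neg h, Matrix.one_apply_ne (Ne.symm h), mul_zero]
  · intro c _ hc
    simp [metric, hc]
  · simp

lemma scalarMat_mul {m : Type*} [Fintype m] (X Y : Matrix m m ℂ) :
    scalarMat A (X * Y) = scalarMat A X * scalarMat A Y := by
  ext; simp [scalarMat, Matrix.mul_apply]

lemma scalarMat_metric_mul_self [NeZero r] :
    scalarMat A (metric N r) * scalarMat A (metric N r) = 1 := by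
  rw [← scalarMat_mul, metric_mul_self, scalarMat_one]

lemma transpose_scalarMat_metric_mul_self [NeZero r] :
    (scalarMat A (metric N r))ᵀ * (scalarMat A (metric N r))ᵀ = 1 := by
  have : (scalarMat A (metric N r))ᵀ = scalarMat A (metric N r)ᵀ := rfl
  rw [this, ← scalarMat_mul, ← Matrix.transpose_mul, metric_mul_self, Matrix.transpose_one,
    scalarMat_one]

lemma prodOneTwo_mul_prodTwoOne [Fintype n] [DecidableEq n] {U V : Matrix n n A}
    (h : U * V = 1) : prodOneTwo U * prodTwoOne V = 1 := by
  have h' : ∀ a b, ∑ c, U a c * V c b = (1 : Matrix n n A) a b := fun a b => by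
    rw [← h, Matrix.mul_apply]
  ext ⟨a, b⟩ ⟨c, d⟩
  simp only [Matrix.mul_apply, prodOneTwo, prodTwoOne, Matrix.of_apply, Fintype.sum_prod_type]
  have : ∀ x, ∑ y, U a x * U b y * (V y d * V x c)
      = U a x * (1 : Matrix n n A) b d * V x c := by
    intro x
    rw [← h' b d, Finset.mul_sum, Finset.sum_mul]
    exact Finset.sum_congr rfl fun y _ => by noncomm_ring
  simp only [this]
  by_cases hbd : b = d
  · subst hbd
    simp only [Matrix.one_apply_eq, mul_one, h']
    by_cases hac : a = c <;> simp [Matrix.one_apply, hac]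
  · simp [hbd]

lemma prodTwoOne_mul_prodOneTwo [Fintype n] [DecidableEq n] {U V : Matrix n n A}
    (h : U * V = 1) : prodTwoOne U * prodOneTwo V = 1 := by
  have h' : ∀ a b, ∑ c, U a c * V c b = (1 : Matrix n n A) a b := fun a b => by
    rw [← h, Matrix.mul_apply]
  ext ⟨a, b⟩ ⟨c, d⟩
  simp only [Matrix.mul_apply, prodOneTwo, prodTwoOne, Matrix.of_apply, Fintype.sum_prod_type]
  rw [Finset.sum_comm]
  have : ∀ y, ∑ x, U b y * U a x * (V x c * V y d)
      = U b y * (1 : Matrix n n A) a c * V y d := by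
    intro y
    rw [← h' a c, Finset.mul_sum, Finset.sum_mul]
    exact Finset.sum_congr rfl fun x _ => by noncomm_ring
  simp only [this]
  by_cases hac : a = c
  · subst hac
    simp only [Matrix.one_apply_eq, mul_one, h']
    by_cases hbd : b = d <;> simp [Matrix.one_apply, hbd]
  · simp [hac]

lemma tensorPow_op_mul [Fintype n] [DecidableEq n] {U V : Matrix n n A} (h : U * V = 1) (k : ℕ) :
    (tensorPow k (U.map MulOpposite.op)).map MulOpposite.unop * tensorPow k V = 1 := by
  have h' : ∀ a b, ∑ c, U a c * V c b = (1 : Matrix n n A) a b := fun a b => by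
    rw [← h, Matrix.mul_apply]
  induction k with
  | zero =>
    ext I J
    obtain rfl : I = J := Subsingleton.elim _ _
    simp [tensorPow, Matrix.mul_apply]
  | succ k ih =>
    rw [← tensorPow_one]
    ext I J
    have ih' := congrFun (congrFun ih (Fin.tail I)) (Fin.tail J)
    rw [Matrix.mul_apply] at ih'
    rw [tensorPow_succ, tensorPow_one, Matrix.mul_apply, sum_cons, Finset.sum_comm, ← ih',
      Finset.mul_sum]
    refine Finset.sum_congr rfl fun L _ => ?_
    simp only [Matrix.map_apply, tensorPow_succ, Fin.cons_zero, Fin.tail_cons,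
      MulOpposite.unop_mul, MulOpposite.unop_op]
    rw [← h' (I 0) (J 0)]
    have hc : Commute (∑ c, U (I 0) c * V c (J 0))
        (MulOpposite.unop (tensorPow k (U.map MulOpposite.op) (Fin.tail I) L)) := by
      rw [h']
      by_cases h0 : I 0 = J 0
      · rw [h0, Matrix.one_apply_eq]; exact Commute.one_left _
      · rw [Matrix.one_apply_ne h0]; exact Commute.zero_left _
    rw [← mul_assoc, hc.eq, Finset.mul_sum, Finset.sum_mul]
    exact Finset.sum_congr rfl fun c _ => by noncomm_ring

/-- The matrix `C Uᵗ C`. -/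
noncomputable def antipodeMat (r : ℂ) (U : Matrix (Fin N) (Fin N) A) : Matrix (Fin N) (Fin N) A :=
  scalarMat A (metric N r) * Uᵀ * scalarMat A (metric N r)

lemma IsQOrthogonal.antipodeMat_mul [NeZero r] {U : Matrix (Fin N) (Fin N) A}
    (h : IsQOrthogonal r U) : antipodeMat r U * U = 1 := by
  rw [antipodeMat, mul_assoc, mul_assoc, ← mul_assoc Uᵀ, h.ctt, scalarMat_metric_mul_self]

lemma IsQOrthogonal.mul_antipodeMat [NeZero r] {U : Matrix (Fin N) (Fin N) A}
    (h : IsQOrthogonal r U) : U * antipodeMat r U = 1 := by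
  rw [antipodeMat, ← mul_assoc, ← mul_assoc, h.tct, scalarMat_metric_mul_self]

lemma antipodeMat_transpose (U : Matrix (Fin N) (Fin N) A) :
    (antipodeMat r U)ᵀ
      = (scalarMat A (metric N r))ᵀ * U * (scalarMat A (metric N r))ᵀ := by
  rw [antipodeMat, transpose_mul_of_commute _ _ (fun a b c d => (commute_scalarMat _ _ _ _).symm),
    transpose_mul_of_commute _ _ (fun a b c d => commute_scalarMat _ _ _ _),
    Matrix.transpose_transpose, mul_assoc]

lemma map_op_scalarMat_mul {m : Type*} [Fintype m] (X : Matrix m m ℂ) (Y : Matrix m m A) :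
    (scalarMat A X * Y).map MulOpposite.op = scalarMat Aᵐᵒᵖ X * Y.map MulOpposite.op := by
  ext a b
  simp only [Matrix.map_apply, Matrix.mul_apply, Finset.op_sum, MulOpposite.op_mul]
  exact Finset.sum_congr rfl fun c _ => (commute_scalarMat (A := Aᵐᵒᵖ) X a c _).symm.eq

lemma map_op_mul_scalarMat {m : Type*} [Fintype m] (X : Matrix m m ℂ) (Y : Matrix m m A) :
    (Y * scalarMat A X).map MulOpposite.op = Y.map MulOpposite.op * scalarMat Aᵐᵒᵖ X := by
  ext a b
  simp only [Matrix.map_apply, Matrix.mul_apply, Finset.op_sum, MulOpposite.op_mul]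
  exact Finset.sum_congr rfl fun c _ => (commute_scalarMat (A := Aᵐᵒᵖ) X c b _).eq

lemma op_mul_mul_transpose {m : Type*} [Fintype m] (X : Matrix m m ℂ) (Y Z : Matrix m m A) :
    Y.map MulOpposite.op * scalarMat Aᵐᵒᵖ X * Z.map MulOpposite.op
      = ((Zᵀ * (scalarMat A X)ᵀ * Yᵀ).map MulOpposite.op)ᵀ := by
  ext a b
  simp only [Matrix.map_apply, Matrix.transpose_apply, Matrix.mul_apply, Finset.sum_mul,
    Finset.op_sum, MulOpposite.op_mul]
  rw [Finset.sum_comm]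
  refine Finset.sum_congr rfl fun d _ => Finset.sum_congr rfl fun c _ => ?_
  have hc : MulOpposite.op (scalarMat A X d c) = scalarMat Aᵐᵒᵖ X d c := rfl
  rw [hc, mul_assoc, (commute_scalarMat X d c _).eq]

/-- The antipode sends a quantum orthogonal matrix to a quantum orthogonal matrix of the opposite
algebra. -/
lemma IsQOrthogonal.op_antipodeMat [NeZero r] {U : Matrix (Fin N) (Fin N) A}
    (h : IsQOrthogonal r U) : IsQOrthogonal r ((antipodeMat r U).map MulOpposite.op) where
  rtt := by
    have e1 : prodOneTwo ((antipodeMat r U).map MulOpposite.op)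
        = (prodTwoOne (antipodeMat r U)).map MulOpposite.op := rfl
    have e2 : prodTwoOne ((antipodeMat r U).map MulOpposite.op)
        = (prodOneTwo (antipodeMat r U)).map MulOpposite.op := rfl
    rw [e1, e2, ← map_op_scalarMat_mul, ← map_op_mul_scalarMat]
    congr 1
    have f1 := prodOneTwo_mul_prodTwoOne h.antipodeMat_mul
    have f2 := prodOneTwo_mul_prodTwoOne h.mul_antipodeMat
    calc scalarMat A (RMatrix N r) * prodTwoOne (antipodeMat r U)
        = prodOneTwo (antipodeMat r U) * (prodTwoOne U * scalarMat A (RMatrix N r))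
            * prodTwoOne (antipodeMat r U) := by rw [← mul_assoc, f1, one_mul]
      _ = prodOneTwo (antipodeMat r U) * scalarMat A (RMatrix N r)
            * (prodOneTwo U * prodTwoOne (antipodeMat r U)) := by
          rw [← h.rtt]; simp only [mul_assoc]
      _ = _ := by rw [f2, mul_one]
  tct := by
    rw [← Matrix.transpose_map, op_mul_mul_transpose, Matrix.transpose_transpose,
      antipodeMat_transpose, antipodeMat]
    have : scalarMat A (metric N r) * Uᵀ * scalarMat A (metric N r) * (scalarMat A (metric N r))ᵀ
        * ((scalarMat A (metric N r))ᵀ * U * (scalarMat A (metric N r))ᵀ)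
        = (scalarMat A (metric N r))ᵀ := by
      calc _ = scalarMat A (metric N r) * Uᵀ * scalarMat A (metric N r)
            * ((scalarMat A (metric N r))ᵀ * (scalarMat A (metric N r))ᵀ) * U
            * (scalarMat A (metric N r))ᵀ := by simp only [mul_assoc]
        _ = scalarMat A (metric N r) * (Uᵀ * scalarMat A (metric N r) * U)
            * (scalarMat A (metric N r))ᵀ := by
          rw [transpose_scalarMat_metric_mul_self, mul_one]; simp only [mul_assoc]
        _ = _ := by rw [h.ctt, scalarMat_metric_mul_self, one_mul]
    rw [this]
    rfl
  ctt := by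
    rw [← Matrix.transpose_map, op_mul_mul_transpose, Matrix.transpose_transpose,
      antipodeMat_transpose, antipodeMat]
    have : (scalarMat A (metric N r))ᵀ * U * (scalarMat A (metric N r))ᵀ
        * (scalarMat A (metric N r))ᵀ
        * (scalarMat A (metric N r) * Uᵀ * scalarMat A (metric N r))
        = (scalarMat A (metric N r))ᵀ := by
      calc _ = (scalarMat A (metric N r))ᵀ * U
            * ((scalarMat A (metric N r))ᵀ * (scalarMat A (metric N r))ᵀ)
            * scalarMat A (metric N r) * Uᵀ * scalarMat A (metric N r) := by
              simp only [mul_assoc]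
        _ = (scalarMat A (metric N r))ᵀ * (U * scalarMat A (metric N r) * Uᵀ)
            * scalarMat A (metric N r) := by
          rw [transpose_scalarMat_metric_mul_self, mul_one]; simp only [mul_assoc]
        _ = _ := by rw [h.tct, mul_assoc, scalarMat_metric_mul_self, mul_one]
    rw [this]
    rfl
  det ε hε := by
    have h1 := congrArg (fun v => (tensorPow N ((antipodeMat r U).map MulOpposite.op)).map
      MulOpposite.unop *ᵥ v) (h.det ε hε)
    simp only [Matrix.mulVec_mulVec, tensorPow_op_mul h.antipodeMat_mul, Matrix.one_mulVec] at h1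
    funext I
    have h2 := congrArg MulOpposite.op (congrFun h1 I)
    rw [← MulOpposite.algebraMap_apply] at h2
    rw [h2]
    simp only [Matrix.mulVec, dotProduct, Finset.op_sum, MulOpposite.op_mul, Matrix.map_apply,
      MulOpposite.op_unop, ← MulOpposite.algebraMap_apply]
    exact Finset.sum_congr rfl fun J _ => (Algebra.commutes _ _).symm

end Lemmas

/-! ### The Hopf algebra structure: `Δ(T) = T ⊗ T`, `ε(T) = 1`, `κ(T) = C Tᵗ C` -/

namespace SOq

variable {N : ℕ} {r : ℂ}

/-- The matrix with entries `∑_c T^a_c ⊗ T^c_b`. -/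
noncomputable def comulMat (N : ℕ) (r : ℂ) : Matrix (Fin N) (Fin N) (SOq N r ⊗[ℂ] SOq N r) :=
  Matrix.of fun a b => ∑ c, T N r a c ⊗ₜ[ℂ] T N r c b

lemma isQOrthogonal_comulMat : IsQOrthogonal r (comulMat N r) := by
  have h1 := (isQOrthogonal_T (N := N) (r := r)).map
    (Algebra.TensorProduct.includeLeft : SOq N r →ₐ[ℂ] SOq N r ⊗[ℂ] SOq N r)
  have h2 := (isQOrthogonal_T (N := N) (r := r)).map
    (Algebra.TensorProduct.includeRight : SOq N r →ₐ[ℂ] SOq N r ⊗[ℂ] SOq N r)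
  have := h1.mul h2 (fun a b c d => by simp [Commute, SemiconjBy])
  have e : comulMat N r
      = (T N r).map (Algebra.TensorProduct.includeLeft : SOq N r →ₐ[ℂ] SOq N r ⊗[ℂ] SOq N r)
        * (T N r).map (Algebra.TensorProduct.includeRight :
            SOq N r →ₐ[ℂ] SOq N r ⊗[ℂ] SOq N r) := by
    ext a b
    simp [comulMat, Matrix.mul_apply]
  rw [e]
  exact this

/-- The coproduct as an algebra homomorphism. -/
noncomputable def comulHom (N : ℕ) (r : ℂ) : SOq N r →ₐ[ℂ] SOq N r ⊗[ℂ] SOq N r :=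
  lift (comulMat N r) isQOrthogonal_comulMat

/-- The counit as an algebra homomorphism. -/
noncomputable def counitHom (N : ℕ) (r : ℂ) : SOq N r →ₐ[ℂ] ℂ :=
  lift 1 isQOrthogonal_one

/-- The antipode as an algebra homomorphism to the opposite algebra. -/
noncomputable def antipodeHom (N : ℕ) (r : ℂ) [NeZero r] : SOq N r →ₐ[ℂ] (SOq N r)ᵐᵒᵖ :=
  lift ((antipodeMat r (T N r)).map MulOpposite.op) isQOrthogonal_T.op_antipodeMat

lemma comulHom_T (a b : Fin N) :
    comulHom N r (T N r a b) = ∑ c, T N r a c ⊗ₜ[ℂ] T N r c b := by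
  simp [comulHom, comulMat]

lemma counitHom_T (a b : Fin N) :
    counitHom N r (T N r a b) = (1 : Matrix (Fin N) (Fin N) ℂ) a b := by
  simp [counitHom]

noncomputable instance instBialgebra : Bialgebra ℂ (SOq N r) :=
  Bialgebra.ofAlgHom (comulHom N r) (counitHom N r)
    (algHom_ext fun a b => by
      simp only [AlgHom.comp_apply, comulHom_T, map_sum, Algebra.TensorProduct.map_tmul,
        TensorProduct.sum_tmul, TensorProduct.tmul_sum, AlgHom.id_apply]
      rw [Finset.sum_comm]
      rfl)
    (algHom_ext fun a b => by
      simp only [AlgHom.comp_apply, comulHom_T, map_sum, Algebra.TensorProduct.map_tmul,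
        counitHom_T, AlgHom.id_apply]
      rw [Finset.sum_eq_single a]
      · simp
      · intro c _ hc
        rw [Matrix.one_apply_ne hc.symm, TensorProduct.zero_tmul]
      · simp)
    (algHom_ext fun a b => by
      simp only [AlgHom.comp_apply, comulHom_T, map_sum, Algebra.TensorProduct.map_tmul,
        counitHom_T, AlgHom.id_apply]
      rw [Finset.sum_eq_single b]
      · simp
      · intro c _ hc
        rw [Matrix.one_apply_ne hc, TensorProduct.tmul_zero]
      · simp)

@[simp] lemma comul_T (a b : Fin N) :
    Coalgebra.comul (R := ℂ) (T N r a b) = ∑ c, T N r a c ⊗ₜ[ℂ] T N r c b := comulHom_T a b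

@[simp] lemma counit_T (a b : Fin N) :
    Coalgebra.counit (R := ℂ) (T N r a b) = (1 : Matrix (Fin N) (Fin N) ℂ) a b := counitHom_T a b

/-- The antipode as a linear map. -/
noncomputable def antipodeLin (N : ℕ) (r : ℂ) [NeZero r] : SOq N r →ₗ[ℂ] SOq N r :=
  (MulOpposite.opLinearEquiv ℂ).symm.toLinearMap ∘ₗ (antipodeHom N r).toLinearMap

lemma antipodeLin_mul [NeZero r] (x y : SOq N r) :
    antipodeLin N r (x * y) = antipodeLin N r y * antipodeLin N r x := by
  simp [antipodeLin]

lemma antipodeLin_algebraMap [NeZero r] (c : ℂ) :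
    antipodeLin N r (algebraMap ℂ _ c) = algebraMap ℂ _ c := by
  simp [antipodeLin]

lemma antipodeLin_T [NeZero r] (a b : Fin N) :
    antipodeLin N r (T N r a b) = antipodeMat r (T N r) a b := by
  simp [antipodeLin, antipodeHom]

lemma antipode_left_mul [NeZero r] (c : ℂ) (x y : SOq N r ⊗[ℂ] SOq N r)
    (hx : LinearMap.mul' ℂ (SOq N r) ((antipodeLin N r).rTensor (SOq N r) x) = algebraMap ℂ _ c) :
    LinearMap.mul' ℂ (SOq N r) ((antipodeLin N r).rTensor (SOq N r) (x * y))
      = c • LinearMap.mul' ℂ (SOq N r) ((antipodeLin N r).rTensor (SOq N r) y) := by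
  induction y using TensorProduct.induction_on with
  | zero => simp
  | add y z hy hz => rw [mul_add, map_add, map_add, hy, hz, map_add, map_add, smul_add]
  | tmul y z =>
    have key : ∀ x : SOq N r ⊗[ℂ] SOq N r,
        LinearMap.mul' ℂ (SOq N r) ((antipodeLin N r).rTensor (SOq N r) (x * y ⊗ₜ z))
          = antipodeLin N r y
            * LinearMap.mul' ℂ (SOq N r) ((antipodeLin N r).rTensor (SOq N r) x) * z := by
      intro x
      induction x using TensorProduct.induction_on with
      | zero => simp
      | add u v hu hv => rw [add_mul, map_add, map_add, hu, hv, map_add, map_add, mul_add, add_mul]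
      | tmul u v => simp [antipodeLin_mul, mul_assoc]
    rw [key, hx, ← Algebra.commutes, mul_assoc, Algebra.smul_def]
    simp

lemma antipode_right_mul [NeZero r] (c : ℂ) (x y : SOq N r ⊗[ℂ] SOq N r)
    (hy : LinearMap.mul' ℂ (SOq N r) ((antipodeLin N r).lTensor (SOq N r) y) = algebraMap ℂ _ c) :
    LinearMap.mul' ℂ (SOq N r) ((antipodeLin N r).lTensor (SOq N r) (x * y))
      = c • LinearMap.mul' ℂ (SOq N r) ((antipodeLin N r).lTensor (SOq N r) x) := by
  induction x using TensorProduct.induction_on with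
  | zero => simp
  | add y z hy hz => rw [add_mul, map_add, map_add, hy, hz, map_add, map_add, smul_add]
  | tmul u v =>
    have key : ∀ y : SOq N r ⊗[ℂ] SOq N r,
        LinearMap.mul' ℂ (SOq N r) ((antipodeLin N r).lTensor (SOq N r) (u ⊗ₜ v * y))
          = u * LinearMap.mul' ℂ (SOq N r) ((antipodeLin N r).lTensor (SOq N r) y)
            * antipodeLin N r v := by
      intro y
      induction y using TensorProduct.induction_on with
      | zero => simp
      | add u v hu hv => rw [mul_add, map_add, map_add, hu, hv, map_add, map_add, mul_add, add_mul]
      | tmul u v => simp [antipodeLin_mul, mul_assoc]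
    rw [key, hy, ← Algebra.commutes, mul_assoc, Algebra.smul_def]
    simp

noncomputable instance instHopfAlgebra [NeZero r] : HopfAlgebra ℂ (SOq N r) where
  antipode := antipodeLin N r
  mul_antipode_rTensor_comul := by
    ext x
    simp only [LinearMap.comp_apply, Algebra.linearMap_apply]
    induction x using SOq.induction with
    | hs c =>
      rw [Bialgebra.comul_algebraMap, Bialgebra.counit_algebraMap,
        Algebra.TensorProduct.algebraMap_apply]
      simp [antipodeLin_algebraMap]
    | hT a b =>
      have := congrFun (congrFun (isQOrthogonal_T (N := N) (r := r)).antipodeMat_mul a) b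
      rw [Matrix.mul_apply] at this
      simp only [comul_T, counit_T, map_sum, LinearMap.rTensor_tmul, LinearMap.mul'_apply,
        antipodeLin_T, this]
      by_cases hab : a = b <;> simp [Matrix.one_apply, hab]
    | hm x y hx hy =>
      rw [Bialgebra.comul_mul, antipode_left_mul _ _ _ hx, hy, Bialgebra.counit_mul, map_mul,
        Algebra.smul_def]
    | ha x y hx hy => simp only [map_add, hx, hy]
  mul_antipode_lTensor_comul := by
    ext x
    simp only [LinearMap.comp_apply, Algebra.linearMap_apply]
    induction x using SOq.induction with
    | hs c =>
      rw [Bialgebra.comul_algebraMap, Bialgebra.counit_algebraMap,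
        Algebra.TensorProduct.algebraMap_apply]
      have h1 : antipodeLin N r 1 = 1 := by simpa using antipodeLin_algebraMap (N := N) (r := r) 1
      simp [h1]
    | hT a b =>
      have := congrFun (congrFun (isQOrthogonal_T (N := N) (r := r)).mul_antipodeMat a) b
      rw [Matrix.mul_apply] at this
      simp only [comul_T, counit_T, map_sum, LinearMap.lTensor_tmul, LinearMap.mul'_apply,
        antipodeLin_T, this]
      by_cases hab : a = b <;> simp [Matrix.one_apply, hab]
    | hm x y hx hy =>
      rw [Bialgebra.comul_mul, antipode_right_mul _ _ _ hy, hx, Bialgebra.counit_mul, mul_comm,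
        map_mul, Algebra.smul_def]
    | ha x y hx hy => simp only [map_add, hx, hy]

end SOq

/-! ### Star structures and real forms -/

/-- A `*`-structure (conjugation) on a complex Hopf algebra: an antilinear, antimultiplicative
involution compatible with the coproduct and with the counit. -/
structure IsStarStructure {A : Type*} [Ring A] [HopfAlgebra ℂ A]
    (st : A →ₛₗ[starRingEnd ℂ] A) : Prop where
  map_mul : ∀ x y, st (x * y) = st y * st x
  involutive : ∀ x, st (st x) = x
  comul : ∀ x, Coalgebra.comul (R := ℂ) (st x)
    = TensorProduct.map st st (Coalgebra.comul (R := ℂ) x)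
  counit : ∀ x, Coalgebra.counit (R := ℂ) (st x) = starRingEnd ℂ (Coalgebra.counit (R := ℂ) x)

/-- The real points determined by a `*`-structure: the points `g` of the complex group
(the characters of the Hopf algebra, which form a group under convolution) such that
`f^*(g)` is the complex conjugate of `f(g)` for all functions `f`. -/
def realPoints {A : Type*} [Ring A] [HopfAlgebra ℂ A] (st : A →ₛₗ[starRingEnd ℂ] A) :
    Set (WithConv (A →ₐ[ℂ] ℂ)) :=
  {χ | ∀ f : A, χ (st f) = starRingEnd ℂ (χ f)}

/-- The classical group `SO(l, m)`: the real matrices of determinant `1` preserving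
`diag(1, …, 1, -1, …, -1)`. -/
def specialOrthogonal (l m : ℕ) : Submonoid (Matrix (Fin l ⊕ Fin m) (Fin l ⊕ Fin m) ℝ) where
  carrier := {g | gᵀ * LieAlgebra.Orthogonal.indefiniteDiagonal (Fin l) (Fin m) ℝ * g
      = LieAlgebra.Orthogonal.indefiniteDiagonal (Fin l) (Fin m) ℝ ∧ g.det = 1}
  one_mem' := by simp
  mul_mem' := by
    rintro g h ⟨hg, hg'⟩ ⟨hh, hh'⟩
    refine ⟨?_, by rw [Matrix.det_mul, hg', hh', one_mul]⟩
    rw [Matrix.transpose_mul]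
    calc _ = hᵀ * (gᵀ * LieAlgebra.Orthogonal.indefiniteDiagonal (Fin l) (Fin m) ℝ * g) * h := by
          simp only [mul_assoc]
      _ = _ := by rw [hg, hh]

/-- A conjugation `st` on `SO_q(N)` at `q = 1` gives the real form `SO(l, m)`: there is a linear
change of coordinates `T' = M T M⁻¹` such that the entries of `T'` are real, the metric
`C' = (M⁻¹)ᵗ C M⁻¹` is diagonal with `l` entries `1` and `m` entries `-1` (in some order, given
by `e`), and `T'` identifies the group of real points with `SO(l, m)`. -/
def GivesRealForm {N : ℕ} {r : ℂ} [NeZero r] (l m : ℕ)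
    (st : SOq N r →ₛₗ[starRingEnd ℂ] SOq N r) : Prop :=
  ∃ (e : Fin l ⊕ Fin m ≃ Fin N) (M : Matrix (Fin N) (Fin N) ℂ),
    IsUnit M.det ∧
    (scalarMat (SOq N r) M * SOq.T N r * scalarMat (SOq N r) M⁻¹).map st
      = scalarMat (SOq N r) M * SOq.T N r * scalarMat (SOq N r) M⁻¹ ∧
    (M⁻¹)ᵀ * metric N r * M⁻¹
      = (LieAlgebra.Orthogonal.indefiniteDiagonal (Fin l) (Fin m) ℂ).submatrix e.symm e.symm ∧
    ∃ Φ : specialOrthogonal l m →* WithConv (SOq N r →ₐ[ℂ] ℂ),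
      Function.Injective Φ ∧ Set.range Φ = realPoints st ∧
      ∀ g : specialOrthogonal l m,
        M * (SOq.T N r).map (Φ g) * M⁻¹ = (g.1.map Complex.ofReal).submatrix e.symm e.symm

end QuantumOrthogonal

open QuantumOrthogonal

/-! Every map in the theorem has the form T ↦ X T Y with scalar matrices X and Y. By `SOq.lift` its
existence means that one matrix satisfies the defining relations: over the algebra itself for ♯ and
α, over the complex conjugate of the opposite algebra for the `*`-structures. Involutivity,
commutation with ♯ and compatibility with Δ and ε then become identities between scalar matrices
(`SOq.isStarStructure_of_twist`, `SOq.compStar_sharp`).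

Automorphisms come from scalar matrices X that preserve C and for which X ⊗ X commutes with R
(`IsSymmetry`). Two kinds are used: diagonal matrices with x_a x_{a'} = 1, because R conserves the
corresponding weights (`REntry_mul_diagonal`), and, for N = 2n, the exchange of the two middle
indices, where ρ vanishes (`REntry_swap`). The matrix 𝒟 is of the first kind for odd N and of the
second for even N. For odd N, α is conjugation by a diagonal A with entries i, 1, -i, chosen so that
its complex conjugate is -𝒟A.

For ×, passing to the opposite algebra inverts R. Since R(r)⁻¹ = R(r⁻¹) (`sum_REntry_mul_inv`) and
C(r⁻¹) is the transpose of C(r), this replaces r by r⁻¹, and complex conjugation undoes it when |q|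
= 1. For ⋆, the antipode C Tᵗ C satisfies the relations in the opposite algebra, a symmetry of R
allows it to be transposed (`IsQOrthogonal.transpose`), and conjugation changes nothing because R
and C are real. The determinant relation is carried along by showing that q-antisymmetric tensors
stay q-antisymmetric under a symmetry in all slots, under reversal of the slots with r ↦ r⁻¹, and
under C in all slots followed by reversal.

At q = 1 the matrix R is the identity and the determinant relation says det = 1, so characters are
complex matrices of determinant 1 preserving C (`isQOrthogonal_iff_of_sq_eq_one`). Suppose a
`*`-structure is T ↦ K T K⁻¹ and one real orthogonal matrix diagonalizes C with signs σ and K with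
signs τ. Multiplying its rows by i where τ = -1 gives self-conjugate coordinates and turns the signs
of the metric into στ (`givesRealForm_of_diagonalized`). The matrix `hadamard` diagonalizes both C
and 𝒟, so each signature is found by counting signs. -/

namespace QuantumOrthogonal

/-! ### Symmetries of the entries of the R-matrix -/

section RMatrixIdentities

variable {N : ℕ}

/-- The coefficient of `E_{aa} ⊗ E_{bb}` in the `R`-matrix. -/
noncomputable def diagCoeff (r : ℂ) (a b : Fin N) : ℂ :=
  if a = b then (if a = a.rev then 1 else r ^ 2) else if b = a.rev then (r ^ 2)⁻¹ else 1

/-- The flip and contraction terms overlap at c = b = a', d = a, which is where the factor 1 -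
q^{ρ_a - ρ_{a'}} in the definition comes from. Written as a sum, the three terms can be treated
independently. -/
lemma REntry_eq (r : ℂ) (a b c d : Fin N) :
    REntry r a b c d = (if c = a ∧ d = b then diagCoeff r a b else 0)
      + (if c = b ∧ d = a ∧ b < a then r ^ 2 - (r ^ 2)⁻¹ else 0)
      - (if b = a.rev ∧ d = c.rev ∧ c < a then
          (r ^ 2 - (r ^ 2)⁻¹) * r ^ (twoRho a - twoRho c) else 0) := by
  unfold REntry diagCoeff
  by_cases h1 : c = a ∧ d = b
  · obtain ⟨rfl, rfl⟩ := h1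
    have : ¬ (c = d ∧ d = c ∧ d < c) := fun h => by have := h.2.2; rw [h.1] at this; exact this.false
    simp [this]
  · rw [if_neg h1, if_neg h1]
    by_cases h2 : c = b ∧ d = a
    · obtain ⟨rfl, rfl⟩ := h2
      by_cases h3 : c < d <;> by_cases h4 : c = d.rev
      · subst h4
        simp [h3]
        ring
      · simp [h3, h4]
      · simp [h3]
      · simp [h3]
    · have h2' : ¬ (c = b ∧ d = a ∧ b < a) := fun h => h2 ⟨h.1, h.2.1⟩
      rw [if_neg h2, if_neg h2']
      split_ifs <;> ring

lemma sum_REntry_mul (r : ℂ) (a b : Fin N) (G : Fin N → Fin N → ℂ) :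
    ∑ c, ∑ d, REntry r a b c d * G c d = diagCoeff r a b * G a b
      + (if b < a then (r ^ 2 - (r ^ 2)⁻¹) * G b a else 0)
      - (if b = a.rev then (r ^ 2 - (r ^ 2)⁻¹) * ∑ c with c < a,
          r ^ (twoRho a - twoRho c) * G c c.rev else 0) := by
  simp only [REntry_eq]
  generalize r ^ 2 - (r ^ 2)⁻¹ = β
  simp only [sub_mul, add_mul, Finset.sum_sub_distrib, Finset.sum_add_distrib, ite_mul,
    zero_mul, ite_and]
  congr 1
  · congr 1
    · simp
    · simp
  · by_cases h : b = a.rev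
    · simp only [h, if_true]
      simp only [Finset.sum_ite_eq', Finset.mem_univ, if_true, Finset.sum_filter, Finset.mul_sum]
      refine Finset.sum_congr rfl fun c _ => ?_
      split_ifs <;> ring
    · simp [h]

/-- Conjugating indices reverses their order and negates ρ, so the contraction term keeps both its
range and its coefficient. This symmetry is what permits transposing T. -/
lemma REntry_transpose_flip (r : ℂ) (a b c d : Fin N) : REntry r d c b a = REntry r a b c d := by
  rw [REntry_eq, REntry_eq]
  congr 1
  · congr 1
    · by_cases h : c = a ∧ d = b
      · obtain ⟨rfl, rfl⟩ := h
        simp only [and_self, if_true, diagCoeff, eq_comm]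
        grind
      · rw [if_neg h, if_neg fun h' => h ⟨h'.2.symm, h'.1.symm⟩]
    · refine if_congr ?_ rfl rfl
      grind
  · by_cases h : b = a.rev ∧ d = c.rev ∧ c < a
    · obtain ⟨rfl, rfl, h⟩ := h
      simp only [Fin.rev_rev, Fin.rev_lt_rev, h, and_self, if_true, twoRho_rev]
      congr 2
      ring
    · rw [if_neg h, if_neg]
      rintro ⟨rfl, rfl, h'⟩
      exact h ⟨by simp, by simp, by simpa using Fin.rev_lt_rev.mpr h'⟩

lemma REntry_rev (r : ℂ) (a b c d : Fin N) :
    REntry r b.rev a.rev d.rev c.rev = REntry r a b c d := by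
  rw [REntry_eq, REntry_eq]
  simp only [Fin.rev_inj, Fin.rev_lt_rev, Fin.rev_rev, twoRho_rev]
  congr 1
  · congr 1
    · simp only [diagCoeff, Fin.rev_inj, Fin.rev_rev]
      grind
    · refine if_congr ?_ rfl rfl
      grind
  · by_cases h : b = a.rev ∧ d = c.rev ∧ c < a
    · obtain ⟨rfl, rfl, h⟩ := h
      simp only [Fin.rev_lt_rev, h, and_self, if_true, twoRho_rev]
      congr 2
      ring
    · rw [if_neg h, if_neg]
      rintro ⟨rfl, rfl, h'⟩
      exact h ⟨by simp, by simp, by simpa using Fin.rev_lt_rev.mp h'⟩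

/-- Weight conservation: an entry can be nonzero only if (c, d) is a rearrangement of (a, b), or if
both pairs are conjugate and hence of weight 1. -/
lemma REntry_mul_diagonal (r : ℂ) (x : Fin N → ℂ) (hx : ∀ a, x a * x a.rev = 1) (a b c d : Fin N) :
    x a * x b * REntry r a b c d = REntry r a b c d * (x c * x d) := by
  by_cases h : x a * x b = x c * x d
  · rw [h, mul_comm]
  · have : REntry r a b c d = 0 := by
      rw [REntry_eq, if_neg, if_neg, if_neg]
      · ring
      · rintro ⟨rfl, rfl, -⟩
        exact h (by rw [hx, hx])
      · rintro ⟨rfl, rfl, -⟩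
        exact h (mul_comm _ _)
      · rintro ⟨rfl, rfl⟩
        exact h rfl
    rw [this, mul_zero, zero_mul]

lemma val_swap {i j : Fin N} (hj : (j : ℕ) = i + 1) (a : Fin N) :
    ((Equiv.swap i j a : Fin N) : ℕ)
      = if (a : ℕ) = i then (i : ℕ) + 1 else if (a : ℕ) = i + 1 then (i : ℕ) else a := by
  rw [Equiv.swap_apply_def]
  simp only [Fin.ext_iff, hj]
  split_ifs <;> simp_all

lemma rev_swap {i j : Fin N} (hj : (j : ℕ) = i + 1) (hij : j = i.rev) (a : Fin N) :
    (Equiv.swap i j a).rev = Equiv.swap i j a.rev := by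
  subst hij
  have := Fin.val_rev i
  ext
  rw [Fin.val_rev, val_swap hj, val_swap hj, Fin.val_rev]
  split_ifs <;> omega

lemma twoRho_swap {i j : Fin N} (hj : (j : ℕ) = i + 1) (hij : j = i.rev) (a : Fin N) :
    twoRho (Equiv.swap i j a) = twoRho a := by
  subst hij
  have := Fin.val_rev i
  unfold twoRho
  simp only [rev_swap hj rfl, Fin.lt_def, val_swap hj, Fin.val_rev]
  split_ifs <;> omega

/-- Adjacent indices are exchanged, so the only pair whose order is inverted is the middle pair
itself, and that pair is excluded. -/
lemma swap_lt_swap {i j : Fin N} (hj : (j : ℕ) = i + 1) (hij : j = i.rev) {a b : Fin N}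
    (h : ¬ (b = a.rev ∧ (a = i ∨ a = j))) :
    Equiv.swap i j b < Equiv.swap i j a ↔ b < a := by
  subst hij
  have := Fin.val_rev i
  simp only [Fin.ext_iff, Fin.val_rev] at h
  simp only [Fin.lt_def, val_swap hj]
  split_ifs <;> omega

/-- The exchange respects conjugation and ρ, and it disturbs the order only inside the middle pair.
There the flip and contraction coefficients cancel because ρ = 0. -/
lemma REntry_swap {i j : Fin N} (hj : (j : ℕ) = i + 1) (hij : j = i.rev) (r : ℂ)
    (a b c d : Fin N) :
    REntry r (Equiv.swap i j a) (Equiv.swap i j b) (Equiv.swap i j c) (Equiv.swap i j d)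
      = REntry r a b c d := by
  have hd : diagCoeff r (Equiv.swap i j a) (Equiv.swap i j b) = diagCoeff r a b := by
    simp only [diagCoeff, rev_swap hj hij, (Equiv.swap i j).injective.eq_iff]
  rw [REntry_eq, REntry_eq, hd]
  simp only [rev_swap hj hij, (Equiv.swap i j).injective.eq_iff, twoRho_swap hj hij]
  -- The only entries in which an order condition can change; with ρ = 0 the two ordered terms are
  -- equal and opposite, whichever way the order falls.
  by_cases h : (b = a.rev ∧ (a = i ∨ a = j)) ∧ c = b ∧ d = a
  · obtain ⟨⟨rfl, h⟩, rfl, rfl⟩ := h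
    have h0 : twoRho d = 0 := by
      have := Fin.val_rev i
      have := Fin.val_rev d
      unfold twoRho
      rw [hij, Fin.ext_iff, Fin.ext_iff] at h
      rw [hij] at hj
      simp only [Fin.lt_def]
      split_ifs <;> omega
    simp [h0, twoRho_rev]
  · congr 1
    · congr 1
      refine if_congr ?_ rfl rfl
      refine and_congr_right fun h1 => and_congr_right fun h2 => ?_
      exact swap_lt_swap hj hij fun h3 => h ⟨h3, h1, h2⟩
    · refine if_congr ?_ rfl rfl
      refine and_congr_right fun h1 => and_congr_right fun h2 => ?_
      refine swap_lt_swap hj hij fun h3 => h ⟨⟨h1, h3.2⟩, ?_, ?_⟩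
      · rw [h3.1, h1]
      · rw [h2, h3.1, Fin.rev_rev]

/-! ### The inverse of the R-matrix -/

/-- The diagonal coefficients of the block of `R` spanned by the pairs `(a, a')`. -/
noncomputable def blockCoeff (r : ℂ) (a : Fin N) : ℂ := if a = a.rev then 1 else (r ^ 2)⁻¹

lemma diagCoeff_rev (r : ℂ) (a : Fin N) : diagCoeff r a a.rev = blockCoeff r a := by
  unfold diagCoeff blockCoeff
  by_cases h : a = a.rev
  · rw [if_pos h, if_pos h, if_pos h]
  · rw [if_neg h, if_pos rfl, if_neg h]

lemma blockCoeff_inv (r : ℂ) (a : Fin N) : blockCoeff r⁻¹ a = (blockCoeff r a)⁻¹ := by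
  unfold blockCoeff
  split_ifs <;> simp

/-- A partial sum of the geometric-type series `∑ q^{-2ρ_a}`. -/
noncomputable def rhoPartial (r : ℂ) (a : Fin N) : ℂ :=
  blockCoeff r a * r ^ (-2 * twoRho a) + if a.rev < a then r ^ 2 - (r ^ 2)⁻¹ else 0

/-- Away from the middle ρ drops by 1 at each step and the identity is q = q⁻¹ + (q - q⁻¹). Near the
middle ρ stalls at 0 (even N) or moves by halves (odd N); the case distinction in `blockCoeff` and
the added constant absorb this. -/
lemma rhoPartial_succ {r : ℂ} (hr : r ≠ 0) {a b : Fin N} (hb : (b : ℕ) = a + 1) :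
    rhoPartial r b = rhoPartial r a + (r ^ 2 - (r ^ 2)⁻¹) * r ^ (-2 * twoRho a) := by
  have key : ∀ (k : ℤ), r ^ (2 : ℕ) * r ^ k = r ^ (k + 2) := fun k => by
    rw [add_comm, zpow_add₀ hr]; norm_cast
  have key' : ∀ (k : ℤ), (r ^ (2 : ℕ))⁻¹ * r ^ k = r ^ (k - 2) := fun k => by
    rw [sub_eq_add_neg, add_comm, zpow_add₀ hr, zpow_neg]; norm_cast
  have ht : ∀ c : Fin N, twoRho c = if 2 * (c : ℕ) + 1 < N then (N : ℤ) - 2 - 2 * c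
      else if 2 * (c : ℕ) + 1 = N then 0 else N - 2 * c := fun c => by
    unfold twoRho
    simp only [Fin.lt_def, Fin.val_rev]
    split_ifs <;> omega
  have hl : ∀ c : Fin N, c.rev < c ↔ N < 2 * (c : ℕ) + 1 := fun c => by
    simp only [Fin.lt_def, Fin.val_rev]
    omega
  have he : ∀ c : Fin N, c = c.rev ↔ 2 * (c : ℕ) + 1 = N := fun c => by
    simp only [Fin.ext_iff, Fin.val_rev]
    omega
  unfold rhoPartial blockCoeff
  rw [sub_mul, key, key']
  simp only [hl, he, ht, hb, ite_mul, one_mul, key']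
  have h2 : r ^ (2 : ℤ) = r ^ (2 : ℕ) := by norm_cast
  have h2' : r ^ (-2 : ℤ) = (r ^ (2 : ℕ))⁻¹ := by rw [zpow_neg]; norm_cast
  rcases lt_trichotomy (2 * (a : ℕ) + 3) N with h | h | h
  · have c1 : 2 * ((a : ℕ) + 1) + 1 < N := by omega
    have c2 : 2 * (a : ℕ) + 1 < N := by omega
    simp only [c1, c2, c1.ne, c2.ne, c1.not_gt, c2.not_gt, if_true, if_false]
    push_cast
    ring_nf
  · have c1 : 2 * ((a : ℕ) + 1) + 1 = N := by omega
    have c2 : 2 * (a : ℕ) + 1 < N := by omega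
    have c3 : (N : ℤ) = 2 * a + 3 := by omega
    simp only [c1, c2, c2.ne, c2.not_gt, if_true, if_false, lt_self_iff_false, c3]
    ring_nf
  · rcases lt_trichotomy (2 * (a : ℕ) + 1) N with h' | h' | h'
    · have c1 : N < 2 * ((a : ℕ) + 1) + 1 := by omega
      have c3 : (N : ℤ) = 2 * a + 2 := by omega
      simp only [c1, h', c1.ne', h'.ne, c1.not_gt, h'.not_gt, if_true, if_false, c3]
      push_cast
      ring_nf
      rw [h2']
      simp
    · have c1 : N < 2 * ((a : ℕ) + 1) + 1 := by omega
      have c3 : (N : ℤ) = 2 * a + 1 := by omega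
      simp only [h', c1, c1.ne', c1.not_gt, if_true, if_false, lt_self_iff_false, c3]
      push_cast
      ring_nf
      rw [h2, h2']
      simp
    · have c1 : N < 2 * ((a : ℕ) + 1) + 1 := by omega
      simp only [c1, h', c1.ne', h'.ne', c1.not_gt, h'.not_gt, if_true, if_false]
      push_cast
      ring_nf

lemma sum_rho_lt {r : ℂ} (hr : r ≠ 0) (z : Fin N) (hz : (z : ℕ) = 0) (k : ℕ) (hk : k < N) :
    (r ^ 2 - (r ^ 2)⁻¹) * ∑ e : Fin N with e < ⟨k, hk⟩, r ^ (-2 * twoRho e)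
      = rhoPartial r ⟨k, hk⟩ - rhoPartial r z := by
  induction k with
  | zero =>
    have : z = ⟨0, hk⟩ := Fin.ext hz
    simp [this, Fin.lt_def]
  | succ k ih =>
    have h : Finset.univ.filter (fun e : Fin N => e < ⟨k + 1, hk⟩)
        = insert ⟨k, by omega⟩ (Finset.univ.filter fun e : Fin N => e < ⟨k, by omega⟩) := by
      ext e
      simp only [Finset.mem_filter, Finset.mem_univ, true_and, Finset.mem_insert, Fin.lt_def,
        Fin.ext_iff]
      omega
    rw [h, Finset.sum_insert (by simp), mul_add, ih (by omega),
      rhoPartial_succ hr (a := ⟨k, by omega⟩) (b := ⟨k + 1, hk⟩) rfl]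
    ring

lemma sum_rho_between {r : ℂ} (hr : r ≠ 0) {a c : Fin N} (h : c < a) :
    (r ^ 2 - (r ^ 2)⁻¹) * ∑ e : Fin N with c < e ∧ e < a, r ^ (-2 * twoRho e)
      = rhoPartial r a - rhoPartial r c - (r ^ 2 - (r ^ 2)⁻¹) * r ^ (-2 * twoRho c) := by
  have hz : 0 < N := c.pos
  have h1 := sum_rho_lt hr ⟨0, hz⟩ rfl a a.2
  have h2 := sum_rho_lt hr ⟨0, hz⟩ rfl c c.2
  have h3 : Finset.univ.filter (fun e : Fin N => e < a)
      = (Finset.univ.filter fun e : Fin N => c < e ∧ e < a) ∪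
        insert c (Finset.univ.filter fun e : Fin N => e < c) := by
    ext e
    simp only [Finset.mem_filter, Finset.mem_univ, true_and, Finset.mem_insert, Fin.lt_def,
      Fin.ext_iff, Finset.mem_union] at *
    omega
  simp only [Fin.eta] at h1 h2
  rw [h3, Finset.sum_union, Finset.sum_insert (by simp), mul_add, mul_add, h2] at h1
  · linear_combination h1
  · rw [Finset.disjoint_left]
    intro e
    simp only [Finset.mem_filter, Finset.mem_univ, true_and, Finset.mem_insert, Fin.lt_def,
      Fin.ext_iff]
    omega

/-- The telescoped sum in the shape needed for R(r)R(r⁻¹): the lower end carries the inverse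
coefficient, which is the diagonal coefficient of the block of R(r⁻¹). -/
lemma sum_rho_between' {r : ℂ} (hr : r ≠ 0) {a c : Fin N} (h : c < a) :
    (r ^ 2 - (r ^ 2)⁻¹) * ∑ e : Fin N with c < e ∧ e < a, r ^ (-2 * twoRho e)
      = blockCoeff r a * r ^ (-2 * twoRho a) - (blockCoeff r c)⁻¹ * r ^ (-2 * twoRho c)
        + if a.rev < a ∧ c < c.rev then r ^ 2 - (r ^ 2)⁻¹ else 0 := by
  rw [sum_rho_between hr h, rhoPartial, rhoPartial]
  have h1 : (blockCoeff r c)⁻¹ * r ^ (-2 * twoRho c)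
      = blockCoeff r c * r ^ (-2 * twoRho c) + (r ^ 2 - (r ^ 2)⁻¹) * r ^ (-2 * twoRho c)
        - if c = c.rev then r ^ 2 - (r ^ 2)⁻¹ else 0 := by
    by_cases hc : c = c.rev
    · have : twoRho c = 0 := by
        have := twoRho_rev c
        rw [← hc] at this
        omega
      simp [blockCoeff, ← hc, this]
    · simp only [blockCoeff, hc, if_false, inv_inv]
      ring
  rw [h1]
  simp only [Fin.lt_def, Fin.ext_iff, Fin.val_rev] at *
  split_ifs <;> first | omega | ring

lemma REntry_block (r : ℂ) (a c : Fin N) :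
    REntry r a a.rev c c.rev = (if c = a then blockCoeff r a else 0)
      + (if c = a.rev ∧ a.rev < a then r ^ 2 - (r ^ 2)⁻¹ else 0)
      - (if c < a then (r ^ 2 - (r ^ 2)⁻¹) * r ^ (twoRho a - twoRho c) else 0) := by
  rw [REntry_eq, diagCoeff_rev]
  congr 1
  · congr 1
    · refine if_congr ?_ rfl rfl
      simp
    · refine if_congr ?_ rfl rfl
      constructor
      · rintro ⟨h1, -, h2⟩
        exact ⟨h1, h2⟩
      · rintro ⟨rfl, h2⟩
        simpa using h2
  · simp

lemma sum_block {r : ℂ} (hr : r ≠ 0) (a e : Fin N) :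
    ∑ x with x < a, r ^ (twoRho a - twoRho x) * REntry r⁻¹ x x.rev e e.rev
      = (if e < a then r ^ (twoRho a - twoRho e) * (blockCoeff r e)⁻¹ else 0)
        - (if e < e.rev ∧ e.rev < a then
            (r ^ 2 - (r ^ 2)⁻¹) * r ^ (twoRho a + twoRho e) else 0)
        + (r ^ 2 - (r ^ 2)⁻¹) * r ^ (twoRho a + twoRho e)
          * ∑ x with e < x ∧ x < a, r ^ (-2 * twoRho x) := by
  simp only [REntry_block, mul_add, mul_sub, Finset.sum_add_distrib, Finset.sum_sub_distrib,
    blockCoeff_inv]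
  have hβ : r⁻¹ ^ 2 - (r⁻¹ ^ 2)⁻¹ = -(r ^ 2 - (r ^ 2)⁻¹) := by simp
  rw [hβ]
  generalize r ^ 2 - (r ^ 2)⁻¹ = β
  have h1 : ∑ x with x < a, r ^ (twoRho a - twoRho x) * (if e = x then (blockCoeff r x)⁻¹ else 0)
      = if e < a then r ^ (twoRho a - twoRho e) * (blockCoeff r e)⁻¹ else 0 := by
    simp
  have h2 : ∑ x with x < a, r ^ (twoRho a - twoRho x) * (if e = x.rev ∧ x.rev < x then -β else 0)
      = -if e < e.rev ∧ e.rev < a then β * r ^ (twoRho a + twoRho e) else 0 := by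
    rw [Finset.sum_filter, Finset.sum_eq_single e.rev]
    · rw [twoRho_rev, Fin.rev_rev]
      by_cases h3 : e < e.rev <;> by_cases h4 : e.rev < a <;> simp [h3, h4, mul_comm]
    · intro x _ hx
      have : e ≠ x.rev := fun h => hx (by rw [h, Fin.rev_rev])
      simp [this]
    · simp
  have h3 : ∑ x with x < a, r ^ (twoRho a - twoRho x)
        * (if e < x then -β * r⁻¹ ^ (twoRho x - twoRho e) else 0)
      = -(β * r ^ (twoRho a + twoRho e) * ∑ x with e < x ∧ x < a, r ^ (-2 * twoRho x)) := by
    rw [Finset.sum_filter, Finset.sum_filter, Finset.mul_sum, ← Finset.sum_neg_distrib]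
    refine Finset.sum_congr rfl fun x _ => ?_
    have : r ^ (twoRho a - twoRho x) * r⁻¹ ^ (twoRho x - twoRho e)
        = r ^ (twoRho a + twoRho e) * r ^ (-2 * twoRho x) := by
      rw [inv_zpow', ← zpow_add₀ hr, ← zpow_add₀ hr]
      congr 1
      ring
    by_cases h4 : x < a <;> by_cases h5 : e < x <;> simp only [h4, h5, and_self, and_true, and_false,
      if_true, if_false, mul_zero, neg_zero]
    linear_combination (-β) * this
  rw [h1, h2, h3]
  ring

/-- R preserves the span of the conjugate pairs. Outside it the flip coefficients for r and r⁻¹ are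
opposite and cancel. Inside it an entry with e < a contains the sum of q^{-2ρ_x} over e < x < a,
produced by two successive contractions, and `sum_rho_between'` evaluates it. -/
lemma sum_REntry_mul_inv {r : ℂ} (hr : r ≠ 0) (a b e f : Fin N) :
    ∑ c, ∑ d, REntry r a b c d * REntry r⁻¹ c d e f = if e = a ∧ f = b then 1 else 0 := by
  rw [sum_REntry_mul r a b (fun c d => REntry r⁻¹ c d e f)]
  have hβ : r⁻¹ ^ 2 - (r⁻¹ ^ 2)⁻¹ = -(r ^ 2 - (r ^ 2)⁻¹) := by simp
  have hr2 : r ^ 2 ≠ 0 := pow_ne_zero 2 hr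
  by_cases hb : b = a.rev
  · subst hb
    by_cases hf : f = e.rev
    · subst hf
      have hgoal : (e = a ∧ e.rev = a.rev) ↔ e = a := by simp
      have hrev : REntry r⁻¹ a.rev a e e.rev = REntry r⁻¹ a.rev a.rev.rev e e.rev := by
        rw [Fin.rev_rev]
      simp only [hgoal, if_true, diagCoeff_rev, sum_block hr, hrev]
      rcases lt_trichotomy e a with h | rfl | h
      · have hs := sum_rho_between' hr h
        rw [REntry_block, REntry_block, hβ, blockCoeff_inv, blockCoeff_inv]
        have ha0 := zpow_ne_zero (twoRho a) hr
        have he0 := zpow_ne_zero (twoRho e) hr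
        have hX : ∀ c : Fin N, r ^ (-2 * twoRho c) = (r ^ twoRho c)⁻¹ * (r ^ twoRho c)⁻¹ := by
          intro c
          rw [← zpow_neg, ← zpow_add₀ hr]
          congr 1
          ring
        simp only [hX] at hs ⊢
        have hY : ∀ (c d : Fin N), r⁻¹ ^ (twoRho c - twoRho d) = (r ^ twoRho c)⁻¹ * r ^ twoRho d := by
          intro c d
          rw [inv_zpow', ← zpow_neg, ← zpow_add₀ hr]
          congr 1
          ring
        have hZ : r⁻¹ ^ (-twoRho a - twoRho e) = r ^ twoRho a * r ^ twoRho e := by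
          rw [inv_zpow', ← zpow_add₀ hr]
          congr 1
          ring
        have hYX : e = a.rev → r ^ twoRho e = (r ^ twoRho a)⁻¹ := by
          rintro rfl
          rw [twoRho_rev, zpow_neg]
        have hB : e = a.rev → blockCoeff r a = (r ^ 2)⁻¹ ∧ blockCoeff r e = (r ^ 2)⁻¹ := by
          rintro rfl
          have : a ≠ a.rev := h.ne'
          rw [blockCoeff, blockCoeff, if_neg this, Fin.rev_rev, if_neg this.symm]
          exact ⟨rfl, rfl⟩
        simp only [hY, hZ, zpow_sub₀ hr, zpow_add₀ hr, twoRho_rev, Fin.rev_rev,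
          h, h.ne, if_true, if_false]
        clear hY hX hZ hgoal hrev hβ
        generalize ∑ x with e < x ∧ x < a, (r ^ twoRho x)⁻¹ * (r ^ twoRho x)⁻¹ = S at *
        generalize r ^ twoRho a = X at *
        generalize r ^ twoRho e = Y at *
        by_cases h1 : e = a.rev
        · obtain ⟨hb1, hb2⟩ := hB h1
          have h2 : a.rev < a := h1 ▸ h
          have h5 : blockCoeff r a.rev = (r ^ 2)⁻¹ := h1 ▸ hb2
          simp only [h2, h5, hb1, h1, hYX h1, Fin.rev_rev, and_self, if_true, if_false,
            false_and, and_false, lt_irrefl, inv_inv] at hs ⊢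
          have hX : X / X⁻¹ = X * X := by simp
          have hX' : X * X⁻¹ = 1 := mul_inv_cancel₀ ha0
          rw [hX, hX']
          linear_combination (-(r ^ 2 - (r ^ 2)⁻¹)) * hs + 0 * hX'
        -- The two indicators belong to flip followed by contraction and to contraction followed by
        -- flip. For e < a and e ≠ a' their ranges are disjoint, and together they fill the range of
        -- the constant in `sum_rho_between'`.
        · have hif : ((if a.rev < a ∧ e < a.rev then (1 : ℂ) else 0)
              + if e < e.rev ∧ e.rev < a then 1 else 0) = if a.rev < a ∧ e < e.rev then 1 else 0 := by
            simp only [Fin.lt_def, Fin.ext_iff, Fin.val_rev] at *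
            split_ifs <;> first | omega | simp
          have hs' : (r ^ 2 - (r ^ 2)⁻¹) * S * (X * Y) = blockCoeff r a * (X⁻¹ * Y)
              - (blockCoeff r e)⁻¹ * (X / Y)
              + (if a.rev < a ∧ e < e.rev then r ^ 2 - (r ^ 2)⁻¹ else 0) * (X * Y) := by
            have hX : X * X⁻¹ = 1 := mul_inv_cancel₀ ha0
            have hY : Y * Y⁻¹ = 1 := mul_inv_cancel₀ he0
            rw [hs, div_eq_mul_inv]
            linear_combination (blockCoeff r a * X⁻¹ * Y) * hX
              - ((blockCoeff r e)⁻¹ * X * Y⁻¹) * hY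
          simp only [h1, false_and, if_false]
          by_cases h2 : a.rev < a <;> by_cases h3 : e < a.rev <;> by_cases h4 : e < e.rev <;>
            by_cases h5 : e.rev < a <;>
            simp only [h2, h3, h4, h5, and_self, and_true, and_false, if_true, if_false] at hif hs' ⊢ <;>
            first
            | linear_combination (-(r ^ 2 - (r ^ 2)⁻¹)) * hs'
            | norm_num at hif
      · have h1 : Finset.univ.filter (fun x : Fin N => e < x ∧ x < e) = ∅ := by
          ext x
          simp only [Finset.mem_filter, Finset.mem_univ, true_and, Finset.notMem_empty, iff_false]
          exact fun h => h.1.not_gt h.2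
        have h2 : ¬ (e < e.rev ∧ e.rev < e) := fun h => h.1.not_gt h.2
        have h3 : ¬ (e = e.rev ∧ e.rev < e) := fun h => h.2.ne h.1.symm
        have h4 : blockCoeff r e ≠ 0 := by unfold blockCoeff; split_ifs <;> simp [hr]
        rw [h1, if_neg h2, REntry_block, if_neg h3, REntry_block, blockCoeff_inv]
        by_cases h5 : e.rev < e
        · simp [h5.ne', h5.not_gt, h4]
        · simp [h5, h4]
      · have h1 : Finset.univ.filter (fun x : Fin N => e < x ∧ x < a) = ∅ := by
          ext x
          simp only [Finset.mem_filter, Finset.mem_univ, true_and, Finset.notMem_empty, iff_false]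
          exact fun h' => (h.trans h'.1).not_gt h'.2
        rw [h1, REntry_block, REntry_block]
        simp only [Fin.lt_def, Fin.ext_iff, Fin.val_rev] at *
        split_ifs <;> first | omega | simp
    · have h : ∀ x y : Fin N, y = x.rev → REntry r⁻¹ x y e f = 0 := by
        rintro x _ rfl
        rw [REntry_eq, if_neg, if_neg, if_neg]
        · ring
        · exact fun h => hf h.2.1
        · rintro ⟨rfl, rfl, -⟩
          exact hf (by simp)
        · rintro ⟨rfl, rfl⟩
          exact hf rfl
      have h0 : ¬ (e = a ∧ f = a.rev) := by
        rintro ⟨rfl, rfl⟩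
        exact hf rfl
      rw [if_neg h0, h _ _ rfl, h _ _ (by simp)]
      simp [h]
  · have hb' : a ≠ b.rev := fun h => hb (by rw [h, Fin.rev_rev])
    simp only [hb, if_false, REntry_eq, hb', hβ, false_and]
    unfold diagCoeff
    by_cases hab : a = b
    · subst hab
      simp only [if_true, lt_self_iff_false, and_false, if_false, hb]
      split_ifs <;> simp [hr]
    · have hba : b ≠ a := fun h => hab h.symm
      simp only [hab, hba, hb, hb', if_false, one_mul]
      by_cases h1 : b < a
      · simp only [h1, h1.not_gt, and_true, and_false, if_true, if_false]
        split_ifs <;> grind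
      · simp [h1]

end RMatrixIdentities
-- Stability of q-antisymmetric tensors
section Antisymmetric

variable {N : ℕ}

lemma RMatrix_mul_RMatrix_inv {r : ℂ} (hr : r ≠ 0) : RMatrix N r * RMatrix N r⁻¹ = 1 := by
  ext ⟨a, b⟩ ⟨e, f⟩
  rw [Matrix.mul_apply, Fintype.sum_prod_type]
  simp only [RMatrix, Matrix.of_apply, sum_REntry_mul_inv hr, Matrix.one_apply, Prod.mk.injEq,
    eq_comm]

lemma RMatrix_inv_mul_RMatrix {r : ℂ} (hr : r ≠ 0) : RMatrix N r⁻¹ * RMatrix N r = 1 := by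
  simpa using RMatrix_mul_RMatrix_inv (N := N) (inv_ne_zero hr)

lemma metric_inv (r : ℂ) : metric N r⁻¹ = (metric N r)ᵀ := by
  ext a b
  simp only [metric, Matrix.of_apply, Matrix.transpose_apply]
  by_cases h : b = a.rev
  · subst h
    simp [twoRho_rev]
  · rw [if_neg h, if_neg]
    rintro rfl
    simp at h

/-- The matrix of `R̂`, with `R̂^{ab}_{cd} = R^{ba}_{cd}`. -/
noncomputable def RHat (N : ℕ) (r : ℂ) : Matrix (Fin N × Fin N) (Fin N × Fin N) ℂ :=
  (RMatrix N r).submatrix Prod.swap id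

/-- The contraction with the metric, as a matrix with identical rows. -/
noncomputable def metricRows (N : ℕ) (r : ℂ) : Matrix (Fin N × Fin N) (Fin N × Fin N) ℂ :=
  Matrix.of fun _ y => metric N r y.1 y.2

/-- In each pair of neighbouring slots the tensor `ε` is an eigenvector of `B` with
eigenvalue `v`. -/
def IsAdjEigen (B : Matrix (Fin N × Fin N) (Fin N × Fin N) ℂ) (v : ℂ)
    (ε : (Fin N → Fin N) → ℂ) : Prop :=
  ∀ k l : Fin N, (k : ℕ) + 1 = l → ∀ I : Fin N → Fin N,
    ∑ p : Fin N × Fin N, B (I k, I l) p * ε (Function.update (Function.update I k p.1) l p.2)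
      = v * ε I

/-- Both conditions become eigenvalue equations on neighbouring slots, the metric one with
eigenvalue 0, so each stability argument is made only once. -/
lemma isQAntisymm_iff {r : ℂ} {ε : (Fin N → Fin N) → ℂ} :
    IsQAntisymm r ε ↔ IsAdjEigen (RHat N r) (-(r ^ 2)⁻¹) ε ∧ IsAdjEigen (metricRows N r) 0 ε := by
  simp only [IsQAntisymm, IsAdjEigen, Fintype.sum_prod_type, RHat, metricRows, RMatrix,
    Matrix.submatrix_apply, Matrix.of_apply, Prod.swap_prod_mk, id, zero_mul]
  exact ⟨fun h => ⟨fun k l hkl I => (h k l hkl I).1, fun k l hkl I => (h k l hkl I).2⟩,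
    fun h k l hkl I => ⟨h.1 k l hkl I, h.2 k l hkl I⟩⟩

lemma tensorPow_apply (k : ℕ) {n : Type*} (Y : Matrix n n ℂ) (I J : Fin k → n) :
    tensorPow k Y I J = ∏ m, Y (I m) (J m) := by
  simp [tensorPow, List.prod_ofFn]

lemma prod_update_update {k l : Fin N} (hkl : k ≠ l) (Y : Matrix (Fin N) (Fin N) ℂ)
    (I J : Fin N → Fin N) :
    ∏ m, Y (I m) (J m) = Y (I k) (J k) * Y (I l) (J l)
      * ∏ m ∈ (Finset.univ.erase k).erase l, Y (I m) (J m) := by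
  rw [mul_assoc, Finset.mul_prod_erase _ (fun m => Y (I m) (J m)) (by simp [hkl.symm]),
    Finset.mul_prod_erase _ (fun m => Y (I m) (J m)) (by simp)]

/-- Exchange the entries in the slots `k` and `l` of a multi-index with a pair of indices. -/
def slotExchange {k l : Fin N} (hkl : k ≠ l) :
    ((Fin N → Fin N) × (Fin N × Fin N)) ≃ ((Fin N → Fin N) × (Fin N × Fin N)) :=
  Function.Involutive.toPerm
    (fun x => (Function.update (Function.update x.1 k x.2.1) l x.2.2, (x.1 k, x.1 l))) (by
      rintro ⟨J, c, d⟩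
      simp only [Function.update_self, ne_eq, hkl, not_false_eq_true, Function.update_of_ne,
        Prod.mk.injEq, and_true]
      funext m
      by_cases h1 : m = l
      · subst h1; simp
      · by_cases h2 : m = k
        · subst h2; simp [hkl]
        · simp [h1, h2])

/-- An operator on two slots ignores the factors Y in the other slots, so it only has to be moved
past Y ⊗ Y. When the eigenvalue is 0, whatever matrix `Z` appears on the left is harmless; this
covers the metric condition, where Y is absorbed altogether. -/
lemma IsAdjEigen.tensorPow {B B' Z : Matrix (Fin N × Fin N) (Fin N × Fin N) ℂ} {v : ℂ}
    {ε : (Fin N → Fin N) → ℂ} (h : IsAdjEigen B v ε) {Y : Matrix (Fin N) (Fin N) ℂ}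
    (hB : B' * prodOneTwo Y = Z * B) (hv : v = 0 ∨ Z = prodOneTwo Y) :
    IsAdjEigen B' v (tensorPow N Y *ᵥ ε) := by
  intro k l hkl I
  have hne : k ≠ l := by rintro rfl; omega
  set W : (Fin N → Fin N) → (Fin N → Fin N) → ℂ := fun I J =>
    ∏ m ∈ (Finset.univ.erase k).erase l, Y (I m) (J m) with hW
  have hW1 : ∀ J c d, W (Function.update (Function.update I k c) l d) J = W I J := by
    intro J c d
    refine Finset.prod_congr rfl fun m hm => ?_
    simp only [Finset.mem_erase] at hm
    rw [Function.update_of_ne hm.1, Function.update_of_ne hm.2.1]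
  have hW2 : ∀ J c d, W I (Function.update (Function.update J k c) l d) = W I J := by
    intro J c d
    refine Finset.prod_congr rfl fun m hm => ?_
    simp only [Finset.mem_erase] at hm
    rw [Function.update_of_ne hm.1, Function.update_of_ne hm.2.1]
  have hY : ∀ J (p : Fin N × Fin N),
      QuantumOrthogonal.tensorPow N Y (Function.update (Function.update I k p.1) l p.2) J
        = prodOneTwo Y p (J k, J l) * W I J := by
    intro J p
    rw [tensorPow_apply, prod_update_update hne]
    change _ * W (Function.update (Function.update I k p.1) l p.2) J = _
    rw [hW1]
    simp [prodOneTwo, hne]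
  have hY' : ∀ J, QuantumOrthogonal.tensorPow N Y I J
        = prodOneTwo Y (I k, I l) (J k, J l) * W I J := by
    intro J
    rw [tensorPow_apply, prod_update_update hne]
    rfl
  calc ∑ p : Fin N × Fin N, B' (I k, I l) p * (QuantumOrthogonal.tensorPow N Y *ᵥ ε)
        (Function.update (Function.update I k p.1) l p.2)
      = ∑ J, (B' * prodOneTwo Y) (I k, I l) (J k, J l) * (W I J * ε J) := by
        simp only [Matrix.mulVec, dotProduct, hY, Finset.mul_sum, Matrix.mul_apply, Finset.sum_mul]
        rw [Finset.sum_comm]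
        exact Finset.sum_congr rfl fun J _ => Finset.sum_congr rfl fun p _ => by ring
    _ = ∑ x : (Fin N → Fin N) × (Fin N × Fin N),
          Z (I k, I l) x.2 * B x.2 (x.1 k, x.1 l) * (W I x.1 * ε x.1) := by
        rw [hB, Fintype.sum_prod_type]
        simp only [Matrix.mul_apply, Finset.sum_mul]
    _ = ∑ x : (Fin N → Fin N) × (Fin N × Fin N), Z (I k, I l) (x.1 k, x.1 l)
          * B (x.1 k, x.1 l) x.2
          * (W I x.1 * ε (Function.update (Function.update x.1 k x.2.1) l x.2.2)) := by
        -- The summed pair and the entries in slots k and l trade places, so that `B` acts on the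
        -- tensor instead of on the columns of Y.
        refine (Fintype.sum_equiv (slotExchange hne) _ _ fun x => ?_).symm
        have hx : slotExchange hne x
          = (Function.update (Function.update x.1 k x.2.1) l x.2.2, (x.1 k, x.1 l)) := rfl
        rw [hx]
        simp [hne, hW2]
    _ = ∑ J, Z (I k, I l) (J k, J l) * W I J * (v * ε J) := by
        rw [Fintype.sum_prod_type]
        refine Finset.sum_congr rfl fun J _ => ?_
        rw [← h k l hkl J, Finset.mul_sum]
        exact Finset.sum_congr rfl fun p _ => by ring
    _ = _ := by
        rcases hv with rfl | rfl
        · simp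
        · simp only [Matrix.mulVec, dotProduct, hY', Finset.mul_sum]
          exact Finset.sum_congr rfl fun J _ => by ring

lemma IsAdjEigen.reverse {B : Matrix (Fin N × Fin N) (Fin N × Fin N) ℂ} {v : ℂ}
    {ε : (Fin N → Fin N) → ℂ} (h : IsAdjEigen B v ε) :
    IsAdjEigen (B.submatrix Prod.swap Prod.swap) v fun I => ε (I ∘ Fin.rev) := by
  intro k l hkl I
  have h1 := h l.rev k.rev (by simp only [Fin.val_rev]; omega) (I ∘ Fin.rev)
  have hne : k ≠ l := by rintro rfl; omega
  simp only [Function.comp_apply, Fin.rev_rev] at h1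
  rw [← h1]
  refine Fintype.sum_equiv (Equiv.prodComm _ _) _ _ fun p => ?_
  simp only [Matrix.submatrix_apply, Prod.swap_prod_mk, Equiv.prodComm_apply]
  congr 2
  funext m
  simp only [Function.comp_apply, Function.update_apply, Fin.rev_eq_iff, Prod.fst_swap,
    Prod.snd_swap]
  split_ifs with h2 h3
  · exact absurd (h3.symm.trans h2) (by simpa using hne)
  all_goals rfl

lemma IsAdjEigen.inv {B B' : Matrix (Fin N × Fin N) (Fin N × Fin N) ℂ} {v : ℂ}
    {ε : (Fin N → Fin N) → ℂ} (h : IsAdjEigen B v ε) (hB : B' * B = 1) (hv : v ≠ 0) :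
    IsAdjEigen B' v⁻¹ ε := by
  intro k l hkl I
  have hne : k ≠ l := by rintro rfl; omega
  -- The eigenvalue equation is used at every multi-index that differs from I in these two slots;
  -- summing against the left inverse then collapses the sum.
  have h1 : ∀ p : Fin N × Fin N, ε (Function.update (Function.update I k p.1) l p.2)
      = v⁻¹ * ∑ p' : Fin N × Fin N, B p p'
        * ε (Function.update (Function.update I k p'.1) l p'.2) := by
    intro p
    have h2 := h k l hkl (Function.update (Function.update I k p.1) l p.2)
    rw [eq_inv_mul_iff_mul_eq₀ hv, ← h2]
    refine Finset.sum_congr rfl fun p' _ => ?_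
    simp only [Function.update_self, ne_eq, hne, not_false_eq_true, Function.update_of_ne]
    congr 2
    funext m
    by_cases h1 : m = l
    · subst h1; simp
    · by_cases h2 : m = k
      · subst h2; simp [hne]
      · simp [h1, h2]
  rw [Finset.sum_congr rfl fun p _ => congrArg (B' (I k, I l) p * ·) (h1 p)]
  simp only [Finset.mul_sum]
  rw [Finset.sum_comm]
  have h3 : ∀ p', ∑ p, B' (I k, I l) p * (v⁻¹ * (B p p'
        * ε (Function.update (Function.update I k p'.1) l p'.2)))
      = (1 : Matrix (Fin N × Fin N) (Fin N × Fin N) ℂ) (I k, I l) p'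
        * (v⁻¹ * ε (Function.update (Function.update I k p'.1) l p'.2)) := by
    intro p'
    rw [← hB, Matrix.mul_apply, Finset.sum_mul]
    exact Finset.sum_congr rfl fun p _ => by ring
  simp only [h3]
  simp [Matrix.one_apply]

lemma IsAdjEigen.conj {B : Matrix (Fin N × Fin N) (Fin N × Fin N) ℂ} {v : ℂ}
    {ε : (Fin N → Fin N) → ℂ} (h : IsAdjEigen B v ε) :
    IsAdjEigen (B.map (starRingEnd ℂ)) (starRingEnd ℂ v) fun I => starRingEnd ℂ (ε I) := by
  intro k l hkl I
  have := congrArg (starRingEnd ℂ) (h k l hkl I)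
  simpa using this

/-- R̂ is R followed by the flip of its row pair, and the flip commutes with Y ⊗ Y, so commuting
with R suffices for the eigenvalue condition. -/
lemma IsQAntisymm.tensorPow {r : ℂ} {ε : (Fin N → Fin N) → ℂ} (h : IsQAntisymm r ε)
    {Y : Matrix (Fin N) (Fin N) ℂ}
    (hR : RMatrix N r * prodOneTwo Y = prodOneTwo Y * RMatrix N r)
    (hC : Yᵀ * metric N r * Y = metric N r) :
    IsQAntisymm r (tensorPow N Y *ᵥ ε) := by
  rw [isQAntisymm_iff] at h ⊢
  refine ⟨h.1.tensorPow (Z := prodOneTwo Y) ?_ (Or.inr rfl), h.2.tensorPow (Z := 1) ?_ (Or.inl rfl)⟩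
  · have : ∀ X : Matrix (Fin N × Fin N) (Fin N × Fin N) ℂ,
        (prodOneTwo Y * X).submatrix Prod.swap id = prodOneTwo Y * X.submatrix Prod.swap id := by
      intro X
      ext x y
      simp only [Matrix.submatrix_apply, Matrix.mul_apply, id]
      refine Fintype.sum_equiv (Equiv.prodComm _ _) _ _ fun p => ?_
      simp [prodOneTwo, mul_comm]
    rw [RHat, ← this, ← hR]
    ext x y
    simp [Matrix.mul_apply]
  · rw [one_mul]
    ext x ⟨c, d⟩
    conv_rhs => rw [metricRows, Matrix.of_apply, ← hC]
    simp only [Matrix.mul_apply, metricRows, prodOneTwo, Matrix.of_apply, Fintype.sum_prod_type,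
      Finset.sum_mul, Matrix.transpose_apply]
    rw [Finset.sum_comm]
    exact Finset.sum_congr rfl fun a _ => Finset.sum_congr rfl fun b _ => by ring

/-- Reversing the slots conjugates R̂(r) by the flip, which gives the inverse of R̂(r⁻¹). The
eigenvalue -q⁻¹ is therefore inverted to -q, the value required at r⁻¹, and the metric is
transposed. -/
lemma IsQAntisymm.reverse {r : ℂ} (hr : r ≠ 0) {ε : (Fin N → Fin N) → ℂ} (h : IsQAntisymm r ε) :
    IsQAntisymm r⁻¹ fun I => ε (I ∘ Fin.rev) := by
  rw [isQAntisymm_iff] at h ⊢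
  constructor
  · have := h.1.reverse.inv (B' := RHat N r⁻¹) ?_ (by simp [hr])
    · convert this using 1
      simp
    · have : (RMatrix N r⁻¹ * RMatrix N r).submatrix Prod.swap Prod.swap
          = RHat N r⁻¹ * (RHat N r).submatrix Prod.swap Prod.swap := by
        ext x y
        simp [Matrix.mul_apply, RHat]
      rw [← this, RMatrix_inv_mul_RMatrix hr, Matrix.submatrix_one _ Prod.swap_injective]
  · convert h.2.reverse using 1
    ext x y
    simp [metricRows, metric_inv]

/-- The tensor `ε^{a_N' ⋯ a_1'}`, with indices lowered by the metric, is `q`-antisymmetric. -/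
lemma IsQAntisymm.reverse_metric {r : ℂ} [NeZero r] {ε : (Fin N → Fin N) → ℂ}
    (h : IsQAntisymm r ε) :
    IsQAntisymm r fun I => (QuantumOrthogonal.tensorPow N (metric N r) *ᵥ ε) (I ∘ Fin.rev) := by
  have hr : r ≠ 0 := NeZero.ne r
  rw [isQAntisymm_iff] at h ⊢
  have h1 : (RMatrix N r).submatrix id Prod.swap * prodOneTwo (metric N r)
      = prodOneTwo (metric N r) * RHat N r := by
    ext ⟨a, b⟩ ⟨c, d⟩
    rw [Matrix.mul_apply, Matrix.mul_apply, Finset.sum_eq_single (c.rev, d.rev),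
      Finset.sum_eq_single (a.rev, b.rev)]
    · simp only [RHat, RMatrix, prodOneTwo, metric, Matrix.submatrix_apply, Matrix.of_apply, id,
        Prod.swap_prod_mk, if_true, Fin.rev_rev]
      -- C is index conjugation times the diagonal matrix of q^{-ρ_a}. The diagonal part passes
      -- through R by weight conservation, the conjugation by `REntry_rev`.
      have := REntry_mul_diagonal r (fun a => r ^ (-twoRho a))
        (fun a => by rw [← zpow_add₀ hr, twoRho_rev]; simp) a b d.rev c.rev
      rw [mul_comm (r ^ (-twoRho c.rev)), ← this, ← REntry_rev r b.rev]
      simp only [Fin.rev_rev]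
    · rintro ⟨e, f⟩ - hef
      have : ¬ (e = a.rev ∧ f = b.rev) := fun h => hef (by rw [h.1, h.2])
      simp only [prodOneTwo, metric, Matrix.of_apply]
      split_ifs <;> simp_all
    · simp
    · rintro ⟨e, f⟩ - hef
      have : ¬ (c = e.rev ∧ d = f.rev) := fun h => hef (by rw [h.1, h.2, Fin.rev_rev, Fin.rev_rev])
      simp only [prodOneTwo, metric, Matrix.of_apply]
      split_ifs <;> simp_all
    · simp
  have h2 : (metricRows N r).submatrix Prod.swap Prod.swap * prodOneTwo (metric N r)
      = 1 * metricRows N r := by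
    rw [one_mul]
    ext x ⟨c, d⟩
    have : (metric N r)ᵀ * (metric N r)ᵀ * metric N r = metric N r := by
      rw [← Matrix.transpose_mul, metric_mul_self, Matrix.transpose_one, one_mul]
    conv_rhs => rw [metricRows, Matrix.of_apply, ← this]
    simp only [Matrix.mul_apply, metricRows, prodOneTwo, Matrix.of_apply, Fintype.sum_prod_type,
      Finset.sum_mul, Matrix.transpose_apply, Matrix.submatrix_apply, Prod.swap_prod_mk]
    rw [Finset.sum_comm]
    exact Finset.sum_congr rfl fun a _ => Finset.sum_congr rfl fun b _ => by ring
  constructor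
  · convert (h.1.tensorPow h1 (Or.inr rfl)).reverse using 1
    ext x y
    simp [RHat]
  · convert (h.2.tensorPow h2 (Or.inl rfl)).reverse using 1
    ext x y
    simp

end Antisymmetric
-- Operations preserving the defining relations
section Closure

variable {N : ℕ} {r : ℂ} {A : Type*} [Ring A] [Algebra ℂ A]

lemma scalarMat_prodOneTwo (X : Matrix (Fin N) (Fin N) ℂ) :
    scalarMat A (prodOneTwo X) = prodOneTwo (scalarMat A X) := by
  ext; simp [scalarMat, prodOneTwo]

lemma prodTwoOne_eq_prodOneTwo (X : Matrix (Fin N) (Fin N) ℂ) : prodTwoOne X = prodOneTwo X := by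
  ext; simp [prodOneTwo, prodTwoOne, mul_comm]

lemma prodTwoOne_scalarMat (X : Matrix (Fin N) (Fin N) ℂ) :
    prodTwoOne (scalarMat A X) = prodOneTwo (scalarMat A X) := by
  ext; simp only [prodOneTwo, prodTwoOne, Matrix.of_apply]; exact (commute_scalarMat _ _ _ _).eq

lemma tensorPow_scalarMat (k : ℕ) (X : Matrix (Fin N) (Fin N) ℂ) :
    tensorPow k (scalarMat A X) = scalarMat A (tensorPow k X) :=
  (map_tensorPow (Algebra.ofId ℂ A) k X).symm

lemma scalarMat_mulVec {m : Type*} [Fintype m] (X : Matrix m m ℂ) (v : m → ℂ) :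
    scalarMat A X *ᵥ (fun J => algebraMap ℂ A (v J)) = fun I => algebraMap ℂ A ((X *ᵥ v) I) := by
  funext I
  simp [Matrix.mulVec, dotProduct, scalarMat]

/-- A scalar change of basis preserving the `R`-matrix and the metric. -/
structure IsSymmetry (r : ℂ) (X Y : Matrix (Fin N) (Fin N) ℂ) : Prop where
  mul_eq_one : X * Y = 1
  rmatrix : RMatrix N r * prodOneTwo X = prodOneTwo X * RMatrix N r
  metric_left : X * metric N r * Xᵀ = metric N r
  metric_right : Xᵀ * metric N r * X = metric N r

lemma IsSymmetry.mul_eq_one' {X Y : Matrix (Fin N) (Fin N) ℂ} (h : IsSymmetry r X Y) : Y * X = 1 :=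
  mul_eq_one_comm.mp h.mul_eq_one

lemma IsSymmetry.symm {X Y : Matrix (Fin N) (Fin N) ℂ} (h : IsSymmetry r X Y) :
    IsSymmetry r Y X where
  mul_eq_one := h.mul_eq_one'
  rmatrix := by
    have h1 := prodOneTwo_mul_prodTwoOne h.mul_eq_one
    have h2 := prodOneTwo_mul_prodTwoOne h.mul_eq_one'
    rw [prodTwoOne_eq_prodOneTwo] at h1 h2
    calc RMatrix N r * prodOneTwo Y
        = prodOneTwo Y * (prodOneTwo X * RMatrix N r) * prodOneTwo Y := by
          rw [← mul_assoc, h2, one_mul]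
      _ = prodOneTwo Y * RMatrix N r * (prodOneTwo X * prodOneTwo Y) := by
          rw [← h.rmatrix]; simp only [mul_assoc]
      _ = _ := by rw [h1, mul_one]
  metric_left := by
    have h1 : Xᵀ * Yᵀ = 1 := by rw [← Matrix.transpose_mul, h.mul_eq_one', Matrix.transpose_one]
    calc Y * metric N r * Yᵀ = Y * (X * metric N r * Xᵀ) * Yᵀ := by rw [h.metric_left]
      _ = (Y * X) * metric N r * (Xᵀ * Yᵀ) := by simp only [mul_assoc]
      _ = _ := by rw [h1, h.mul_eq_one', one_mul, mul_one]
  metric_right := by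
    have h1 : Yᵀ * Xᵀ = 1 := by rw [← Matrix.transpose_mul, h.mul_eq_one, Matrix.transpose_one]
    calc Yᵀ * metric N r * Y = Yᵀ * (Xᵀ * metric N r * X) * Y := by rw [h.metric_right]
      _ = (Yᵀ * Xᵀ) * metric N r * (X * Y) := by simp only [mul_assoc]
      _ = _ := by rw [h1, h.mul_eq_one, one_mul, mul_one]

/-- For the determinant relation, Y in every slot keeps ε q-antisymmetric, U fixes the result, and X
in every slot brings back ε itself. One-dimensionality of the space of such tensors is never needed.
-/
lemma IsQOrthogonal.conj_scalarMat {U : Matrix (Fin N) (Fin N) A} (h : IsQOrthogonal r U)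
    {X Y : Matrix (Fin N) (Fin N) ℂ} (hX : IsSymmetry r X Y) :
    IsQOrthogonal r (scalarMat A X * U * scalarMat A Y) := by
  have c1 : ∀ a b c d, Commute (scalarMat A X a b) (U c d) := fun a b c d =>
    commute_scalarMat _ _ _ _
  have c2 : ∀ a b c d, Commute ((scalarMat A X * U) a b) (scalarMat A Y c d) := fun a b c d =>
    (commute_scalarMat _ _ _ _).symm
  have hsR : ∀ {X Y : Matrix (Fin N) (Fin N) ℂ}, IsSymmetry r X Y →
      scalarMat A (RMatrix N r) * prodOneTwo (scalarMat A X)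
        = prodOneTwo (scalarMat A X) * scalarMat A (RMatrix N r) := fun h => by
    rw [← scalarMat_prodOneTwo, ← scalarMat_mul, ← scalarMat_mul, h.rmatrix]
  have hsC : ∀ {X Y : Matrix (Fin N) (Fin N) ℂ}, IsSymmetry r X Y →
      scalarMat A X * scalarMat A (metric N r) * (scalarMat A X)ᵀ = scalarMat A (metric N r) :=
    fun h => by
      conv_rhs => rw [← h.metric_left]
      rw [scalarMat_mul, scalarMat_mul]; rfl
  have hsC' : ∀ {X Y : Matrix (Fin N) (Fin N) ℂ}, IsSymmetry r X Y →
      (scalarMat A X)ᵀ * scalarMat A (metric N r) * scalarMat A X = scalarMat A (metric N r) :=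
    fun h => by
      conv_rhs => rw [← h.metric_right]
      rw [scalarMat_mul, scalarMat_mul]; rfl
  constructor
  · rw [prodOneTwo_mul _ _ c2, prodOneTwo_mul _ _ c1, prodTwoOne_mul _ _ c2, prodTwoOne_mul _ _ c1,
      prodTwoOne_scalarMat, prodTwoOne_scalarMat, ← mul_assoc, ← mul_assoc, hsR hX,
      mul_assoc (prodOneTwo _), h.rtt, mul_assoc, mul_assoc, mul_assoc, mul_assoc, hsR hX.symm]
  · rw [transpose_mul_of_commute _ _ c2, transpose_mul_of_commute _ _ c1]
    calc _ = scalarMat A X * (U * (scalarMat A Y * scalarMat A (metric N r) * (scalarMat A Y)ᵀ) * Uᵀ)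
          * (scalarMat A X)ᵀ := by simp only [mul_assoc]
      _ = _ := by rw [hsC hX.symm, h.tct, hsC hX]
  · rw [transpose_mul_of_commute _ _ c2, transpose_mul_of_commute _ _ c1]
    calc _ = (scalarMat A Y)ᵀ
          * (Uᵀ * ((scalarMat A X)ᵀ * scalarMat A (metric N r) * scalarMat A X) * U)
          * scalarMat A Y := by simp only [mul_assoc]
      _ = _ := by rw [hsC' hX, h.ctt, hsC' hX.symm]
  · intro ε hε
    rw [tensorPow_mul _ _ _ c2, tensorPow_mul _ _ _ c1, ← Matrix.mulVec_mulVec,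
      tensorPow_scalarMat, tensorPow_scalarMat, scalarMat_mulVec, ← Matrix.mulVec_mulVec,
      h.det _ (hε.tensorPow hX.symm.rmatrix hX.symm.metric_right), scalarMat_mulVec,
      Matrix.mulVec_mulVec, ← tensorPow_mul _ _ _ (fun _ _ _ _ => Commute.all _ _), hX.mul_eq_one,
      tensorPow_one, Matrix.one_mulVec]

/-- The opposite product runs from right to left, which amounts to reversing both multi-indices.
This is why the determinant relation meets reversed tensors. -/
lemma tensorPow_map_op (k : ℕ) (U : Matrix (Fin N) (Fin N) A) (I J : Fin k → Fin N) :
    tensorPow k (U.map MulOpposite.op) I J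
      = MulOpposite.op (tensorPow k U (I ∘ Fin.rev) (J ∘ Fin.rev)) := by
  simp only [tensorPow, Matrix.of_apply, MulOpposite.op_list_prod, List.map_ofFn]
  congr 1
  refine List.ext_getElem (by simp) fun m h1 h2 => ?_
  simp only [List.getElem_ofFn, List.getElem_reverse, List.length_ofFn, Function.comp_apply,
    Matrix.map_apply]
  have h3 : m < k := by simpa using h1
  have h4 : ∀ h : k - 1 - m < k, Fin.rev ⟨k - 1 - m, h⟩ = ⟨m, h3⟩ := fun h => by
    ext
    rw [Fin.val_rev]
    simp only
    omega
  rw [h4]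

lemma tensorPow_map_op_mulVec (U : Matrix (Fin N) (Fin N) A) (ε : (Fin N → Fin N) → ℂ)
    (I : Fin N → Fin N) :
    (tensorPow N (U.map MulOpposite.op) *ᵥ fun J => algebraMap ℂ Aᵐᵒᵖ (ε J)) I
      = MulOpposite.op ((tensorPow N U *ᵥ fun J => algebraMap ℂ A (ε (J ∘ Fin.rev)))
          (I ∘ Fin.rev)) := by
  simp only [Matrix.mulVec, dotProduct, tensorPow_map_op, Finset.op_sum, MulOpposite.op_mul,
    ← MulOpposite.algebraMap_apply]
  refine Fintype.sum_equiv (Equiv.arrowCongr Fin.revPerm (Equiv.refl _)) _ _ fun J => ?_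
  have h1 : Equiv.arrowCongr Fin.revPerm (Equiv.refl _) J = J ∘ Fin.rev := by
    funext m; simp [Equiv.arrowCongr]
  have h2 : (J ∘ Fin.rev) ∘ Fin.rev = J := by funext m; simp
  rw [h1, h2]
  exact (Algebra.commutes _ _).symm

/-- Over the opposite algebra the relations hold for the inverse parameter. -/
lemma IsQOrthogonal.op [NeZero r] {U : Matrix (Fin N) (Fin N) A} (h : IsQOrthogonal r U) :
    IsQOrthogonal r⁻¹ (U.map MulOpposite.op) where
  rtt := by
    have hr : r ≠ 0 := NeZero.ne r
    have e1 : prodOneTwo (U.map MulOpposite.op) = (prodTwoOne U).map MulOpposite.op := rfl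
    have e2 : prodTwoOne (U.map MulOpposite.op) = (prodOneTwo U).map MulOpposite.op := rfl
    rw [e1, e2, ← map_op_scalarMat_mul, ← map_op_mul_scalarMat]
    congr 1
    have f1 : scalarMat A (RMatrix N r) * scalarMat A (RMatrix N r⁻¹) = 1 := by
      rw [← scalarMat_mul, RMatrix_mul_RMatrix_inv hr, scalarMat_one]
    have f2 : scalarMat A (RMatrix N r⁻¹) * scalarMat A (RMatrix N r) = 1 := by
      rw [← scalarMat_mul, RMatrix_inv_mul_RMatrix hr, scalarMat_one]
    calc scalarMat A (RMatrix N r⁻¹) * prodTwoOne U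
        = scalarMat A (RMatrix N r⁻¹) * (prodTwoOne U * scalarMat A (RMatrix N r))
            * scalarMat A (RMatrix N r⁻¹) := by rw [mul_assoc, mul_assoc, f1, mul_one]
      _ = _ := by rw [← h.rtt, ← mul_assoc, f2, one_mul]
  tct := by
    rw [← Matrix.transpose_map, op_mul_mul_transpose, Matrix.transpose_transpose, metric_inv]
    have : (scalarMat A (metric N r)ᵀ)ᵀ = scalarMat A (metric N r) := rfl
    rw [this, h.tct]
    rfl
  ctt := by
    rw [← Matrix.transpose_map, op_mul_mul_transpose, metric_inv]
    have : (scalarMat A (metric N r)ᵀ)ᵀ = scalarMat A (metric N r) := rfl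
    rw [this, Matrix.transpose_transpose, h.ctt]
    rfl
  det ε hε := by
    funext I
    rw [tensorPow_map_op_mulVec]
    -- Here ε is q-antisymmetric for r⁻¹, so its reversal is q-antisymmetric for r and the relation
    -- over the original algebra applies.
    have hε' := hε.reverse (inv_ne_zero (NeZero.ne r))
    rw [inv_inv] at hε'
    rw [h.det _ hε', MulOpposite.algebraMap_apply]
    have : (I ∘ Fin.rev) ∘ Fin.rev = I := by funext m; simp
    simp only [this]

/-- RTT follows from `REntry_transpose_flip`, and the two metric relations trade places. The
determinant relation has no direct transpose and is obtained through the antipode matrix C Uᵗ C. -/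
lemma IsQOrthogonal.transpose [NeZero r] {U : Matrix (Fin N) (Fin N) A} (h : IsQOrthogonal r U) :
    IsQOrthogonal r Uᵀ where
  rtt := by
    ext ⟨a, b⟩ ⟨c, d⟩
    have h1 := congrFun (congrFun h.rtt (d, c)) (b, a)
    simp only [Matrix.mul_apply, scalarMat, RMatrix, prodOneTwo, prodTwoOne, Matrix.map_apply,
      Matrix.of_apply, Matrix.transpose_apply, Fintype.sum_prod_type] at h1 ⊢
    calc ∑ x, ∑ y, algebraMap ℂ A (REntry r a b x y) * (U c x * U d y)
        = ∑ y, ∑ x, U c x * U d y * algebraMap ℂ A (REntry r y x b a) := by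
          rw [Finset.sum_comm]
          refine Finset.sum_congr rfl fun y _ => Finset.sum_congr rfl fun x _ => ?_
          rw [REntry_transpose_flip, Algebra.commutes]
      _ = _ := h1.symm
      _ = ∑ x, ∑ y, U y b * U x a * algebraMap ℂ A (REntry r x y c d) := by
          rw [Finset.sum_comm]
          refine Finset.sum_congr rfl fun x _ => Finset.sum_congr rfl fun y _ => ?_
          rw [← REntry_transpose_flip r d c, Algebra.commutes]
  tct := h.ctt
  ctt := h.tct
  det ε hε := by
    have hC : tensorPow N (scalarMat A (metric N r)) * tensorPow N (scalarMat A (metric N r)) = 1 := by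
      rw [← tensorPow_mul _ _ _ (fun _ _ _ _ => commute_scalarMat _ _ _ _),
        scalarMat_metric_mul_self, tensorPow_one]
    -- The relation for C Uᵗ C in the opposite algebra, applied to the reversal of C^{⊗N} ε. The two
    -- reversals cancel, so C Uᵗ C fixes C^{⊗N} ε; removing C, which squares to 1, leaves Uᵗ fixing
    -- ε.
    have h1 : tensorPow N (antipodeMat r U) *ᵥ
        (fun J => algebraMap ℂ A ((tensorPow N (metric N r) *ᵥ ε) J))
          = fun J => algebraMap ℂ A ((tensorPow N (metric N r) *ᵥ ε) J) := by
      have h2 := h.op_antipodeMat.det _ hε.reverse_metric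
      funext I
      have h3 := congrFun h2 (I ∘ Fin.rev)
      have hrev : ∀ J : Fin N → Fin N, (J ∘ Fin.rev) ∘ Fin.rev = J := fun J => by
        funext m; simp
      rw [tensorPow_map_op_mulVec] at h3
      simpa only [hrev, MulOpposite.algebraMap_apply, MulOpposite.op_inj] using h3
    rw [antipodeMat, tensorPow_mul _ _ _ (fun _ _ _ _ => (commute_scalarMat _ _ _ _).symm),
      tensorPow_mul _ _ _ (fun _ _ _ _ => commute_scalarMat _ _ _ _), ← scalarMat_mulVec,
      ← tensorPow_scalarMat] at h1
    have h4 := congrArg (tensorPow N (scalarMat A (metric N r)) *ᵥ ·) h1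
    simp only [Matrix.mulVec_mulVec, ← mul_assoc, hC, one_mul] at h4
    rw [mul_assoc, hC, mul_one, Matrix.one_mulVec] at h4
    exact h4

end Closure
-- Complex conjugate algebras
section Conjugate

/-- The complex conjugate of a complex algebra: the same ring, with scalars acting through
complex conjugation. -/
def ConjAlgebra (A : Type*) : Type _ := A

variable {A : Type*} [Ring A] [Algebra ℂ A]

instance : Ring (ConjAlgebra A) := inferInstanceAs (Ring A)

noncomputable instance : Algebra ℂ (ConjAlgebra A) :=
  ((algebraMap ℂ A).comp (starRingEnd ℂ)).toAlgebra' fun _ x => Algebra.commutes (A := A) _ x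

/-- The identity, as a ring isomorphism onto the conjugate algebra. -/
def toConjAlgebra : A ≃+* ConjAlgebra A := RingEquiv.refl A

lemma algebraMap_conjAlgebra (c : ℂ) :
    algebraMap ℂ (ConjAlgebra A) c = toConjAlgebra (algebraMap ℂ A (starRingEnd ℂ c)) := rfl

lemma scalarMat_conjAlgebra {m : Type*} (X : Matrix m m ℂ) :
    scalarMat (ConjAlgebra A) X = (scalarMat A (X.map (starRingEnd ℂ))).map toConjAlgebra := rfl

variable {N : ℕ} {r : ℂ}

/-- The hypotheses compare R, C and q instead of requiring that s be the conjugate of r: for even N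
and q < 0 the root r is imaginary although all of these data are real. The lemma serves s = r for ⋆
and s = r⁻¹ for ×. -/
lemma IsQOrthogonal.toConjAlgebra {s : ℂ} {U : Matrix (Fin N) (Fin N) A} (h : IsQOrthogonal s U)
    (hR : RMatrix N s = (RMatrix N r).map (starRingEnd ℂ))
    (hC : metric N s = (metric N r).map (starRingEnd ℂ)) (hq : s ^ 2 = starRingEnd ℂ (r ^ 2)) :
    IsQOrthogonal r (U.map QuantumOrthogonal.toConjAlgebra) where
  rtt := by
    rw [scalarMat_conjAlgebra, ← hR]
    exact h.rtt
  tct := by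
    rw [scalarMat_conjAlgebra, ← hC]
    exact h.tct
  ctt := by
    rw [scalarMat_conjAlgebra, ← hC]
    exact h.ctt
  det ε hε := by
    refine h.det (fun I => starRingEnd ℂ (ε I)) ?_
    rw [isQAntisymm_iff] at hε ⊢
    constructor
    · convert hε.1.conj using 1
      · rw [RHat, RHat, hR]; rfl
      · simp [hq]
    · convert hε.2.conj using 1
      · ext x y
        simp [metricRows, hC]
      · simp

end Conjugate

/-! ### Linear and antilinear maps on scalar multiples of a matrix -/

section ScalarConjugation

variable {A B : Type*} [Ring A] [Algebra ℂ A] [Ring B] [Algebra ℂ B] {m : Type*} [Fintype m]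

lemma scalarMat_mul_mul_apply (X Z : Matrix m m ℂ) (Y : Matrix m m A) (a b : m) :
    (scalarMat A X * Y * scalarMat A Z) a b = ∑ c, ∑ d, (X a c * Z d b) • Y c d := by
  simp only [Matrix.mul_apply, Finset.sum_mul]
  rw [Finset.sum_comm]
  refine Finset.sum_congr rfl fun c _ => Finset.sum_congr rfl fun d _ => ?_
  rw [scalarMat, scalarMat, Matrix.map_apply, Matrix.map_apply, ← Algebra.commutes, ← mul_assoc,
    ← map_mul, ← Algebra.smul_def, mul_comm]

lemma map_scalarMat_mul_mul (st : A →ₛₗ[starRingEnd ℂ] B) (X Z : Matrix m m ℂ)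
    (Y : Matrix m m A) :
    (scalarMat A X * Y * scalarMat A Z).map st
      = scalarMat B (X.map (starRingEnd ℂ)) * Y.map st * scalarMat B (Z.map (starRingEnd ℂ)) := by
  ext a b
  rw [Matrix.map_apply, scalarMat_mul_mul_apply, scalarMat_mul_mul_apply]
  simp

lemma algHom_map_scalarMat_mul_mul (φ : A →ₐ[ℂ] B) (X Z : Matrix m m ℂ) (Y : Matrix m m A) :
    (scalarMat A X * Y * scalarMat A Z).map φ
      = scalarMat B X * Y.map φ * scalarMat B Z := by
  rw [map_mul_apply, map_mul_apply, map_scalarMat, map_scalarMat]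

end ScalarConjugation

lemma IsStarStructure.map_algebraMap {A : Type*} [Ring A] [HopfAlgebra ℂ A]
    {st : A →ₛₗ[starRingEnd ℂ] A} (h : IsStarStructure st) (c : ℂ) :
    st (algebraMap ℂ _ c) = algebraMap ℂ _ (starRingEnd ℂ c) := by
  have h1 : st 1 = 1 := by
    have h2 := h.map_mul (st 1) 1
    rw [mul_one, h.involutive, mul_one] at h2
    exact h2.symm
  rw [Algebra.algebraMap_eq_smul_one, LinearMap.map_smulₛₗ, h1, ← Algebra.algebraMap_eq_smul_one]

/-! ### Maps of the form T ↦ X T Y -/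

namespace SOq

variable {N : ℕ} {r : ℂ}

/-- The matrix `X T Y` of linear combinations of generators. -/
noncomputable def twist (r : ℂ) (X Y : Matrix (Fin N) (Fin N) ℂ) :
    Matrix (Fin N) (Fin N) (SOq N r) :=
  scalarMat (SOq N r) X * T N r * scalarMat (SOq N r) Y

lemma twist_one : twist r (1 : Matrix (Fin N) (Fin N) ℂ) 1 = T N r := by
  rw [twist, scalarMat_one, one_mul, mul_one]

lemma scalarMat_mul_twist_mul (X Y Z W : Matrix (Fin N) (Fin N) ℂ) :
    scalarMat (SOq N r) Z * twist r X Y * scalarMat (SOq N r) W = twist r (Z * X) (Y * W) := by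
  simp only [twist, scalarMat_mul, mul_assoc]

lemma map_twist (φ : SOq N r →ₐ[ℂ] SOq N r) {X Y : Matrix (Fin N) (Fin N) ℂ}
    (h : (T N r).map φ = twist r X Y) (Z W : Matrix (Fin N) (Fin N) ℂ) :
    (twist r Z W).map φ = twist r (Z * X) (Y * W) := by
  rw [twist, algHom_map_scalarMat_mul_mul, h, scalarMat_mul_twist_mul]

lemma semilinear_map_twist (st : SOq N r →ₛₗ[starRingEnd ℂ] SOq N r)
    {X Y : Matrix (Fin N) (Fin N) ℂ} (h : (T N r).map st = twist r X Y)
    (Z W : Matrix (Fin N) (Fin N) ℂ) :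
    (twist r Z W).map st
      = twist r (Z.map (starRingEnd ℂ) * X) (Y * W.map (starRingEnd ℂ)) := by
  rw [twist, map_scalarMat_mul_mul, h, scalarMat_mul_twist_mul]

/-- Between the two tensor factors the product X T Y · X T Y contains Y X, which cancels and leaves
X Δ(T) Y. -/
lemma comul_twist {X Y : Matrix (Fin N) (Fin N) ℂ} (h : Y * X = 1) (a b : Fin N) :
    Coalgebra.comul (R := ℂ) (twist r X Y a b) = ∑ c, twist r X Y a c ⊗ₜ[ℂ] twist r X Y c b := by
  set iL : SOq N r →ₐ[ℂ] SOq N r ⊗[ℂ] SOq N r := Algebra.TensorProduct.includeLeft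
  set iR : SOq N r →ₐ[ℂ] SOq N r ⊗[ℂ] SOq N r := Algebra.TensorProduct.includeRight
  have hT : (T N r).map (Bialgebra.comulAlgHom ℂ (SOq N r)) = (T N r).map iL * (T N r).map iR := by
    ext a b
    simp [iL, iR, Matrix.mul_apply]
  have key : (twist r X Y).map (Bialgebra.comulAlgHom ℂ (SOq N r))
      = (twist r X Y).map iL * (twist r X Y).map iR := by
    simp only [twist, algHom_map_scalarMat_mul_mul, hT]
    have h1 : scalarMat (SOq N r ⊗[ℂ] SOq N r) Y * scalarMat (SOq N r ⊗[ℂ] SOq N r) X = 1 := by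
      rw [← scalarMat_mul, h, scalarMat_one]
    calc _ = scalarMat (SOq N r ⊗[ℂ] SOq N r) X * (T N r).map iL * 1 * (T N r).map iR
          * scalarMat (SOq N r ⊗[ℂ] SOq N r) Y := by simp only [mul_assoc, one_mul]
      _ = _ := by rw [← h1]; simp only [mul_assoc]
  have := congrFun (congrFun key a) b
  simpa [Matrix.mul_apply, iL, iR] using this

lemma counit_twist {X Y : Matrix (Fin N) (Fin N) ℂ} (h : X * Y = 1) (a b : Fin N) :
    Coalgebra.counit (R := ℂ) (twist r X Y a b) = (1 : Matrix (Fin N) (Fin N) ℂ) a b := by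
  have hT : (T N r).map (Bialgebra.counitAlgHom ℂ (SOq N r)) = 1 := by
    ext a b
    simp
  have hs : ∀ X : Matrix (Fin N) (Fin N) ℂ, scalarMat ℂ X = X := fun X => by ext; simp [scalarMat]
  have key : (twist r X Y).map (Bialgebra.counitAlgHom ℂ (SOq N r)) = 1 := by
    rw [twist, algHom_map_scalarMat_mul_mul, hT, hs, hs, mul_one, h]
  exact congrFun (congrFun key a) b

/-- The endomorphism `T ↦ X T Y` attached to a symmetry of the data. -/
noncomputable def symmetryHom {X Y : Matrix (Fin N) (Fin N) ℂ} (h : IsSymmetry r X Y) :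
    SOq N r →ₐ[ℂ] SOq N r :=
  lift (twist r X Y) (isQOrthogonal_T.conj_scalarMat h)

lemma map_symmetryHom {X Y : Matrix (Fin N) (Fin N) ℂ} (h : IsSymmetry r X Y) :
    (T N r).map (symmetryHom h) = twist r X Y := by
  ext a b
  exact lift_T _ _ a b

lemma symmetryHom_comp {X Y : Matrix (Fin N) (Fin N) ℂ} (h : IsSymmetry r X Y)
    {Z W : Matrix (Fin N) (Fin N) ℂ} (h' : IsSymmetry r Z W) (h1 : Z * X = 1) (h2 : Y * W = 1) :
    (symmetryHom h).comp (symmetryHom h') = AlgHom.id ℂ (SOq N r) := by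
  refine algHom_ext fun a b => ?_
  have h3 := map_twist (symmetryHom h) (map_symmetryHom h) Z W
  rw [h1, h2, twist_one, ← map_symmetryHom h'] at h3
  exact congrFun (congrFun h3 a) b

/-- The Hopf algebra automorphism `T ↦ X T X⁻¹` attached to a symmetry of the data. -/
noncomputable def symmetryEquiv {X Y : Matrix (Fin N) (Fin N) ℂ} (h : IsSymmetry r X Y) :
    SOq N r ≃ₐc[ℂ] SOq N r :=
  BialgEquiv.ofAlgEquiv
    (AlgEquiv.ofAlgHom (symmetryHom h) (symmetryHom h.symm)
      (symmetryHom_comp _ _ h.mul_eq_one' h.mul_eq_one')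
      (symmetryHom_comp _ _ h.mul_eq_one h.mul_eq_one))
    (algHom_ext fun a b => by
      have := congrFun (congrFun (map_symmetryHom h) a) b
      simp only [Matrix.map_apply] at this
      simp [this, counit_twist h.mul_eq_one])
    (algHom_ext fun a b => by
      have := fun a b => congrFun (congrFun (map_symmetryHom h) a) b
      simp only [Matrix.map_apply] at this
      simp [this, comul_twist h.mul_eq_one'])

lemma map_symmetryEquiv {X Y : Matrix (Fin N) (Fin N) ℂ} (h : IsSymmetry r X Y) :
    (T N r).map (symmetryEquiv h) = twist r X Y := map_symmetryHom h

/-- The antilinear antimultiplicative map determined by the images of the generators. -/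
noncomputable def antiHom (U : Matrix (Fin N) (Fin N) (SOq N r))
    (hU : IsQOrthogonal r ((U.map MulOpposite.op).map toConjAlgebra)) :
    SOq N r →ₛₗ[starRingEnd ℂ] SOq N r where
  toFun x := MulOpposite.unop (toConjAlgebra.symm (lift _ hU x))
  map_add' x y := by simp
  map_smul' c x := by
    rw [Algebra.smul_def, map_mul, AlgHom.commutes, algebraMap_conjAlgebra, map_mul,
      MulOpposite.unop_mul, RingEquiv.symm_apply_apply, MulOpposite.algebraMap_apply,
      MulOpposite.unop_op, ← Algebra.commutes, ← Algebra.smul_def]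

lemma map_antiHom (U : Matrix (Fin N) (Fin N) (SOq N r))
    (hU : IsQOrthogonal r ((U.map MulOpposite.op).map toConjAlgebra)) :
    (T N r).map (antiHom U hU) = U := by
  ext a b
  simp [antiHom]

lemma antiHom_mul (U : Matrix (Fin N) (Fin N) (SOq N r))
    (hU : IsQOrthogonal r ((U.map MulOpposite.op).map toConjAlgebra)) (x y : SOq N r) :
    antiHom U hU (x * y) = antiHom U hU y * antiHom U hU x := by
  simp [antiHom]

lemma antiHom_algebraMap (U : Matrix (Fin N) (Fin N) (SOq N r))
    (hU : IsQOrthogonal r ((U.map MulOpposite.op).map toConjAlgebra)) (c : ℂ) :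
    antiHom U hU (algebraMap ℂ _ c) = algebraMap ℂ _ (starRingEnd ℂ c) := by
  have h1 : antiHom U hU 1 = 1 := by simp [antiHom]
  rw [Algebra.algebraMap_eq_smul_one, LinearMap.map_smulₛₗ, h1, ← Algebra.algebraMap_eq_smul_one]

lemma map_map_mul {A : Type*} [Ring A] [Algebra ℂ A] {st : A →ₛₗ[starRingEnd ℂ] A}
    (h : ∀ x y, st (x * y) = st y * st x) (x y : A ⊗[ℂ] A) :
    TensorProduct.map st st (x * y) = TensorProduct.map st st y * TensorProduct.map st st x := by
  induction x using TensorProduct.induction_on with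
  | zero => simp
  | add x x' hx hx' => rw [add_mul, map_add, map_add, hx, hx', mul_add]
  | tmul a b =>
    induction y using TensorProduct.induction_on with
    | zero => simp
    | add y y' hy hy' => rw [mul_add, map_add, map_add, hy, hy', add_mul]
    | tmul c d => simp [h]

/-- All the axioms pass to sums and products, so the generators decide. There, applying the map
twice multiplies T on the left by the conjugate of X times X and on the right by Y times its
conjugate, which explains the last two hypotheses. -/
lemma isStarStructure_of_twist [NeZero r] {st : SOq N r →ₛₗ[starRingEnd ℂ] SOq N r}
    (hmul : ∀ x y, st (x * y) = st y * st x)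
    (hc : ∀ c, st (algebraMap ℂ _ c) = algebraMap ℂ _ (starRingEnd ℂ c))
    {X Y : Matrix (Fin N) (Fin N) ℂ} (hT : (T N r).map st = twist r X Y) (hXY : X * Y = 1)
    (h1 : X.map (starRingEnd ℂ) * X = 1) (h2 : Y * Y.map (starRingEnd ℂ) = 1) :
    IsStarStructure st where
  map_mul := hmul
  involutive x := by
    induction x using SOq.induction with
    | hs c => simp [hc]
    | hT a b =>
      have h3 := semilinear_map_twist st hT X Y
      rw [h1, h2, twist_one, ← hT] at h3
      exact congrFun (congrFun h3 a) b
    | hm x y hx hy => rw [hmul, hmul, hx, hy]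
    | ha x y hx hy => rw [map_add, map_add, hx, hy]
  comul x := by
    induction x using SOq.induction with
    | hs c =>
      rw [hc, Bialgebra.comul_algebraMap, Bialgebra.comul_algebraMap,
        Algebra.TensorProduct.algebraMap_apply, Algebra.TensorProduct.algebraMap_apply,
        TensorProduct.map_tmul, hc]
      have := hc 1
      simp only [map_one] at this
      rw [this]
    | hT a b =>
      have h3 : ∀ a b, st (T N r a b) = twist r X Y a b := fun a b => congrFun (congrFun hT a) b
      rw [h3, comul_twist (mul_eq_one_comm.mp hXY), comul_T]
      simp [h3]
    | hm x y hx hy => rw [hmul, Bialgebra.comul_mul, hx, hy, Bialgebra.comul_mul, map_map_mul hmul]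
    | ha x y hx hy => simp only [map_add, hx, hy]
  counit x := by
    induction x using SOq.induction with
    | hs c => simp [hc]
    | hT a b =>
      have h3 : st (T N r a b) = twist r X Y a b := congrFun (congrFun hT a) b
      rw [h3, counit_twist hXY, counit_T]
      simp [Matrix.one_apply, apply_ite]
    | hm x y hx hy => rw [hmul, Bialgebra.counit_mul, hx, hy, Bialgebra.counit_mul, map_mul, mul_comm]
    | ha x y hx hy => simp only [map_add, hx, hy]

/-- Two compositions of a star structure with Hopf algebra automorphisms agree when they agree on
the generators. -/
lemma star_comm_of_twist [NeZero r] {st st' : SOq N r →ₛₗ[starRingEnd ℂ] SOq N r}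
    (h : IsStarStructure st) (h' : IsStarStructure st')
    {φ ψ : SOq N r ≃ₐc[ℂ] SOq N r}
    (hT : ((T N r).map st).map φ = ((T N r).map ψ).map st') (x : SOq N r) :
    φ (st x) = st' (ψ x) := by
  have hφ : ∀ c, φ (algebraMap ℂ _ c) = algebraMap ℂ _ c := AlgHomClass.commutes φ
  have hψ : ∀ c, ψ (algebraMap ℂ _ c) = algebraMap ℂ _ c := AlgHomClass.commutes ψ
  induction x using SOq.induction with
  | hs c => rw [h.map_algebraMap, hφ, hψ, h'.map_algebraMap]
  | hT a b => exact congrFun (congrFun hT a) b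
  | hm x y hx hy => rw [h.map_mul, map_mul, map_mul, h'.map_mul, hx, hy]
  | ha x y hx hy => simp only [map_add, hx, hy]

/-- The composition of a star structure with an automorphism. -/
noncomputable def compStar (φ : SOq N r ≃ₐc[ℂ] SOq N r)
    (st : SOq N r →ₛₗ[starRingEnd ℂ] SOq N r) : SOq N r →ₛₗ[starRingEnd ℂ] SOq N r where
  toFun x := φ (st x)
  map_add' x y := by simp
  map_smul' c x := by rw [LinearMap.map_smulₛₗ, map_smul]

end SOq
-- Symmetries of R and C; reality of the scalar data
section Symmetries

variable {N : ℕ} {r : ℂ}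

lemma isSymmetry_diagonal (r : ℂ) (x : Fin N → ℂ) (hx : ∀ a, x a * x a.rev = 1) :
    IsSymmetry r (Matrix.diagonal x) (Matrix.diagonal fun a => x a.rev) where
  mul_eq_one := by
    rw [Matrix.diagonal_mul_diagonal]
    simp [hx]
  rmatrix := by
    have : prodOneTwo (Matrix.diagonal x) = Matrix.diagonal fun p : Fin N × Fin N => x p.1 * x p.2 := by
      ext ⟨a, b⟩ ⟨c, d⟩
      by_cases h1 : a = c <;> by_cases h2 : b = d <;>
        simp [prodOneTwo, Matrix.diagonal_apply, h1, h2]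
    rw [this]
    ext ⟨a, b⟩ ⟨c, d⟩
    rw [Matrix.mul_diagonal, Matrix.diagonal_mul]
    exact (REntry_mul_diagonal r x hx a b c d).symm
  metric_left := by
    rw [Matrix.diagonal_transpose]
    ext a b
    rw [Matrix.mul_diagonal, Matrix.diagonal_mul, metric, Matrix.of_apply]
    split_ifs with h
    · rw [h, mul_right_comm, hx, one_mul]
    · simp
  metric_right := by
    rw [Matrix.diagonal_transpose]
    ext a b
    rw [Matrix.mul_diagonal, Matrix.diagonal_mul, metric, Matrix.of_apply]
    split_ifs with h
    · rw [h, mul_right_comm, hx, one_mul]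
    · simp

lemma dMatrix_of_odd (h : ¬ Even N) :
    dMatrix N = Matrix.diagonal fun a : Fin N => if a = a.rev then (-1 : ℂ) else 1 := by
  ext a b
  have hN := Nat.not_even_iff.mp h
  have : (a : ℕ) = N / 2 ↔ a = a.rev := by
    rw [Fin.ext_iff, Fin.val_rev]
    omega
  simp only [dMatrix, Matrix.of_apply, h, if_false, Matrix.diagonal_apply, this]

lemma exists_dMatrix_of_even (h : Even N) (hN : 1 ≤ N) :
    ∃ i j : Fin N, (i : ℕ) + 1 = N / 2 ∧ (j : ℕ) = i + 1 ∧ j = i.rev ∧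
      dMatrix N = Matrix.of fun a b => if b = Equiv.swap i j a then 1 else 0 := by
  obtain ⟨n, hn⟩ := h
  refine ⟨⟨n - 1, by omega⟩, ⟨n, by omega⟩, ?_, ?_, ?_, ?_⟩
  · simp only; omega
  · simp only; omega
  · rw [Fin.ext_iff, Fin.val_rev]; simp only; omega
  · have hj : ((⟨n, by omega⟩ : Fin N) : ℕ) = ((⟨n - 1, by omega⟩ : Fin N) : ℕ) + 1 := by
      simp only; omega
    ext a b
    simp only [dMatrix, Matrix.of_apply, show Even N from ⟨n, hn⟩, if_true]
    simp only [Fin.ext_iff, val_swap hj]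
    split_ifs <;> first | rfl | omega

/-- For even N this is the invariance of R and C under the exchange of the two middle indices. For
odd N, 𝒟 is diagonal with x_a x_{a'} = 1, since the middle index is its own conjugate and (-1)² = 1.
-/
lemma isSymmetry_dMatrix (hN : 1 ≤ N) (r : ℂ) : IsSymmetry r (dMatrix N) (dMatrix N) := by
  by_cases h : Even N
  · obtain ⟨i, j, -, hj, hij, hD⟩ := exists_dMatrix_of_even h hN
    rw [hD]
    have hsym : ∀ a b : Fin N, b = Equiv.swap i j a ↔ a = Equiv.swap i j b := fun a b => by
      constructor <;> rintro rfl <;> simp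
    have hC : ∀ a b : Fin N, metric N r (Equiv.swap i j a) (Equiv.swap i j b) = metric N r a b := by
      intro a b
      simp only [metric, Matrix.of_apply, rev_swap hj hij, (Equiv.swap i j).injective.eq_iff,
        twoRho_swap hj hij]
    refine ⟨?_, ?_, ?_, ?_⟩
    · ext a b
      simp only [Matrix.mul_apply, Matrix.of_apply, mul_ite, mul_one, mul_zero, hsym _ b]
      simp [Matrix.one_apply, eq_comm]
    · ext ⟨a, b⟩ ⟨c, d⟩
      simp only [Matrix.mul_apply, Fintype.sum_prod_type, prodOneTwo, Matrix.of_apply, RMatrix,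
        mul_ite, mul_one, mul_zero, ite_mul, one_mul, zero_mul]
      simp only [hsym _ c, hsym _ d]
      have := REntry_swap hj hij r a b (Equiv.swap i j c) (Equiv.swap i j d)
      simp only [Equiv.swap_apply_self] at this
      simp [this]
    · ext a b
      simp only [Matrix.mul_apply, Matrix.of_apply, Matrix.transpose_apply, mul_ite, mul_one,
        mul_zero, ite_mul, one_mul, zero_mul]
      simp [hC]
    · ext a b
      simp only [Matrix.mul_apply, Matrix.of_apply, Matrix.transpose_apply, mul_ite, mul_one,
        mul_zero, ite_mul, one_mul, zero_mul, hsym _ a, hsym _ b]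
      simp [hC]
  · have := isSymmetry_diagonal r (fun a : Fin N => if a = a.rev then (-1 : ℂ) else 1) (by
      intro a
      by_cases h : a = a.rev
      · simp [← h]
      · simp [h, Ne.symm h])
    rw [dMatrix_of_odd h]
    convert this using 2
    funext a
    simp [eq_comm]

lemma dMatrix_transpose (N : ℕ) : (dMatrix N)ᵀ = dMatrix N := by
  ext a b
  simp only [dMatrix, Matrix.transpose_apply, Matrix.of_apply]
  by_cases h : Even N
  · simp only [h, if_true]
    grind
  · simp only [h, if_false]
    grind

lemma dMatrix_conj (N : ℕ) : (dMatrix N).map (starRingEnd ℂ) = dMatrix N := by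
  ext a b
  simp only [dMatrix, Matrix.map_apply, Matrix.of_apply]
  split_ifs <;> simp

lemma dMatrix_mul_self (hN : 1 ≤ N) : dMatrix N * dMatrix N = 1 :=
  (isSymmetry_dMatrix hN 1).mul_eq_one

lemma dMatrix_inv (hN : 1 ≤ N) : (dMatrix N)⁻¹ = dMatrix N :=
  Matrix.inv_eq_left_inv (dMatrix_mul_self hN)

lemma metric_mul_dMatrix (hN : 1 ≤ N) (r : ℂ) :
    metric N r * dMatrix N = dMatrix N * metric N r := by
  have h := (isSymmetry_dMatrix hN r).metric_left
  rw [dMatrix_transpose] at h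
  calc metric N r * dMatrix N = dMatrix N * metric N r * (dMatrix N * dMatrix N) := by
        conv_lhs => rw [← h]
        simp only [mul_assoc]
    _ = _ := by rw [dMatrix_mul_self hN, mul_one]

lemma transpose_metric_mul_dMatrix (hN : 1 ≤ N) (r : ℂ) :
    (metric N r)ᵀ * dMatrix N = dMatrix N * (metric N r)ᵀ := by
  rw [← metric_inv, metric_mul_dMatrix hN]

lemma RMatrix_conj (r : ℂ) :
    RMatrix N (starRingEnd ℂ r) = (RMatrix N r).map (starRingEnd ℂ) := by
  ext x y
  simp only [RMatrix, REntry_eq, diagCoeff, Matrix.of_apply, Matrix.map_apply, map_sub, map_add,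
    apply_ite (starRingEnd ℂ), map_mul, map_inv₀, map_pow, map_one, map_zero, map_zpow₀]

lemma metric_conj (r : ℂ) :
    metric N (starRingEnd ℂ r) = (metric N r).map (starRingEnd ℂ) := by
  ext x y
  simp only [metric, Matrix.of_apply, Matrix.map_apply, apply_ite (starRingEnd ℂ), map_zero,
    map_zpow₀]

lemma even_twoRho (hN : Even N) (a : Fin N) : Even (twoRho a) := by
  obtain ⟨n, hn⟩ := hN
  unfold twoRho
  split_ifs
  · exact ⟨n - 1 - (a : ℕ), by omega⟩
  · exact ⟨-(n - 1 - (a.rev : ℕ)), by omega⟩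
  · exact ⟨0, rfl⟩

/-- For even N every ρ_a is an integer, so only powers of q occur and the choice of square root is
immaterial. -/
lemma RMatrix_neg (hN : Even N) (r : ℂ) : RMatrix N (-r) = RMatrix N r := by
  ext x y
  simp only [RMatrix, REntry_eq, diagCoeff, Matrix.of_apply, neg_sq,
    ((even_twoRho hN _).sub (even_twoRho hN _)).neg_zpow]

lemma metric_neg (hN : Even N) (r : ℂ) : metric N (-r) = metric N r := by
  ext x y
  simp only [metric, Matrix.of_apply, (even_twoRho hN _).neg.neg_zpow]

lemma conj_sq_of_im_eq_zero (h : (r ^ 2).im = 0) : starRingEnd ℂ (r ^ 2) = r ^ 2 :=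
  Complex.conj_eq_iff_im.mpr h

/-- Real q makes the conjugate of r equal to ±r. The minus sign forces Re r = 0, hence q ≤ 0, which
the positivity assumption rules out for odd N. -/
lemma conj_eq_or_even (h : (r ^ 2).im = 0) (hN : Odd N → 0 < (r ^ 2).re) :
    starRingEnd ℂ r = r ∨ (starRingEnd ℂ r = -r ∧ Even N) := by
  have h1 := conj_sq_of_im_eq_zero h
  rw [map_pow, sq_eq_sq_iff_eq_or_eq_neg] at h1
  rcases h1 with h1 | h1
  · exact Or.inl h1
  · by_cases he : Even N
    · exact Or.inr ⟨h1, he⟩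
    · exfalso
      have h2 := hN (Nat.not_even_iff_odd.mp he)
      have h3 : r.re = 0 := by
        have := congrArg Complex.re h1
        simp only [Complex.conj_re, Complex.neg_re] at this
        linarith
      rw [sq, Complex.mul_re, h3] at h2
      nlinarith [sq_nonneg r.im]

lemma RMatrix_real (h : (r ^ 2).im = 0) (hN : Odd N → 0 < (r ^ 2).re) :
    RMatrix N r = (RMatrix N r).map (starRingEnd ℂ) := by
  rw [← RMatrix_conj]
  rcases conj_eq_or_even h hN with h1 | ⟨h1, he⟩
  · rw [h1]
  · rw [h1, RMatrix_neg he]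

lemma metric_real (h : (r ^ 2).im = 0) (hN : Odd N → 0 < (r ^ 2).re) :
    metric N r = (metric N r).map (starRingEnd ℂ) := by
  rw [← metric_conj]
  rcases conj_eq_or_even h hN with h1 | ⟨h1, he⟩
  · rw [h1]
  · rw [h1, metric_neg he]

end Symmetries

/-! ### The automorphism ♯, the star structures ⋆ and ×, and the intertwiner α -/

namespace SOq

variable {N : ℕ} {r : ℂ}

/-- The Hopf algebra automorphism `♯`, with `T ↦ 𝒟 T 𝒟⁻¹`. -/
noncomputable def sharp (hN : 1 ≤ N) (r : ℂ) : SOq N r ≃ₐc[ℂ] SOq N r :=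
  symmetryEquiv (isSymmetry_dMatrix hN r)

lemma map_sharp (hN : 1 ≤ N) : (T N r).map (sharp hN r) = twist r (dMatrix N) (dMatrix N) :=
  map_symmetryEquiv _

lemma bialgEquiv_map_twist (φ : SOq N r ≃ₐc[ℂ] SOq N r) {X Y : Matrix (Fin N) (Fin N) ℂ}
    (h : (T N r).map φ = twist r X Y) (Z W : Matrix (Fin N) (Fin N) ℂ) :
    (twist r Z W).map φ = twist r (Z * X) (Y * W) :=
  map_twist (AlgHomClass.toAlgHom φ) h Z W

lemma sharp_sharp (hN : 1 ≤ N) (x : SOq N r) : sharp hN r (sharp hN r x) = x := by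
  have h : (symmetryHom (isSymmetry_dMatrix hN r)).comp (symmetryHom (isSymmetry_dMatrix hN r))
      = AlgHom.id ℂ (SOq N r) := symmetryHom_comp _ _ (dMatrix_mul_self hN) (dMatrix_mul_self hN)
  exact DFunLike.congr_fun h x

/-- Cᵗ T Cᵗ is the transpose of the antipode matrix C Tᵗ C. Hence the relations hold in the opposite
algebra with the same parameter, and conjugation preserves them because R, C and q are real. -/
lemma exists_star [NeZero r] (h : (r ^ 2).im = 0) (hN : Odd N → 0 < (r ^ 2).re) :
    ∃ st : SOq N r →ₛₗ[starRingEnd ℂ] SOq N r, IsStarStructure st ∧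
      (T N r).map st = twist r (metric N r)ᵀ (metric N r)ᵀ := by
  have hU : IsQOrthogonal r
      (((twist r (metric N r)ᵀ (metric N r)ᵀ).map MulOpposite.op).map toConjAlgebra) := by
    have h1 := (isQOrthogonal_T (N := N) (r := r)).op_antipodeMat.transpose.toConjAlgebra (r := r)
      (RMatrix_real h hN) (metric_real h hN) (conj_sq_of_im_eq_zero h).symm
    rw [← Matrix.transpose_map, antipodeMat_transpose] at h1
    exact h1
  have hmul : (metric N r)ᵀ * (metric N r)ᵀ = 1 := by
    rw [← Matrix.transpose_mul, metric_mul_self, Matrix.transpose_one]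
  have hconj : (metric N r)ᵀ.map (starRingEnd ℂ) = (metric N r)ᵀ :=
    congrArg Matrix.transpose (metric_real h hN).symm
  exact ⟨antiHom _ hU, isStarStructure_of_twist (antiHom_mul _ hU) (antiHom_algebraMap _ hU)
    (map_antiHom _ hU) hmul (by rw [hconj, hmul]) (by rw [hconj, hmul]), map_antiHom _ hU⟩

lemma conj_eq_inv (h : ‖r ^ 2‖ = 1) : starRingEnd ℂ r = r⁻¹ := by
  have : ‖r‖ = 1 := by
    rw [norm_pow] at h
    exact (pow_eq_one_iff_of_nonneg (norm_nonneg r) two_ne_zero).mp h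
  exact (Complex.inv_eq_conj this).symm

/-- The opposite algebra turns r into r⁻¹; for |q| = 1 this is the complex conjugate of r, so
conjugating the algebra returns to r. -/
lemma exists_cross [NeZero r] (h : ‖r ^ 2‖ = 1) :
    ∃ st : SOq N r →ₛₗ[starRingEnd ℂ] SOq N r, IsStarStructure st ∧
      (T N r).map st = twist r 1 1 := by
  have hU : IsQOrthogonal r (((twist r (1 : Matrix (Fin N) (Fin N) ℂ) 1).map MulOpposite.op).map toConjAlgebra) := by
    rw [twist_one]
    refine (isQOrthogonal_T (N := N) (r := r)).op.toConjAlgebra ?_ ?_ ?_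
    · rw [← RMatrix_conj, conj_eq_inv h]
    · rw [← metric_conj, conj_eq_inv h]
    · rw [map_pow, conj_eq_inv h]
  exact ⟨antiHom _ hU, isStarStructure_of_twist (antiHom_mul _ hU) (antiHom_algebraMap _ hU)
    (map_antiHom _ hU) (mul_one 1) (by simp) (by simp), map_antiHom _ hU⟩

/-- The composition of `♯` with a star structure `T ↦ V T V⁻¹`, where `V` is a real involution
commuting with `𝒟`. -/
lemma compStar_sharp [NeZero r] (hN : 1 ≤ N) {st : SOq N r →ₛₗ[starRingEnd ℂ] SOq N r}
    (hst : IsStarStructure st) {V : Matrix (Fin N) (Fin N) ℂ} (hT : (T N r).map st = twist r V V)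
    (hV : V.map (starRingEnd ℂ) = V) (hVV : V * V = 1) (hVD : V * dMatrix N = dMatrix N * V) :
    (∀ x, compStar (sharp hN r) st x = st (sharp hN r x)) ∧
      IsStarStructure (compStar (sharp hN r) st) ∧
      (T N r).map (compStar (sharp hN r) st) = twist r (V * dMatrix N) (dMatrix N * V) := by
  have hDD := dMatrix_mul_self hN
  have hT' : (T N r).map (compStar (sharp hN r) st) = twist r (V * dMatrix N) (dMatrix N * V) := by
    have := bialgEquiv_map_twist _ (map_sharp (r := r) hN) V V
    rw [← hT] at this
    exact this
  have hcomm : ∀ x, sharp hN r (st x) = st (sharp hN r x) := by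
    refine star_comm_of_twist hst hst ?_
    rw [map_sharp, semilinear_map_twist st hT, hT, bialgEquiv_map_twist _ (map_sharp hN),
      dMatrix_conj, hVD]
  have hinv : V * dMatrix N * (dMatrix N * V) = 1 := by
    rw [mul_assoc, ← mul_assoc (dMatrix N), hDD, one_mul, hVV]
  have hconj : (V * dMatrix N).map (starRingEnd ℂ) = V * dMatrix N := by
    rw [Matrix.map_mul, hV, dMatrix_conj]
  have hconj' : (dMatrix N * V).map (starRingEnd ℂ) = dMatrix N * V := by
    rw [Matrix.map_mul, hV, dMatrix_conj]
  refine ⟨hcomm, isStarStructure_of_twist ?_ ?_ hT' hinv ?_ ?_, hT'⟩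
  · intro x y
    change sharp hN r (st (x * y)) = sharp hN r (st y) * sharp hN r (st x)
    rw [hst.map_mul, map_mul]
  · intro c
    change sharp hN r (st (algebraMap ℂ _ c)) = _
    rw [hst.map_algebraMap]
    exact AlgHomClass.commutes _ _
  · rw [hconj]
    conv_lhs => rw [hVD, mul_assoc, ← hVD, ← mul_assoc V, hVV, one_mul, hDD]
  · rw [hconj']
    conv_lhs => rw [mul_assoc, ← mul_assoc V, hVD, mul_assoc, hVV, mul_one, hDD]

/-- For `N = 2n + 1`, the diagonal matrix intertwining `×♯` and `×`. -/
noncomputable def twistVec (N : ℕ) (a : Fin N) : ℂ :=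
  if a < a.rev then Complex.I else if a.rev < a then -Complex.I else 1

lemma twistVec_mul_rev (a : Fin N) : twistVec N a * twistVec N a.rev = 1 := by
  simp only [twistVec, Fin.rev_rev]
  rcases lt_trichotomy a a.rev with h | h | h
  · simp [h, h.not_gt]
  · simp [← h]
  · simp [h, h.not_gt]

/-- With A the diagonal matrix of `twistVec` and Ā its conjugate, α followed by × involves Ā, while
×♯ followed by α involves 𝒟A. The two agree up to a common sign, and T ↦ X T X⁻¹ does not see the
sign of X. -/
lemma exists_intertwiner [NeZero r] (hN : 1 ≤ N) (hodd : ¬ Even N)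
    {st : SOq N r →ₛₗ[starRingEnd ℂ] SOq N r}
    (hst : IsStarStructure st) (hT : (T N r).map st = twist r 1 1) :
    ∃ α : SOq N r ≃ₐc[ℂ] SOq N r, ∀ x, α (compStar (sharp hN r) st x) = st (α x) := by
  obtain ⟨-, hst', hT'⟩ := compStar_sharp hN hst hT (by simp) (mul_one 1) (by simp)
  set A := isSymmetry_diagonal r (twistVec N) twistVec_mul_rev with hA
  refine ⟨symmetryEquiv A, star_comm_of_twist hst' hst ?_⟩
  rw [hT', bialgEquiv_map_twist _ (map_symmetryEquiv A), map_symmetryEquiv A,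
    semilinear_map_twist st hT]
  have h1 : (Matrix.diagonal (twistVec N)).map (starRingEnd ℂ)
      = -(dMatrix N * Matrix.diagonal (twistVec N)) := by
    rw [dMatrix_of_odd hodd, Matrix.diagonal_mul_diagonal, Matrix.diagonal_map (map_zero _),
      Matrix.diagonal_neg]
    congr 1
    funext a
    simp only [twistVec]
    rcases lt_trichotomy a a.rev with h | h | h
    · simp [h, h.ne]
    · simp [← h]
    · simp [h, h.not_gt, h.ne']
  have h2 : (Matrix.diagonal fun a => twistVec N a.rev).map (starRingEnd ℂ)
      = -((Matrix.diagonal fun a => twistVec N a.rev) * dMatrix N) := by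
    rw [dMatrix_of_odd hodd, Matrix.diagonal_mul_diagonal, Matrix.diagonal_map (map_zero _),
      Matrix.diagonal_neg]
    congr 1
    funext a
    simp only [twistVec, Fin.rev_rev]
    rcases lt_trichotomy a a.rev with h | h | h
    · simp [h, h.ne, h.not_gt]
    · simp [← h]
    · simp [h, h.ne']
  have h3 : ∀ X Y : Matrix (Fin N) (Fin N) ℂ, twist r (-X) (-Y) = twist r X Y := by
    intro X Y
    have : ∀ X : Matrix (Fin N) (Fin N) ℂ, scalarMat (SOq N r) (-X) = -scalarMat (SOq N r) X := by
      intro X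
      ext
      simp [scalarMat]
    rw [twist, this, this, neg_mul, neg_mul_neg]
    rfl
  rw [h1, h2, one_mul, mul_one, mul_one, one_mul, h3]

end SOq
-- The relations at q = 1
section Classical

variable {N : ℕ} {r : ℂ}

lemma RMatrix_of_sq_eq_one (h : r ^ 2 = 1) : RMatrix N r = 1 := by
  ext ⟨a, b⟩ ⟨c, d⟩
  simp only [RMatrix, Matrix.of_apply, REntry_eq, diagCoeff, h, inv_one, sub_self, zero_mul,
    ite_self, add_zero, sub_zero, Matrix.one_apply, Prod.mk.injEq]
  exact if_congr ⟨fun h => ⟨h.1.symm, h.2.symm⟩, fun h => ⟨h.1.symm, h.2.symm⟩⟩ rfl rfl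

/-- At q = 1 the matrix R is the identity, so R̂ is the flip of two slots and the eigenvalue is -1.
-/
lemma isAdjEigen_RHat_iff (h : r ^ 2 = 1) {ε : (Fin N → Fin N) → ℂ} :
    IsAdjEigen (RHat N r) (-(r ^ 2)⁻¹) ε ↔
      ∀ k l : Fin N, (k : ℕ) + 1 = l → ∀ I, ε (I ∘ Equiv.swap k l) = -ε I := by
  refine forall_congr' fun k => forall_congr' fun l => forall_congr' fun hkl =>
    forall_congr' fun I => ?_
  have hne : k ≠ l := by rintro rfl; omega
  have hR : ∀ p, RHat N r (I k, I l) p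
      = (1 : Matrix (Fin N × Fin N) (Fin N × Fin N) ℂ) (I l, I k) p := fun p => by
    rw [RHat, RMatrix_of_sq_eq_one h]
    rfl
  simp only [hR]
  rw [Finset.sum_eq_single (I l, I k)]
  · have h1 : Function.update (Function.update I k (I l)) l (I k) = I ∘ Equiv.swap k l := by
      funext m
      simp only [Function.comp_apply, Equiv.swap_apply_def, Function.update_apply]
      split_ifs with h1 h2 <;> simp_all
    simp [h, h1]
  · rintro p - hp
    rw [Matrix.one_apply_ne hp.symm, zero_mul]
  · simp

lemma apply_comp_perm {ε : (Fin N → Fin N) → ℂ}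
    (h : ∀ k l : Fin N, (k : ℕ) + 1 = l → ∀ I, ε (I ∘ Equiv.swap k l) = -ε I)
    (σ : Equiv.Perm (Fin N)) (I : Fin N → Fin N) :
    ε (I ∘ σ) = ((Equiv.Perm.sign σ : ℤ) : ℂ) * ε I := by
  obtain _ | n := N
  · obtain rfl : σ = 1 := Subsingleton.elim _ _
    simp
  · have hσ : σ ∈ Submonoid.closure
        (Set.range fun i : Fin n => Equiv.swap i.castSucc i.succ) := by
      rw [Equiv.Perm.mclosure_swap_castSucc_succ]
      exact Submonoid.mem_top _
    induction hσ using Submonoid.closure_induction generalizing I with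
    | mem τ hτ =>
      obtain ⟨i, rfl⟩ := hτ
      have hne : i.castSucc ≠ i.succ := i.castSucc_lt_succ.ne
      rw [h _ _ (by simp), Equiv.Perm.sign_swap hne]
      simp
    | one => simp
    | mul τ υ _ _ hτ hυ =>
      have : I ∘ (τ * υ : Equiv.Perm (Fin (n + 1))) = (I ∘ τ) ∘ υ := rfl
      rw [this, hυ, hτ, Equiv.Perm.sign_mul]
      push_cast
      ring

lemma apply_eq_zero {ε : (Fin N → Fin N) → ℂ}
    (h : ∀ k l : Fin N, (k : ℕ) + 1 = l → ∀ I, ε (I ∘ Equiv.swap k l) = -ε I)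
    {I : Fin N → Fin N} (hI : ¬ Function.Injective I) : ε I = 0 := by
  simp only [Function.Injective, not_forall] at hI
  obtain ⟨a, b, hab, hne⟩ := hI
  have h1 := apply_comp_perm h (Equiv.swap a b) I
  have h2 : I ∘ Equiv.swap a b = I := by
    funext m
    simp only [Function.comp_apply, Equiv.swap_apply_def]
    split_ifs <;> simp_all
  rw [h2, Equiv.Perm.sign_swap hne] at h1
  simp only [Units.val_neg, Units.val_one, Int.cast_neg, Int.cast_one, neg_mul, one_mul] at h1
  linear_combination (1 / 2) * h1

/-- Only injective multi-indices, that is permutations, contribute to the contraction, and the sum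
is the Leibniz formula for the matrix whose rows are selected by I. Permuting rows or repeating one
then compares it with det X. -/
lemma tensorPow_mulVec_of_antisymm {ε : (Fin N → Fin N) → ℂ}
    (h : ∀ k l : Fin N, (k : ℕ) + 1 = l → ∀ I, ε (I ∘ Equiv.swap k l) = -ε I)
    (X : Matrix (Fin N) (Fin N) ℂ) :
    tensorPow N X *ᵥ ε = X.det • ε := by
  have h1 : ∀ I, (tensorPow N X *ᵥ ε) I = (X.submatrix I id).det * ε id := by
    intro I
    have h2 : ∑ J : Fin N → Fin N, (∏ m, X (I m) (J m)) * ε J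
        = ∑ σ : Equiv.Perm (Fin N), (∏ m, X (I m) (σ m)) * ε σ := by
      refine (Finset.sum_of_injOn (fun σ : Equiv.Perm (Fin N) => (σ : Fin N → Fin N))
        DFunLike.coe_injective.injOn (by simp) ?_ (by simp)).symm
      intro J _ hJ
      rw [apply_eq_zero h, mul_zero]
      intro hinj
      refine hJ ⟨Equiv.ofBijective J (Finite.injective_iff_bijective.mp hinj), by simp, rfl⟩
    simp only [Matrix.mulVec, dotProduct, tensorPow_apply]
    rw [h2, ← Matrix.det_transpose, Matrix.det_apply', Finset.sum_mul]
    refine Finset.sum_congr rfl fun σ _ => ?_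
    have h3 := apply_comp_perm h σ id
    rw [Function.id_comp] at h3
    rw [h3]
    simp only [Matrix.transpose_apply, Matrix.submatrix_apply, id]
    ring
  funext I
  rw [h1, Pi.smul_apply, smul_eq_mul]
  by_cases hI : Function.Injective I
  · have h3 := apply_comp_perm h (Equiv.ofBijective I (Finite.injective_iff_bijective.mp hI)) id
    have h4 := Matrix.det_permute (Equiv.ofBijective I (Finite.injective_iff_bijective.mp hI)) X
    rw [Function.id_comp, Equiv.coe_ofBijective] at h3
    rw [Equiv.coe_ofBijective] at h4
    rw [h3, h4]
    ring
  · rw [apply_eq_zero h hI]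
    simp only [Function.Injective, not_forall] at hI
    obtain ⟨a, b, hab, hne⟩ := hI
    rw [Matrix.det_zero_of_row_eq hne]
    · simp
    · funext j
      simp [hab]

lemma metric_transpose_of_sq_eq_one (h : r ^ 2 = 1) : (metric N r)ᵀ = metric N r := by
  rw [← metric_inv, inv_eq_of_mul_eq_one_right (b := r) (by rw [← sq, h])]

/-- At `q = 1` the sign tensor is antisymmetric. -/
lemma isQAntisymm_det (h : r ^ 2 = 1) :
    IsQAntisymm r fun J : Fin N → Fin N => ((1 : Matrix (Fin N) (Fin N) ℂ).submatrix J id).det := by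
  have h1 : ∀ k l : Fin N, k ≠ l → ∀ I : Fin N → Fin N,
      ((1 : Matrix (Fin N) (Fin N) ℂ).submatrix (I ∘ Equiv.swap k l) id).det
        = -((1 : Matrix (Fin N) (Fin N) ℂ).submatrix I id).det := by
    intro k l hne I
    have := Matrix.det_permute (Equiv.swap k l) ((1 : Matrix (Fin N) (Fin N) ℂ).submatrix I id)
    rw [Equiv.Perm.sign_swap hne, Matrix.submatrix_submatrix] at this
    simpa using this
  rw [isQAntisymm_iff, isAdjEigen_RHat_iff h]
  refine ⟨fun k l hkl => h1 k l (by rintro rfl; omega), fun k l hkl I => ?_⟩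
  have hne : k ≠ l := by rintro rfl; omega
  rw [zero_mul]
  have key : ∀ p : Fin N × Fin N, ((1 : Matrix (Fin N) (Fin N) ℂ).submatrix
        (Function.update (Function.update I k p.swap.1) l p.swap.2) id).det
      = -((1 : Matrix (Fin N) (Fin N) ℂ).submatrix
        (Function.update (Function.update I k p.1) l p.2) id).det := by
    intro p
    rw [← h1 k l hne]
    congr 2
    funext m
    simp only [Function.comp_apply, Equiv.swap_apply_def, Function.update_apply, Prod.fst_swap,
      Prod.snd_swap]
    split_ifs <;> simp_all
  -- The contraction of a symmetric form with a tensor antisymmetric in the same two slots equals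
  -- its own negative.
  have h2 : ∀ S : ℂ, S = -S → S = 0 := fun S hS => by linear_combination (1 / 2) * hS
  apply h2
  conv_lhs => rw [← Equiv.sum_comp (Equiv.prodComm (Fin N) (Fin N))]
  rw [← Finset.sum_neg_distrib]
  refine Finset.sum_congr rfl fun p _ => ?_
  beta_reduce
  rw [Equiv.prodComm_apply, key, mul_neg]
  congr 2
  exact congrFun (congrFun (metric_transpose_of_sq_eq_one (N := N) h) p.1) p.2

/-- RTT becomes commutativity and is automatic over ℂ, and the second metric relation follows from
the first by inverting X. Testing the determinant relation on the sign tensor gives det X = 1;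
conversely every antisymmetric tensor is scaled by det X. -/
lemma isQOrthogonal_iff_of_sq_eq_one [NeZero r] (h : r ^ 2 = 1) (X : Matrix (Fin N) (Fin N) ℂ) :
    IsQOrthogonal r X ↔ Xᵀ * metric N r * X = metric N r ∧ X.det = 1 := by
  have hs : ∀ {m : Type} (X : Matrix m m ℂ), scalarMat ℂ X = X := fun X => by ext; simp [scalarMat]
  constructor
  · intro hX
    have h1 := hX.ctt
    rw [hs] at h1
    have h2 := congrFun (hX.det _ (isQAntisymm_det h)) id
    have h3 := tensorPow_mulVec_of_antisymm
      ((isAdjEigen_RHat_iff h).mp (isQAntisymm_iff.mp (isQAntisymm_det (N := N) h)).1) X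
    simp only [Algebra.algebraMap_self, RingHom.id_apply] at h2
    rw [h3] at h2
    simp only [Pi.smul_apply, Matrix.submatrix_id_id, Matrix.det_one, smul_eq_mul, mul_one] at h2
    exact ⟨h1, h2⟩
  · rintro ⟨h1, h2⟩
    have h3 : X * (metric N r * Xᵀ * metric N r) = 1 := by
      rw [mul_eq_one_comm, mul_assoc, mul_assoc, ← mul_assoc Xᵀ, h1, metric_mul_self]
    refine ⟨?_, ?_, ?_, ?_⟩
    · rw [hs, RMatrix_of_sq_eq_one h, one_mul, mul_one, prodTwoOne_eq_prodOneTwo]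
    · rw [hs]
      calc X * metric N r * Xᵀ
          = X * (metric N r * Xᵀ * metric N r) * metric N r := by
            simp only [mul_assoc, metric_mul_self, mul_one]
        _ = _ := by rw [h3, one_mul]
    · rw [hs, h1]
    · intro ε hε
      simp only [Algebra.algebraMap_self, RingHom.id_apply]
      rw [tensorPow_mulVec_of_antisymm ((isAdjEigen_RHat_iff h).mp (isQAntisymm_iff.mp hε).1), h2,
        one_smul]

end Classical

/-! ### Real points and indefinite orthogonal groups -/

section RealForms

variable {N : ℕ} {r : ℂ}

/-- A real matrix indexed by `Fin l ⊕ Fin m`, as a complex matrix indexed by `Fin N`. -/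
noncomputable def complexify {l m : ℕ} (e : Fin l ⊕ Fin m ≃ Fin N)
    (g : Matrix (Fin l ⊕ Fin m) (Fin l ⊕ Fin m) ℝ) : Matrix (Fin N) (Fin N) ℂ :=
  (g.map Complex.ofReal).submatrix e.symm e.symm

lemma complexify_mul {l m : ℕ} (e : Fin l ⊕ Fin m ≃ Fin N)
    (g h : Matrix (Fin l ⊕ Fin m) (Fin l ⊕ Fin m) ℝ) :
    complexify e (g * h) = complexify e g * complexify e h := by
  rw [complexify, complexify, complexify, Matrix.submatrix_mul_equiv]
  congr 1
  exact Matrix.map_mul (f := Complex.ofRealHom)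

lemma complexify_one {l m : ℕ} (e : Fin l ⊕ Fin m ≃ Fin N) : complexify e 1 = 1 := by
  rw [complexify, Matrix.map_one _ Complex.ofReal_zero Complex.ofReal_one,
    Matrix.submatrix_one_equiv]

lemma complexify_injective {l m : ℕ} (e : Fin l ⊕ Fin m ≃ Fin N) :
    Function.Injective (complexify e) := by
  intro g h hgh
  ext i j
  have := congrFun (congrFun hgh (e i)) (e j)
  simpa [complexify] using this

lemma complexify_transpose {l m : ℕ} (e : Fin l ⊕ Fin m ≃ Fin N)
    (g : Matrix (Fin l ⊕ Fin m) (Fin l ⊕ Fin m) ℝ) :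
    (complexify e g)ᵀ = complexify e gᵀ := rfl

lemma det_complexify {l m : ℕ} (e : Fin l ⊕ Fin m ≃ Fin N)
    (g : Matrix (Fin l ⊕ Fin m) (Fin l ⊕ Fin m) ℝ) :
    (complexify e g).det = (g.det : ℂ) := by
  rw [complexify, Matrix.det_submatrix_equiv_self]
  exact (RingHom.map_det Complex.ofRealHom g).symm

lemma complexify_conj {l m : ℕ} (e : Fin l ⊕ Fin m ≃ Fin N)
    (g : Matrix (Fin l ⊕ Fin m) (Fin l ⊕ Fin m) ℝ) :
    (complexify e g).map (starRingEnd ℂ) = complexify e g := by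
  ext a b
  simp [complexify]

lemma exists_complexify {l m : ℕ} (e : Fin l ⊕ Fin m ≃ Fin N) {X : Matrix (Fin N) (Fin N) ℂ}
    (hX : X.map (starRingEnd ℂ) = X) : ∃ g, complexify e g = X := by
  refine ⟨Matrix.of fun i j => (X (e i) (e j)).re, ?_⟩
  ext a b
  have := congrFun (congrFun hX a) b
  simpa [complexify] using Complex.conj_eq_iff_re.mp this

lemma complexify_indefiniteDiagonal {l m : ℕ} (e : Fin l ⊕ Fin m ≃ Fin N) :
    complexify e (LieAlgebra.Orthogonal.indefiniteDiagonal (Fin l) (Fin m) ℝ)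
      = (LieAlgebra.Orthogonal.indefiniteDiagonal (Fin l) (Fin m) ℂ).submatrix e.symm e.symm := by
  rw [complexify]
  congr 1
  rw [LieAlgebra.Orthogonal.indefiniteDiagonal, LieAlgebra.Orthogonal.indefiniteDiagonal,
    Matrix.diagonal_map Complex.ofReal_zero]
  congr 1
  funext i
  rcases i with i | i <;> simp

lemma scalarMat_complex {m : Type*} (X : Matrix m m ℂ) : scalarMat ℂ X = X := by
  ext; simp [scalarMat]

lemma SOq.map_twist_complex (χ : SOq N r →ₐ[ℂ] ℂ) (X Y : Matrix (Fin N) (Fin N) ℂ) :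
    (SOq.twist r X Y).map χ = X * (SOq.T N r).map χ * Y := by
  rw [SOq.twist, algHom_map_scalarMat_mul_mul, scalarMat_complex, scalarMat_complex]

/-- The real points are detected on a matrix of self-conjugate coordinates. -/
lemma mem_realPoints_iff [NeZero r] {st : SOq N r →ₛₗ[starRingEnd ℂ] SOq N r}
    (hst : IsStarStructure st) {M M' : Matrix (Fin N) (Fin N) ℂ} (hM : M * M' = 1)
    (hfix : (SOq.twist r M M').map st = SOq.twist r M M') (χ : WithConv (SOq N r →ₐ[ℂ] ℂ)) :
    χ ∈ realPoints st ↔ (M * (SOq.T N r).map χ * M').map (starRingEnd ℂ)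
      = M * (SOq.T N r).map χ * M' := by
  have hM' : M' * M = 1 := mul_eq_one_comm.mp hM
  have hχ : ∀ X Y : Matrix (Fin N) (Fin N) ℂ,
      (SOq.twist r X Y).map χ = X * (SOq.T N r).map χ * Y := SOq.map_twist_complex χ.ofConv
  constructor
  · intro h
    rw [← hχ]
    conv_rhs => rw [← hfix]
    ext a b
    exact (h _).symm
  · intro h f
    have hmulχ : ∀ x y, χ (x * y) = χ x * χ y := map_mul χ.ofConv
    have haddχ : ∀ x y, χ (x + y) = χ x + χ y := map_add χ.ofConv
    have hcχ : ∀ c : ℂ, χ (algebraMap ℂ _ c) = c := χ.ofConv.commutes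
    induction f using SOq.induction with
    | hs c => rw [hst.map_algebraMap, hcχ, hcχ]
    | hT a b =>
      -- The generators are complex combinations of the self-conjugate coordinates, so reality of
      -- the values on those coordinates determines the condition on T.
      have h1 : SOq.T N r
          = scalarMat (SOq N r) M' * SOq.twist r M M' * scalarMat (SOq N r) M := by
        rw [SOq.scalarMat_mul_twist_mul, hM', SOq.twist_one]
      have h2 : (SOq.T N r).map st
          = SOq.twist r (M'.map (starRingEnd ℂ) * M) (M' * M.map (starRingEnd ℂ)) := by
        conv_lhs => rw [h1]
        rw [map_scalarMat_mul_mul, hfix, SOq.scalarMat_mul_twist_mul]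
      have h3 : ((SOq.T N r).map st).map χ = ((SOq.T N r).map χ).map (starRingEnd ℂ) := by
        rw [h2, hχ]
        calc _ = M'.map (starRingEnd ℂ) * (M * (SOq.T N r).map χ * M') * M.map (starRingEnd ℂ) := by
              simp only [mul_assoc]
          _ = (M' * (M * (SOq.T N r).map χ * M') * M).map (starRingEnd ℂ) := by
              rw [Matrix.map_mul, Matrix.map_mul, h]
          _ = _ := by
              rw [← mul_assoc, ← mul_assoc, hM', one_mul, mul_assoc, hM', mul_one]
      exact congrFun (congrFun h3 a) b
    | hm x y hx hy => rw [hst.map_mul, hmulχ, hmulχ, hx, hy, map_mul, mul_comm]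
    | ha x y hx hy => rw [map_add, haddχ, haddχ, hx, hy, map_add]

/-- Conjugation by M leaves the determinant alone and carries the form C to the diagonal form, whose
entries are real, so the complex equations are the real ones read in ℂ. -/
lemma isQOrthogonal_conj_complexify [NeZero r] (h : r ^ 2 = 1) {l m : ℕ}
    {M M' : Matrix (Fin N) (Fin N) ℂ} (hM : M * M' = 1) (e : Fin l ⊕ Fin m ≃ Fin N)
    (hC : M'ᵀ * metric N r * M'
      = (LieAlgebra.Orthogonal.indefiniteDiagonal (Fin l) (Fin m) ℂ).submatrix e.symm e.symm)
    (g : Matrix (Fin l ⊕ Fin m) (Fin l ⊕ Fin m) ℝ) :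
    IsQOrthogonal r (M' * complexify e g * M) ↔ g ∈ specialOrthogonal l m := by
  have hM' : M' * M = 1 := mul_eq_one_comm.mp hM
  have hMt : Mᵀ * M'ᵀ = 1 := by rw [← Matrix.transpose_mul, hM', Matrix.transpose_one]
  have hMt' : M'ᵀ * Mᵀ = 1 := by rw [← Matrix.transpose_mul, hM, Matrix.transpose_one]
  rw [isQOrthogonal_iff_of_sq_eq_one h]
  rw [← complexify_indefiniteDiagonal] at hC
  have hdet : (M' * complexify e g * M).det = (g.det : ℂ) := by
    rw [mul_assoc, Matrix.det_mul_comm, mul_assoc, hM, mul_one, det_complexify]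
  have h1 : M'ᵀ * ((M' * complexify e g * M)ᵀ * metric N r * (M' * complexify e g * M)) * M'
      = complexify e (gᵀ * LieAlgebra.Orthogonal.indefiniteDiagonal (Fin l) (Fin m) ℝ * g) := by
    rw [complexify_mul, complexify_mul, ← hC, ← complexify_transpose, Matrix.transpose_mul,
      Matrix.transpose_mul]
    calc _ = (M'ᵀ * Mᵀ) * (complexify e g)ᵀ * (M'ᵀ * metric N r * M') * complexify e g
          * (M * M') := by simp only [mul_assoc]
      _ = _ := by rw [hM, hMt', one_mul, mul_one]
  have h2 : ∀ X Y : Matrix (Fin N) (Fin N) ℂ, M'ᵀ * X * M' = M'ᵀ * Y * M' → X = Y := by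
    intro X Y hXY
    have := congrArg (fun Z => Mᵀ * Z * M) hXY
    simpa only [← mul_assoc, hMt, one_mul, mul_assoc _ M' M, hM', mul_one] using this
  change _ ↔ gᵀ * LieAlgebra.Orthogonal.indefiniteDiagonal (Fin l) (Fin m) ℝ * g
      = LieAlgebra.Orthogonal.indefiniteDiagonal (Fin l) (Fin m) ℝ ∧ g.det = 1
  rw [hdet]
  refine and_congr ⟨fun h3 => complexify_injective e ?_, fun h3 => h2 _ _ ?_⟩ (by norm_cast)
  · rw [← h1, h3, hC]
  · rw [h1, h3, hC]

/-- A real matrix g corresponds to the character with T ↦ M⁻¹ g M. Since Δ(T) = T ⊗ T, convolution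
of characters is matrix multiplication. A real point has real values on the coordinates M T M⁻¹,
hence comes from some g. -/
lemma givesRealForm_of_fixed [NeZero r] (h : r ^ 2 = 1) {l m : ℕ}
    {st : SOq N r →ₛₗ[starRingEnd ℂ] SOq N r} (hst : IsStarStructure st)
    {M M' : Matrix (Fin N) (Fin N) ℂ} (hM : M * M' = 1) (e : Fin l ⊕ Fin m ≃ Fin N)
    (hC : M'ᵀ * metric N r * M'
      = (LieAlgebra.Orthogonal.indefiniteDiagonal (Fin l) (Fin m) ℂ).submatrix e.symm e.symm)
    (hfix : (SOq.twist r M M').map st = SOq.twist r M M') :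
    GivesRealForm l m st := by
  have hM' : M' * M = 1 := mul_eq_one_comm.mp hM
  have hinv : M⁻¹ = M' := Matrix.inv_eq_right_inv hM
  have hQ := isQOrthogonal_conj_complexify h hM e hC
  let Φ : specialOrthogonal l m → WithConv (SOq N r →ₐ[ℂ] ℂ) := fun g =>
    WithConv.toConv (SOq.lift (M' * complexify e g.1 * M) ((hQ g.1).mpr g.2))
  have hΦT : ∀ g, (SOq.T N r).map (Φ g) = M' * complexify e g.1 * M := by
    intro g
    ext a b
    exact SOq.lift_T _ ((hQ g.1).mpr g.2) a b
  have hext : ∀ χ ψ : WithConv (SOq N r →ₐ[ℂ] ℂ),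
      (SOq.T N r).map χ = (SOq.T N r).map ψ → χ = ψ := by
    intro χ ψ hχ
    apply WithConv.ofConv_injective
    exact SOq.algHom_ext fun a b => congrFun (congrFun hχ a) b
  have hMΦ : ∀ g, M * (SOq.T N r).map (Φ g) * M' = complexify e g.1 := by
    intro g
    rw [hΦT, ← mul_assoc, ← mul_assoc, hM, one_mul, mul_assoc, hM, mul_one]
  refine ⟨e, M, ?_, ?_, ?_, ⟨⟨Φ, ?_⟩, ?_⟩, ?_, ?_, ?_⟩
  · exact (Matrix.isUnit_iff_isUnit_det M).mp (IsUnit.of_mul_eq_one _ hM)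
  · rw [hinv]; exact hfix
  · rw [hinv]; exact hC
  · refine hext _ _ ?_
    rw [hΦT]
    ext a b
    rw [Matrix.map_apply, AlgHom.convOne_apply, SOq.counit_T]
    change (M' * complexify e 1 * M) a b = _
    rw [complexify_one, mul_one, hM']
    rfl
  · intro g g'
    refine hext _ _ ?_
    change (SOq.T N r).map (Φ (g * g')) = (SOq.T N r).map (Φ g * Φ g')
    have h1 : (SOq.T N r).map (Φ g * Φ g') = (SOq.T N r).map (Φ g) * (SOq.T N r).map (Φ g') := by
      ext a b
      rw [Matrix.map_apply, AlgHom.convMul_apply, SOq.comul_T, Matrix.mul_apply]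
      simp
    rw [h1, hΦT, hΦT, hΦT]
    change M' * complexify e (g.1 * g'.1) * M = _
    rw [complexify_mul]
    calc _ = M' * complexify e g.1 * 1 * complexify e g'.1 * M := by simp only [mul_assoc, one_mul]
      _ = _ := by rw [← hM]; simp only [mul_assoc]
  · intro g g' hgg
    apply Subtype.ext
    apply complexify_injective e
    rw [← hMΦ, ← hMΦ]
    exact congrArg (fun χ : WithConv (SOq N r →ₐ[ℂ] ℂ) => M * (SOq.T N r).map χ * M') hgg
  · ext χ
    constructor
    · rintro ⟨g, rfl⟩
      change Φ g ∈ realPoints st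
      rw [mem_realPoints_iff hst hM hfix, hMΦ, complexify_conj]
    · intro hχ
      rw [mem_realPoints_iff hst hM hfix] at hχ
      obtain ⟨g, hg⟩ := exists_complexify e hχ
      have h1 : (SOq.T N r).map χ = M' * complexify e g * M := by
        rw [hg, ← mul_assoc, ← mul_assoc, hM', one_mul, mul_assoc, hM', mul_one]
      have h2 : IsQOrthogonal r ((SOq.T N r).map χ) := SOq.isQOrthogonal_T.map χ.ofConv
      rw [h1, hQ] at h2
      refine ⟨⟨g, h2⟩, hext _ _ ?_⟩
      rw [h1]
      exact hΦT ⟨g, h2⟩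
  · intro g
    rw [hinv]
    exact hMΦ g

/-- A star structure `T ↦ K T K⁻¹` such that a real orthogonal symmetric matrix `O` diagonalizes
both `C` (with signs `σ`) and `K` (with signs `τ`). -/
lemma givesRealForm_of_diagonalized [NeZero r] (h : r ^ 2 = 1) {l m : ℕ}
    {st : SOq N r →ₛₗ[starRingEnd ℂ] SOq N r} (hst : IsStarStructure st)
    {K L O : Matrix (Fin N) (Fin N) ℂ} (hT : (SOq.T N r).map st = SOq.twist r K L)
    (hKL : K * L = 1) (hO : O.map (starRingEnd ℂ) = O) (hOt : Oᵀ = O) (hOO : O * O = 1)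
    {σ τ : Fin N → ℂ} (hτ : ∀ a, τ a = 1 ∨ τ a = -1) (hστ : ∀ a, σ a * τ a = 1 ∨ σ a * τ a = -1)
    (hOC : O * metric N r = Matrix.diagonal σ * O) (hOK : O * K = Matrix.diagonal τ * O)
    (hcard : (Finset.univ.filter fun a => σ a * τ a = 1).card = l) (hlm : l + m = N) :
    GivesRealForm l m st := by
  classical
  -- Row scaling by a unit s with s̄ τ = s makes the coordinates self-conjugate; the factor s̄² = τ
  -- then multiplies the signs of the metric.
  let s : Fin N → ℂ := fun a => if τ a = 1 then 1 else Complex.I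
  have hs1 : ∀ a, starRingEnd ℂ (s a) * τ a = s a := fun a => by
    rcases hτ a with h1 | h1
    · simp [s, h1]
    · have : (-1 : ℂ) ≠ 1 := by norm_num
      simp [s, h1, this]
  have hs2 : ∀ a, s a * starRingEnd ℂ (s a) = 1 := fun a => by
    by_cases h1 : τ a = 1 <;> simp [s, h1]
  have hs3 : ∀ a, starRingEnd ℂ (s a) * starRingEnd ℂ (s a) = τ a := fun a => by
    rcases hτ a with h1 | h1
    · simp [s, h1]
    · have : (-1 : ℂ) ≠ 1 := by norm_num
      simp [s, h1, this]
  set M := Matrix.diagonal s * O with hMdef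
  set M' := O * Matrix.diagonal (fun a => starRingEnd ℂ (s a)) with hM'def
  have hMM : M * M' = 1 := by
    rw [hMdef, hM'def, mul_assoc, ← mul_assoc O, hOO, one_mul, Matrix.diagonal_mul_diagonal]
    simp [hs2]
  have hMK : M.map (starRingEnd ℂ) * K = M := by
    rw [hMdef, Matrix.map_mul, hO, mul_assoc, hOK, ← mul_assoc,
      Matrix.diagonal_map (map_zero _), Matrix.diagonal_mul_diagonal]
    congr 2
    funext a
    exact hs1 a
  have hfix : (SOq.twist r M M').map st = SOq.twist r M M' := by
    rw [SOq.semilinear_map_twist st hT, hMK]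
    congr 1
    have h1 : M.map (starRingEnd ℂ) * M'.map (starRingEnd ℂ) = 1 := by
      rw [← Matrix.map_mul, hMM, Matrix.map_one _ (map_zero _) (map_one _)]
    have h2 : M * (L * M'.map (starRingEnd ℂ)) = 1 := by
      conv_lhs => rw [← hMK]
      rw [mul_assoc, ← mul_assoc K, hKL, one_mul, h1]
    calc L * M'.map (starRingEnd ℂ) = M' * M * (L * M'.map (starRingEnd ℂ)) := by
          rw [mul_eq_one_comm.mp hMM, one_mul]
      _ = _ := by rw [mul_assoc, h2, mul_one]
  have hC : M'ᵀ * metric N r * M' = Matrix.diagonal fun a => σ a * τ a := by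
    rw [hM'def, Matrix.transpose_mul, hOt, Matrix.diagonal_transpose, mul_assoc _ O, hOC, mul_assoc,
      mul_assoc, ← mul_assoc O, hOO, one_mul, Matrix.diagonal_mul_diagonal,
      Matrix.diagonal_mul_diagonal]
    congr 1
    funext a
    rw [← hs3 a]
    ring
  have hc1 : Fintype.card {a // σ a * τ a = 1} = l := by rw [Fintype.card_subtype, hcard]
  have hc2 : Fintype.card {a // ¬ σ a * τ a = 1} = m := by
    rw [Fintype.card_subtype_compl, hc1, Fintype.card_fin]
    omega
  -- The indices with sign +1 fill the first summand, those with sign -1 the second.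
  let e : Fin l ⊕ Fin m ≃ Fin N :=
    (Equiv.sumCongr (Fintype.equivFinOfCardEq hc1).symm (Fintype.equivFinOfCardEq hc2).symm).trans
      (Equiv.sumCompl fun a => σ a * τ a = 1)
  refine givesRealForm_of_fixed h hst hMM e ?_ hfix
  rw [hC, LieAlgebra.Orthogonal.indefiniteDiagonal, Matrix.submatrix_diagonal_equiv]
  congr 1
  funext a
  obtain ⟨i, rfl⟩ := e.surjective a
  rw [Function.comp_apply, Equiv.symm_apply_apply]
  rcases i with i | i
  · exact ((Fintype.equivFinOfCardEq hc1).symm i).2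
  · exact (hστ _).resolve_left ((Fintype.equivFinOfCardEq hc2).symm i).2

end RealForms
-- Simultaneous diagonalization of C and 𝒟, and signatures
section Diagonalization

variable {N : ℕ} {r : ℂ}

/-- The sign of an index different from its conjugate. -/
def halfSign (a : Fin N) : ℂ := if a < a.rev then 1 else -1

/-- The real symmetric orthogonal matrix whose rows are `(e_a + e_{a'}) / √2` for `a < a'`,
`(e_{a'} - e_a) / √2` for `a > a'`, and the middle basis vector. -/
noncomputable def hadamard (N : ℕ) : Matrix (Fin N) (Fin N) ℂ :=
  Matrix.of fun a b => if a = a.rev then (if b = a then 1 else 0)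
    else ((√2)⁻¹ : ℝ) * ((if b = a then halfSign a else 0) + if b = a.rev then 1 else 0)

lemma hadamard_apply_of_eq {a : Fin N} (h : a = a.rev) (b : Fin N) :
    hadamard N a b = if b = a then 1 else 0 := by
  rw [hadamard, Matrix.of_apply, if_pos h]

lemma hadamard_apply_of_ne {a : Fin N} (h : ¬ a = a.rev) (b : Fin N) :
    hadamard N a b = ((√2)⁻¹ : ℝ)
      * ((if b = a then halfSign a else 0) + if b = a.rev then 1 else 0) := by
  rw [hadamard, Matrix.of_apply, if_neg h]

lemma sum_hadamard_mul (a : Fin N) (G : Fin N → ℂ) :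
    ∑ c, hadamard N a c * G c = if a = a.rev then G a
      else ((√2)⁻¹ : ℝ) * (halfSign a * G a + G a.rev) := by
  simp only [hadamard, Matrix.of_apply]
  split_ifs with h
  · simp
  · simp [mul_assoc, add_mul, Finset.sum_add_distrib, ← Finset.mul_sum]

lemma halfSign_rev {a : Fin N} (h : a ≠ a.rev) : halfSign a.rev = -halfSign a := by
  unfold halfSign
  rw [Fin.rev_rev]
  rcases lt_or_gt_of_ne h with h | h
  · simp [h, h.not_gt]
  · simp [h, h.not_gt]

lemma halfSign_mul_self (a : Fin N) : halfSign a * halfSign a = 1 := by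
  unfold halfSign
  split_ifs <;> simp

lemma halfSign_conj (a : Fin N) : starRingEnd ℂ (halfSign a) = halfSign a := by
  unfold halfSign
  split_ifs <;> simp

lemma hadamard_conj (N : ℕ) : (hadamard N).map (starRingEnd ℂ) = hadamard N := by
  ext a b
  simp only [hadamard, Matrix.map_apply, Matrix.of_apply, apply_ite (starRingEnd ℂ), map_mul,
    map_add, halfSign_conj, map_one, map_zero, Complex.conj_ofReal]

lemma hadamard_transpose (N : ℕ) : (hadamard N)ᵀ = hadamard N := by
  ext a b
  simp only [hadamard, Matrix.transpose_apply, Matrix.of_apply]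
  by_cases h1 : a = b
  · rw [h1]
  · by_cases h2 : a = b.rev
    · have h3 : b = a.rev := by rw [h2, Fin.rev_rev]
      have h4 : b ≠ b.rev := fun h => h1 (h2.trans h.symm)
      have h5 : a ≠ a.rev := fun h => h1 (h.trans h3.symm)
      have h6 : b ≠ a := Ne.symm h1
      rw [if_neg h4, if_neg h5, if_neg h1, if_neg h6, if_pos h2, if_pos h3]
    · have h3 : b ≠ a.rev := fun h => h2 (by rw [h, Fin.rev_rev])
      have h6 : b ≠ a := Ne.symm h1
      simp [h1, h2, h3, h6]

lemma hadamard_mul_self (N : ℕ) : hadamard N * hadamard N = 1 := by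
  have hκ : (((√2)⁻¹ : ℝ) : ℂ) * (((√2)⁻¹ : ℝ) : ℂ) = 1 / 2 := by
    rw [← Complex.ofReal_mul, ← mul_inv, Real.mul_self_sqrt (by norm_num)]
    norm_num
  ext a b
  rw [Matrix.mul_apply, sum_hadamard_mul]
  by_cases h : a = a.rev
  · rw [if_pos h, hadamard_apply_of_eq h, Matrix.one_apply]
    exact if_congr eq_comm rfl rfl
  · have h' : ¬ a.rev = a.rev.rev := fun h' => h (Fin.rev_injective h')
    have hs := halfSign_mul_self a
    rw [if_neg h, hadamard_apply_of_ne h, hadamard_apply_of_ne h', Fin.rev_rev, halfSign_rev h,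
      Matrix.one_apply]
    by_cases h1 : b = a
    · subst h1
      simp only [if_true, if_neg h]
      linear_combination (1 + halfSign b * halfSign b) * hκ + (1 / 2) * hs
    · by_cases h2 : b = a.rev
      · rw [if_neg h1, if_pos h2, if_pos h2, if_neg h1, if_neg (Ne.symm h1)]
        ring
      · simp [h1, h2, Ne.symm h1]

/-- Here r = ±1, so only the parity of 2ρ_a matters, and off the middle it is the parity of N. The
case r = -1 with N odd is why r^N is kept. -/
lemma metric_apply_of_sq_eq_one (h : r ^ 2 = 1) (a b : Fin N) :
    metric N r a b = if b = a.rev then (if a = a.rev then 1 else r ^ N) else 0 := by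
  have hr : r ≠ 0 := by
    rintro rfl
    simp at h
  have hz : ∀ k : ℤ, r ^ (2 * k) = 1 := fun k => by
    rw [zpow_mul]
    have : r ^ (2 : ℤ) = 1 := by exact_mod_cast h
    rw [this, one_zpow]
  rw [metric, Matrix.of_apply]
  refine if_congr Iff.rfl ?_ rfl
  by_cases ha : a = a.rev
  · have : twoRho a = 0 := by
      have := twoRho_rev a
      rw [← ha] at this
      omega
    simp [← ha, this]
  · rw [if_neg ha, ← zpow_natCast]
    have : ∃ k : ℤ, -twoRho a = N + 2 * k := by
      unfold twoRho
      split_ifs with h1 h2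
      · exact ⟨1 + a - N, by ring⟩
      · exact ⟨-1 - (a.rev : ℕ), by ring⟩
      · exact absurd (le_antisymm (not_lt.mp h2) (not_lt.mp h1)) ha
    obtain ⟨k, hk⟩ := this
    rw [hk, zpow_add₀ hr, hz, mul_one]

/-- The eigenvalues of the metric at `q = 1`. -/
noncomputable def metricSign (N : ℕ) (r : ℂ) (a : Fin N) : ℂ :=
  if a = a.rev then 1 else halfSign a * r ^ N

lemma hadamard_mul_metric (h : r ^ 2 = 1) :
    hadamard N * metric N r = Matrix.diagonal (metricSign N r) * hadamard N := by
  ext a b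
  rw [Matrix.mul_apply, sum_hadamard_mul, Matrix.diagonal_mul]
  simp only [metric_apply_of_sq_eq_one h, metricSign, hadamard, Matrix.of_apply, Fin.rev_rev]
  by_cases ha : a = a.rev
  · simp [← ha]
  · have ha' : ¬ a.rev = a := fun h => ha h.symm
    have hs := halfSign_mul_self a
    simp only [ha, ha', if_false]
    by_cases h1 : b = a
    · subst h1
      simp only [ha, if_true, if_false]
      linear_combination (-(((√2)⁻¹ : ℝ) : ℂ) * r ^ N) * hs
    · simp only [h1, if_false]
      split_ifs <;> ring

/-- The eigenvalues of `𝒟`. -/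
def dSign (N : ℕ) (a : Fin N) : ℂ := if (a : ℕ) = N / 2 then -1 else 1

/-- For N = 2n the only row on which the middle exchange acts by -1 is the antisymmetric combination
of the middle pair, stored at index n. For N = 2n + 1 it is the middle basis vector, also at index
n. -/
lemma hadamard_mul_dMatrix (hN : 1 ≤ N) :
    hadamard N * dMatrix N = Matrix.diagonal (dSign N) * hadamard N := by
  ext a b
  rw [Matrix.mul_apply, sum_hadamard_mul, Matrix.diagonal_mul]
  have hrev : ∀ a b : Fin N, a = b.rev ↔ (a : ℕ) + b + 1 = N := fun a b => by
    rw [Fin.ext_iff, Fin.val_rev]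
    omega
  by_cases h : Even N
  · obtain ⟨n, hn⟩ := h
    have ha : ¬ a = a.rev := by
      rw [hrev]
      omega
    have hn2 : N / 2 = n := by omega
    rw [if_neg ha, hadamard_apply_of_ne ha]
    simp only [dMatrix, dSign, Matrix.of_apply, show Even N from ⟨n, hn⟩,
      if_true, hn2, hrev, halfSign, Fin.lt_def, Fin.val_rev]
    simp only [Fin.ext_iff, Fin.val_rev]
    generalize (((√2)⁻¹ : ℝ) : ℂ) = κ
    have hb := b.2
    split_ifs <;> first | (exfalso; omega) | ring1
  · have hN2 := Nat.not_even_iff.mp h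
    have hd : ∀ a : Fin N, (if a = a.rev then (-1 : ℂ) else 1) = dSign N a := fun a => by
      rw [dSign]
      refine if_congr ?_ rfl rfl
      rw [hrev]
      omega
    simp only [dMatrix_of_odd h, Matrix.diagonal_apply, hd]
    by_cases ha : a = a.rev
    · rw [if_pos ha, hadamard_apply_of_eq ha, mul_ite, mul_one, mul_zero]
      exact if_congr eq_comm rfl rfl
    · have hd1 : dSign N a = 1 := by rw [← hd, if_neg ha]
      have hd2 : dSign N a.rev = 1 := by
        rw [← hd, if_neg]
        rw [Fin.rev_rev]
        exact fun h => ha h.symm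
      rw [if_neg ha, hadamard_apply_of_ne ha, hd1, hd2, one_mul, mul_ite, mul_one, mul_zero]
      congr 2
      · exact if_congr eq_comm rfl rfl
      · exact if_congr eq_comm rfl rfl

lemma dSign_eq (a : Fin N) : dSign N a = 1 ∨ dSign N a = -1 := by
  unfold dSign
  split_ifs <;> simp

lemma metricSign_eq (h : r ^ 2 = 1) (a : Fin N) :
    metricSign N r a = 1 ∨ metricSign N r a = -1 := by
  have h1 : metricSign N r a * metricSign N r a = 1 := by
    unfold metricSign
    split_ifs
    · simp
    · calc halfSign a * r ^ N * (halfSign a * r ^ N)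
          = halfSign a * halfSign a * (r ^ 2) ^ N := by ring
        _ = 1 := by rw [halfSign_mul_self, h, one_pow, one_mul]
  exact mul_self_eq_one_iff.mp h1

lemma metricSign_mul_self (h : r ^ 2 = 1) (a : Fin N) :
    metricSign N r a * metricSign N r a = 1 := by
  rcases metricSign_eq h a with h | h <;> rw [h] <;> norm_num

lemma mul_sign_eq {x y : ℂ} (hx : x = 1 ∨ x = -1) (hy : y = 1 ∨ y = -1) :
    x * y = 1 ∨ x * y = -1 := by
  rcases hx with rfl | rfl <;> rcases hy with rfl | rfl <;> simp

lemma card_filter_val_lt_of_le {k : ℕ} (hk : k ≤ N) :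
    (Finset.univ.filter fun a : Fin N => (a : ℕ) < k).card = k := by
  rw [Fin.card_filter_val_lt, min_eq_right hk]

lemma card_filter_le_val {k : ℕ} (hk : k ≤ N) :
    (Finset.univ.filter fun a : Fin N => ¬ (a : ℕ) < k).card = N - k := by
  have h := Finset.card_filter_add_card_filter_not (s := (Finset.univ : Finset (Fin N)))
    (fun a => (a : ℕ) < k)
  rw [card_filter_val_lt_of_le hk, Finset.card_univ, Fintype.card_fin] at h
  omega

lemma card_dSign (hN : 1 ≤ N) : (Finset.univ.filter fun a : Fin N => dSign N a = 1).card = N - 1 := by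
  have h1 : (-1 : ℂ) ≠ 1 := by norm_num
  have : (Finset.univ.filter fun a : Fin N => dSign N a = 1)
      = Finset.univ.erase ⟨N / 2, by omega⟩ := by
    ext a
    simp [dSign, Fin.ext_iff, h1]
  rw [this, Finset.card_erase_of_mem (Finset.mem_univ _), Finset.card_univ, Fintype.card_fin]

lemma metricSign_apply (a : Fin N) : metricSign N r a =
    if 2 * (a : ℕ) + 1 = N then 1 else (if 2 * (a : ℕ) + 1 < N then 1 else -1) * r ^ N := by
  rw [metricSign, halfSign]
  refine if_congr ?_ rfl (congrArg (· * r ^ N) (if_congr ?_ rfl rfl))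
  · rw [Fin.ext_iff, Fin.val_rev]
    omega
  · rw [Fin.lt_def, Fin.val_rev]
    omega

/-- The middle index always has sign +1. It is joined by the first n indices if r = 1 and by the
last n if r = -1, so the count does not depend on the root. -/
lemma card_metricSign_of_odd {n : ℕ} (hn : N = 2 * n + 1) (h : r ^ 2 = 1) :
    (Finset.univ.filter fun a : Fin N => metricSign N r a = 1).card = n + 1 := by
  have h1 : (-1 : ℂ) ≠ 1 := by norm_num
  have hrN : r ^ N = r := by rw [hn, pow_succ, pow_mul, h, one_pow, one_mul]
  rcases mul_self_eq_one_iff.mp ((sq r).symm.trans h) with hr | hr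
  · rw [← card_filter_val_lt_of_le (N := N) (k := n + 1) (by omega)]
    congr 1
    refine Finset.filter_congr fun a _ => ?_
    rw [metricSign_apply, hrN, hr]
    split_ifs <;> simp [h1] <;> omega
  · have h2 := card_filter_le_val (N := N) (k := n) (by omega)
    rw [show n + 1 = N - n by omega, ← h2]
    congr 1
    refine Finset.filter_congr fun a _ => ?_
    rw [metricSign_apply, hrN, hr]
    split_ifs <;> simp [h1] <;> omega

lemma card_metricSign_mul_dSign_of_odd {n : ℕ} (hn : N = 2 * n + 1) (h : r ^ 2 = 1) :
    (Finset.univ.filter fun a : Fin N => metricSign N r a * dSign N a = 1).card = n := by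
  have h1 : (-1 : ℂ) ≠ 1 := by norm_num
  have hrN : r ^ N = r := by rw [hn, pow_succ, pow_mul, h, one_pow, one_mul]
  have hN2 : N / 2 = n := by omega
  rcases mul_self_eq_one_iff.mp ((sq r).symm.trans h) with hr | hr
  · rw [← card_filter_val_lt_of_le (N := N) (k := n) (by omega)]
    congr 1
    refine Finset.filter_congr fun a _ => ?_
    rw [metricSign_apply, hrN, hr, dSign, hN2]
    split_ifs <;> simp [h1] <;> omega
  · have h2 := card_filter_le_val (N := N) (k := n + 1) (by omega)
    rw [show N - (n + 1) = n by omega] at h2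
    rw [← h2]
    congr 1
    refine Finset.filter_congr fun a _ => ?_
    rw [metricSign_apply, hrN, hr, dSign, hN2]
    split_ifs <;> simp [h1] <;> omega

/-- C alone has n positive signs, on the first n indices; 𝒟 changes the sign at index n from -1 to
+1. -/
lemma card_metricSign_mul_dSign_of_even {n : ℕ} (hN : 1 ≤ N) (hn : N = 2 * n) (h : r ^ 2 = 1) :
    (Finset.univ.filter fun a : Fin N => metricSign N r a * dSign N a = 1).card = n + 1 := by
  have h1 : (-1 : ℂ) ≠ 1 := by norm_num
  have hrN : r ^ N = 1 := by rw [hn, pow_mul, h, one_pow]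
  have hN2 : N / 2 = n := by omega
  rw [← card_filter_val_lt_of_le (N := N) (k := n + 1) (by omega)]
  congr 1
  refine Finset.filter_congr fun a _ => ?_
  rw [metricSign_apply, hrN, dSign, hN2]
  split_ifs <;> simp [h1] <;> omega

/-- The real form given by a star structure `T ↦ K T K⁻¹`, when `hadamard N` diagonalizes `K` with
signs `τ`. -/
lemma givesRealForm_of_hadamard [NeZero r] (h : r ^ 2 = 1) {l m : ℕ}
    {st : SOq N r →ₛₗ[starRingEnd ℂ] SOq N r} (hst : IsStarStructure st)
    {K L : Matrix (Fin N) (Fin N) ℂ} (hT : (SOq.T N r).map st = SOq.twist r K L)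
    (hKL : K * L = 1) {τ : Fin N → ℂ} (hτ : ∀ a, τ a = 1 ∨ τ a = -1)
    (hOK : hadamard N * K = Matrix.diagonal τ * hadamard N)
    (hcard : (Finset.univ.filter fun a => metricSign N r a * τ a = 1).card = l) (hlm : l + m = N) :
    GivesRealForm l m st :=
  givesRealForm_of_diagonalized h hst hT hKL (hadamard_conj N) (hadamard_transpose N)
    (hadamard_mul_self N) hτ (fun a => mul_sign_eq (metricSign_eq h a) (hτ a))
    (hadamard_mul_metric h) hOK hcard hlm

end Diagonalization
end QuantumOrthogonal

/-! ### Assembly of the theorem -/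

open QuantumOrthogonal
theorem mainTheorem2 (N : ℕ) (hN : 1 ≤ N) (r : ℂ) [NeZero r] :
    ∃ sharp : SOq N r ≃ₐc[ℂ] SOq N r,
      (∀ x, sharp (sharp x) = x) ∧
      (SOq.T N r).map sharp
        = scalarMat (SOq N r) (dMatrix N) * SOq.T N r * scalarMat (SOq N r) (dMatrix N)⁻¹ ∧
      -- the case of real `q = r ^ 2`
      ((r ^ 2).im = 0 → (Odd N → 0 < (r ^ 2).re) →
        ∃ star : SOq N r →ₛₗ[starRingEnd ℂ] SOq N r,
          IsStarStructure star ∧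
          (SOq.T N r).map star
            = (scalarMat (SOq N r) (metric N r))ᵀ * SOq.T N r
              * (scalarMat (SOq N r) (metric N r))ᵀ ∧
          ∃ starSharp : SOq N r →ₛₗ[starRingEnd ℂ] SOq N r,
            (∀ x, starSharp x = sharp (star x)) ∧
            (∀ x, starSharp x = star (sharp x)) ∧
            IsStarStructure starSharp ∧
            (r ^ 2 = 1 → GivesRealForm N 0 star ∧ GivesRealForm (N - 1) 1 starSharp)) ∧
      -- the case `|q| = 1`
      (‖r ^ 2‖ = 1 →
        ∃ cross : SOq N r →ₛₗ[starRingEnd ℂ] SOq N r,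
          IsStarStructure cross ∧
          (SOq.T N r).map cross = SOq.T N r ∧
          ∃ crossSharp : SOq N r →ₛₗ[starRingEnd ℂ] SOq N r,
            (∀ x, crossSharp x = sharp (cross x)) ∧
            (∀ x, crossSharp x = cross (sharp x)) ∧
            IsStarStructure crossSharp ∧
            (∀ n, N = 2 * n → r ^ 2 = 1 → GivesRealForm (n + 1) (n - 1) crossSharp) ∧
            (∀ n, N = 2 * n + 1 →
              (r ^ 2 = 1 → GivesRealForm n (n + 1) crossSharp ∧ GivesRealForm (n + 1) n cross) ∧
              ∃ α : SOq N r ≃ₐc[ℂ] SOq N r, ∀ x, α (crossSharp x) = cross (α x))) := by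
  have hDD := dMatrix_mul_self hN
  refine ⟨SOq.sharp hN r, SOq.sharp_sharp hN, ?_, ?_, ?_⟩
  · rw [dMatrix_inv hN]
    exact SOq.map_sharp hN
  · intro him hodd
    obtain ⟨st, hst, hT⟩ := SOq.exists_star (N := N) him hodd
    have hVV : (metric N r)ᵀ * (metric N r)ᵀ = 1 := by
      rw [← Matrix.transpose_mul, metric_mul_self, Matrix.transpose_one]
    obtain ⟨hcomm, hss, hTs⟩ := SOq.compStar_sharp hN hst hT
      (congrArg Matrix.transpose (metric_real him hodd).symm) hVV
      (transpose_metric_mul_dMatrix hN r)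
    refine ⟨st, hst, hT, SOq.compStar (SOq.sharp hN r) st, fun _ => rfl, hcomm, hss, fun h => ?_⟩
    have hOC : hadamard N * (metric N r)ᵀ = Matrix.diagonal (metricSign N r) * hadamard N := by
      rw [metric_transpose_of_sq_eq_one h, hadamard_mul_metric h]
    constructor
    -- For ⋆ the matrix K is Cᵗ = C, so τ = σ and every product στ is 1: the form is definite.
    · refine givesRealForm_of_hadamard h hst hT hVV (metricSign_eq h) hOC ?_ (add_zero N)
      simp [metricSign_mul_self h]
    -- With K = Cᵗ𝒟 the signs of C cancel in στ and those of 𝒟 remain, exactly one of which is -1.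
    · refine givesRealForm_of_hadamard h hss hTs (τ := fun a => metricSign N r a * dSign N a) ?_
        (fun a => mul_sign_eq (metricSign_eq h a) (dSign_eq a)) ?_ ?_ (by omega)
      · rw [mul_assoc, ← mul_assoc (dMatrix N), hDD, one_mul, hVV]
      · rw [← mul_assoc, hOC, mul_assoc, hadamard_mul_dMatrix hN, ← mul_assoc,
          Matrix.diagonal_mul_diagonal]
      · simp only [← mul_assoc, metricSign_mul_self h, one_mul]
        exact card_dSign hN
  · intro hnorm
    obtain ⟨st, hst, hT⟩ := SOq.exists_cross (N := N) hnorm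
    obtain ⟨hcomm, hss, hTs⟩ := SOq.compStar_sharp hN hst hT (by simp) (mul_one 1) (by simp)
    rw [one_mul, mul_one] at hTs
    refine ⟨st, hst, by rw [hT, SOq.twist_one], SOq.compStar (SOq.sharp hN r) st, fun _ => rfl,
      hcomm, hss, fun n hn h => ?_, fun n hn => ⟨fun h => ⟨?_, ?_⟩, ?_⟩⟩
    · exact givesRealForm_of_hadamard h hss hTs hDD dSign_eq (hadamard_mul_dMatrix hN)
        (card_metricSign_mul_dSign_of_even hN hn h) (by omega)
    · exact givesRealForm_of_hadamard h hss hTs hDD dSign_eq (hadamard_mul_dMatrix hN)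
        (card_metricSign_mul_dSign_of_odd hn h) (by omega)
    -- For × the matrix K is the identity, so the signature is that of C itself.
    · refine givesRealForm_of_hadamard h hst hT (mul_one 1) (τ := fun _ => 1) (fun _ => Or.inl rfl)
        (by simp) ?_ (by omega)
      simp only [mul_one]
      exact card_metricSign_of_odd hn h
    · refine SOq.exists_intertwiner hN (fun he => ?_) hst hT
      rw [hn] at he
      exact Nat.not_even_two_mul_add_one n he
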